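/- **Setting.** Let $A\subset\mathbb Z^k$ be finite with $0\in A$, $|A|>1$, and $P=\operatorname{conv}(A)$. Let $\mathcal T$ be a star-shaped triangulation of $P$ with vertex set $A$ (every simplex not contained in the boundary of $P$ has $0$ as a vertex). Let $\nu:A\to\mathbb R$ satisfy $\nu(0)=0<\nu(a)$ for $0\ne a\in A$, and suppose that the regular subdivision $\Delta_\nu$ of $P$ defined by $\nu$ is $\mathcal T$. For $a\in A$ and a face $\tau$ of $\Delta_\nu$ (identified with its vertex set) put $$C_a=\{u\in\mathbb R^k\mid a\cdot u-\nu(a)\ge b\cdot u-\nu(b)\ \ \forall b\in A\},\qquad C_\tau=\bigcap_{a\in\tau}C_a .$$ Let $d$ be the distance of a constant Riemannian metric on $\mathbb R^k$. For $\epsilon_2>\epsilon_1>0$, an *$(\epsilon_1,\epsilon_2)$-cut-off family* is a family of smooth functions $\chi_a:\mathbb R^k\to[0,1]$, $a\in A$, such that $\chi_a(p)=1$ if $d(p,C_a)\le\epsilon_1$; $\chi_a(p)=0$ if $d(p,C_a)\ge\epsilon_2$; where $0<\chi_a<1$, $\chi_a$ is strictly decreasing in the radial direction from $C_a$, and the level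 sets $\{\chi_a=\xi\}$, $0<\xi<1$, are convex (they bound the convex regions $\{\chi_a\ge\xi\}$); and for each face $\tau$ and $a\in\tau$, outside a compact set, the level sets $\{\chi_a=\xi\}$, $0<\xi<1$, are parallel to $C_\tau$ at the points $p$ with $\{b\in A\mid d(p,C_b)\le\epsilon_2\}=\tau$. With $\alpha_0=-1$, $\alpha_a=1$ for $a\neq0$, and $\operatorname{Log}_t z=(\log|z_i|/\log t)_i$, put for $t>1$, $s\in[0,1]$, $z\in(\mathbb C^*)^k$ $$f_{t,s}(z)=\sum_{a\in A}\alpha_a\bigl((1-s)+s\,\chi_a(\operatorname{Log}_t z)\bigr)\,t^{-\nu(a)}z^a .$$ Let $\psi:\mathbb R^k\to\mathbb R$ be smooth with positive definite Hessian, regarded as a Kähler potential on $(\mathbb C^*)^k$ through $\rho=(\log|z_i|)_i$, with associated $\theta=-d\psi\circ J$, $\omega=d\theta$, $g=\omega(-,J-)$. Suppose that outside a compact set $\psi$ equals a function $\varphi:\mathbb R^k\to\mathbb R$ with $\varphi(\lambda\rho)=\lambda^2\varphi(\rho)$ for $\lambda>0$, and that $\varphi$ is adapted to the polyhedron $C_0$: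 on each nonempty face of $C_0$ it has a unique minimum point, which lies in the relative interior of that face. **Theorem.** There is $\epsilon_0>0$ such that for all $0<\epsilon_1<\epsilon_2<\epsilon_0$ and every $(\epsilon_1,\epsilon_2)$-cut-off family $(\chi_a)_{a\in A}$ there is $t_0>1$ such that for all $t\ge t_0$: 1. For every $s\in[0,1]$ the set $f_{t,s}^{-1}(0)\subset(\mathbb C^*)^k$ is a smooth symplectic hypersurface, and if $\psi_1$ is the restriction of $\psi$ to it and $Z_1$ its Liouville vector field (the tangent field with $\omega(Z_1,-)=\theta$ on tangent vectors), then $Z_1$ is gradient-like for $\psi_1$: there is a constant $\delta>0$ with $Z_1\psi_1\ge\delta\,(|d\psi_1|_g^2+|Z_1|_g^2)$ on $f_{t,s}^{-1}(0)$. 2. For $s=1$ the function $\psi_1$ is Morse–Bott: its critical set is a closed submanifold (compact; its components may have different dimensions), whose tangent space at each critical point is the kernel of the Hessian of $\psi_1$. Consequently $f_{t,1}^{-1}(0)$ is a Morse–Bott Weinstein manifold: it is symplectic, its Liouville vector field is complete and gradient-like for $\psi_1$, and $\psi_1$ is proper, bounded below and Morse–Bott. -/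

import Mathlib

open scoped ContDiff Topology

noncomputable section

namespace Tailored

/-! ### Polyhedral data of a weighted finite set of lattice points -/

/-- A lattice point, viewed as a point of `ℝ^k`. -/
def latticePt {k : ℕ} (a : Fin k → ℤ) : Fin k → ℝ := fun i => (a i : ℝ)

/-- The convex hull `P` of the finite set `A` of lattice points. -/
def polytope {k : ℕ} (A : Finset (Fin k → ℤ)) : Set (Fin k → ℝ) :=
  convexHull ℝ (latticePt '' (A : Set (Fin k → ℤ)))

/-- The affine function `u ↦ a · u - ν(a)`. -/
def height {k : ℕ} (ν : (Fin k → ℤ) → ℝ) (a : Fin k → ℤ) (u : Fin k → ℝ) : ℝ :=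
  (∑ i, (a i : ℝ) * u i) - ν a

/-- A star-shaped triangulation of `P = conv A` with vertex set `A`: every simplex that is not
contained in the (relative) boundary of `P` has `0` as a vertex. -/
structure IsStarShapedTriangulation {k : ℕ} (A : Finset (Fin k → ℤ))
    (T : Geometry.SimplicialComplex ℝ (Fin k → ℝ)) : Prop where
  space_eq : T.space = polytope A
  vertices_eq : T.vertices = latticePt '' (A : Set (Fin k → ℤ))
  star : ∀ s ∈ T.faces,
    ¬ convexHull ℝ (s : Set (Fin k → ℝ)) ⊆ intrinsicFrontier ℝ (polytope A) →
      (0 : Fin k → ℝ) ∈ s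

/-- `τ` is (the set of elements of `A` on) a face of the subdivision `Δ_ν` of `P`, that is, of a
domain of linearity of the largest convex function on `P` that is at most `ν` on `A`: some affine
function is at most `ν` on `A`, with equality exactly on `τ`. -/
def IsRegularFace {k : ℕ} (A : Finset (Fin k → ℤ)) (ν : (Fin k → ℤ) → ℝ)
    (τ : Finset (Fin k → ℤ)) : Prop :=
  τ.Nonempty ∧ τ ⊆ A ∧ ∃ (u : Fin k → ℝ) (c : ℝ),
    (∀ a ∈ τ, (∑ i, (a i : ℝ) * u i) + c = ν a) ∧
    (∀ a ∈ A, a ∉ τ → (∑ i, (a i : ℝ) * u i) + c < ν a)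

/-- The subdivision `Δ_ν` is the triangulation `T` (in particular every element of `A` is a
vertex of `Δ_ν`, so `ν` is strictly convex on `A`). -/
def Induces {k : ℕ} (A : Finset (Fin k → ℤ)) (ν : (Fin k → ℤ) → ℝ)
    (T : Geometry.SimplicialComplex ℝ (Fin k → ℝ)) : Prop :=
  ∀ s : Finset (Fin k → ℝ), s ∈ T.faces ↔
    ∃ τ, IsRegularFace A ν τ ∧ (s : Set (Fin k → ℝ)) = latticePt '' (τ : Set (Fin k → ℤ))

/-- The cell `C_τ`: all functions `height ν a`, `a ∈ τ`, attain the maximum over `A`. -/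
def cell {k : ℕ} (A : Finset (Fin k → ℤ)) (ν : (Fin k → ℤ) → ℝ) (τ : Finset (Fin k → ℤ)) :
    Set (Fin k → ℝ) :=
  {u | ∀ a ∈ τ, ∀ b ∈ A, height ν b u ≤ height ν a u}

/-- The chamber `C_a`. -/
def chamber {k : ℕ} (A : Finset (Fin k → ℤ)) (ν : (Fin k → ℤ) → ℝ) (a : Fin k → ℤ) :
    Set (Fin k → ℝ) :=
  cell A ν {a}

/-! ### Distances for a constant metric, and cut-off functions -/

/-- The norm on `ℝ^k` given by a positive definite matrix `G`. -/
def metricNorm {k : ℕ} (G : Matrix (Fin k) (Fin k) ℝ) (v : Fin k → ℝ) : ℝ :=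
  Real.sqrt (∑ i, ∑ j, G i j * v i * v j)

/-- The distance of a point to a set for the constant Riemannian metric `G`. -/
def metricDist {k : ℕ} (G : Matrix (Fin k) (Fin k) ℝ) (p : Fin k → ℝ) (S : Set (Fin k → ℝ)) : ℝ :=
  sInf ((fun q => metricNorm G (p - q)) '' S)

/-- The set `τ(p)` of those `a ∈ A` whose chamber has distance at most `ε₂` from `p`. -/
def nearby {k : ℕ} (A : Finset (Fin k → ℤ)) (ν : (Fin k → ℤ) → ℝ)
    (G : Matrix (Fin k) (Fin k) ℝ) (ε₂ : ℝ) (p : Fin k → ℝ) : Set (Fin k → ℤ) :=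
  {a | a ∈ A ∧ metricDist G p (chamber A ν a) ≤ ε₂}

/-- The cut-off functions `χ_a`, `a ∈ A`, used in tailoring. -/
structure IsCutoffFamily {k : ℕ} (A : Finset (Fin k → ℤ)) (ν : (Fin k → ℤ) → ℝ)
    (G : Matrix (Fin k) (Fin k) ℝ) (ε₁ ε₂ : ℝ)
    (χ : (Fin k → ℤ) → (Fin k → ℝ) → ℝ) : Prop where
  smooth : ∀ a ∈ A, ContDiff ℝ ∞ (χ a)
  mem_Icc : ∀ a ∈ A, ∀ p, χ a p ∈ Set.Icc (0 : ℝ) 1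
  eq_one : ∀ a ∈ A, ∀ p, metricDist G p (chamber A ν a) ≤ ε₁ → χ a p = 1
  eq_zero : ∀ a ∈ A, ∀ p, ε₂ ≤ metricDist G p (chamber A ν a) → χ a p = 0
  /-- Where it is not locally constant, `χ a` is strictly decreasing along the rays that leave
  the chamber of `a` orthogonally (`c` is the point of the chamber nearest to `p`). -/
  radial : ∀ a ∈ A, ∀ p, χ a p ∈ Set.Ioo (0 : ℝ) 1 → ∀ c ∈ chamber A ν a,
    metricNorm G (p - c) = metricDist G p (chamber A ν a) →
      ∀ r : ℝ, 0 < r → χ a (p + r • (p - c)) < χ a p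
  /-- The level sets are convex hypersurfaces: they bound convex regions. -/
  convex : ∀ a ∈ A, ∀ ξ ∈ Set.Ioo (0 : ℝ) 1, Convex ℝ {p | ξ ≤ χ a p}
  /-- Outside a compact set, on the part of `ℝ^k` where `τ(p) = τ`, the level sets are parallel
  to `C_τ`: the derivative of `χ a` vanishes on the direction space of the affine span of `C_τ`. -/
  parallel : ∀ τ, IsRegularFace A ν τ → ∀ a ∈ τ, ∃ K : Set (Fin k → ℝ), IsCompact K ∧
    ∀ p, p ∉ K → nearby A ν G ε₂ p = (τ : Set (Fin k → ℤ)) → χ a p ∈ Set.Ioo (0 : ℝ) 1 →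
      ∀ v ∈ vectorSpan ℝ (cell A ν τ), fderiv ℝ (χ a) p v = 0

/-! ### The complex torus and the tailored hypersurfaces -/

/-- The complex torus `(ℂ^*)^k`. -/
def torus (k : ℕ) : Set (Fin k → ℂ) := {z | ∀ i, z i ≠ 0}

/-- `Log z = (log |z_1|, …, log |z_k|)`. -/
def Log {k : ℕ} (z : Fin k → ℂ) : Fin k → ℝ := fun i => Real.log ‖z i‖

/-- `Log_t z = Log z / log t`. -/
def LogBase {k : ℕ} (t : ℝ) (z : Fin k → ℂ) : Fin k → ℝ := (Real.log t)⁻¹ • Log z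

/-- The coefficients: `-1` for the exponent `0` and `1` for all other exponents. -/
def coeff {k : ℕ} (a : Fin k → ℤ) : ℝ := if a = 0 then -1 else 1

/-- The function
`f_{t,s}(z) = ∑_a α_a ((1 - s) + s χ_a(Log_t z)) t^{-ν(a)} z^a`. -/
def tailoredFun {k : ℕ} (A : Finset (Fin k → ℤ)) (ν : (Fin k → ℤ) → ℝ)
    (χ : (Fin k → ℤ) → (Fin k → ℝ) → ℝ) (t s : ℝ) (z : Fin k → ℂ) : ℂ :=
  ∑ a ∈ A, ((coeff a * ((1 - s) + s * χ a (LogBase t z)) * t ^ (-ν a) : ℝ) : ℂ) *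
    ∏ i, z i ^ (a i)

/-- The zero set of `f` in the complex torus. -/
def zeroSet {k : ℕ} (f : (Fin k → ℂ) → ℂ) : Set (Fin k → ℂ) := {z | z ∈ torus k ∧ f z = 0}

/-- The tangent space at `z` of the zero set of `f` (at a zero `z` where `df` is surjective). -/
def tangent {k : ℕ} (f : (Fin k → ℂ) → ℂ) (z : Fin k → ℂ) : Submodule ℝ (Fin k → ℂ) :=
  LinearMap.ker (fderiv ℝ f z).toLinearMap

/-! ### Potentials and the Kähler structure of the torus -/

/-- The Hessian of a function on a real normed space, as a bilinear form. -/
def hessian {E : Type*} [NormedAddCommGroup E] [NormedSpace ℝ E] (h : E → ℝ) (x u v : E) : ℝ :=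
  fderiv ℝ (fderiv ℝ h) x u v

/-- `ψ` defines a (torus invariant) Kähler potential `ψ ∘ Log` on the torus: it is smooth with
positive definite Hessian. -/
structure IsPotential {k : ℕ} (ψ : (Fin k → ℝ) → ℝ) : Prop where
  smooth : ContDiff ℝ ∞ ψ
  posDef : ∀ x v, v ≠ 0 → 0 < hessian ψ x v v

/-- Homogeneity of degree two. -/
def IsHomogeneousTwo {k : ℕ} (φ : (Fin k → ℝ) → ℝ) : Prop :=
  ∀ c : ℝ, 0 < c → ∀ x, φ (c • x) = c ^ 2 * φ x

/-- `φ` is adapted to the polyhedron `Q`: on each (nonempty) face of `Q` it has a unique minimum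
point, and this point lies in the relative interior of the face. -/
def IsAdapted {k : ℕ} (φ : (Fin k → ℝ) → ℝ) (Q : Set (Fin k → ℝ)) : Prop :=
  ∀ F : Set (Fin k → ℝ), F.Nonempty → IsExposed ℝ Q F →
    ∃ x ∈ intrinsicInterior ℝ F, ∀ y ∈ F, y ≠ x → φ x < φ y

/-- The potential `ψ`, as a function on the torus. -/
def torusPotential {k : ℕ} (ψ : (Fin k → ℝ) → ℝ) (z : Fin k → ℂ) : ℝ := ψ (Log z)

/-- `dρ(v)`, where `z_j = exp (ρ_j + i η_j)`. -/
def dRho {k : ℕ} (z v : Fin k → ℂ) : Fin k → ℝ := fun i => (v i / z i).re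

/-- `dη(v)`, where `z_j = exp (ρ_j + i η_j)`. -/
def dEta {k : ℕ} (z v : Fin k → ℂ) : Fin k → ℝ := fun i => (v i / z i).im

/-- The Liouville form `θ = -dψ ∘ J = ∑_j (∂_j ψ) dη_j`. -/
def liouvilleForm {k : ℕ} (ψ : (Fin k → ℝ) → ℝ) (z v : Fin k → ℂ) : ℝ :=
  fderiv ℝ ψ (Log z) (dEta z v)

/-- The symplectic form `ω = dθ = ∑_{j,l} (∂_j ∂_l ψ) dρ_j ∧ dη_l`. -/
def symplecticForm {k : ℕ} (ψ : (Fin k → ℝ) → ℝ) (z u v : Fin k → ℂ) : ℝ :=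
  hessian ψ (Log z) (dRho z u) (dEta z v) - hessian ψ (Log z) (dRho z v) (dEta z u)

/-- The Kähler metric `g = ∑_{j,l} (∂_j ∂_l ψ) (dρ_j dρ_l + dη_j dη_l)`. -/
def kahlerMetric {k : ℕ} (ψ : (Fin k → ℝ) → ℝ) (z u v : Fin k → ℂ) : ℝ :=
  hessian ψ (Log z) (dRho z u) (dRho z v) + hessian ψ (Log z) (dEta z u) (dEta z v)

/-! ### The Liouville vector field of the hypersurface and the gradient-like property -/

/-- The zero set of `f` is a smooth hypersurface (of real codimension two), and the restriction
of the symplectic form to it is nondegenerate. -/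
structure IsSymplecticHypersurface {k : ℕ} (ψ : (Fin k → ℝ) → ℝ) (f : (Fin k → ℂ) → ℂ) : Prop where
  smooth : ContDiffOn ℝ ∞ f (torus k)
  regular : ∀ z ∈ zeroSet f, Function.Surjective (fderiv ℝ f z)
  nondegenerate : ∀ z ∈ zeroSet f, ∀ X ∈ tangent f z,
    (∀ Y ∈ tangent f z, symplecticForm ψ z X Y = 0) → X = 0

/-- `Z` is the value at `z` of the Liouville vector field of the zero set of `f`: the tangent
vector with `ω(Z, X) = θ(X)` for all tangent vectors `X`. -/
def IsLiouvilleVector {k : ℕ} (ψ : (Fin k → ℝ) → ℝ) (f : (Fin k → ℂ) → ℂ)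
    (z Z : Fin k → ℂ) : Prop :=
  Z ∈ tangent f z ∧ ∀ X ∈ tangent f z, symplecticForm ψ z Z X = liouvilleForm ψ z X

/-- `|dψ_1|_g²` at `z`, where `ψ_1` is the restriction of the potential to the zero set of `f`:
the square of the dual norm of the restriction of `dψ` to the tangent space. -/
def restrictedCovectorNormSq {k : ℕ} (ψ : (Fin k → ℝ) → ℝ) (f : (Fin k → ℂ) → ℂ)
    (z : Fin k → ℂ) : ℝ :=
  sSup {r : ℝ | ∃ X ∈ tangent f z, kahlerMetric ψ z X X ≤ 1 ∧
    r = (fderiv ℝ (torusPotential ψ) z X) ^ 2}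

/-- The Liouville vector field `Z_1` of the zero set of `f` is gradient-like for the restriction
`ψ_1` of the potential: `Z_1 ψ_1 ≥ δ (|dψ_1|² + |Z_1|²)` for a constant `δ > 0`. -/
def IsGradientLike {k : ℕ} (ψ : (Fin k → ℝ) → ℝ) (f : (Fin k → ℂ) → ℂ) : Prop :=
  ∃ δ : ℝ, 0 < δ ∧ ∀ z ∈ zeroSet f, ∀ Z, IsLiouvilleVector ψ f z Z →
    δ * (restrictedCovectorNormSq ψ f z + kahlerMetric ψ z Z Z) ≤
      fderiv ℝ (torusPotential ψ) z Z

/-! ### Morse–Bott functions -/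

/-- Near its point `z`, the set `S` is a smooth embedded submanifold, with tangent space `W` at
`z`. (The dimension may depend on `z`.) -/
def IsSubmanifoldAt {V : Type*} [NormedAddCommGroup V] [NormedSpace ℝ V]
    (S : Set V) (z : V) (W : Submodule ℝ V) : Prop :=
  ∃ (m : ℕ) (F : V → Fin m → ℝ) (U : Set V), IsOpen U ∧ z ∈ U ∧ ContDiffOn ℝ ∞ F U ∧
    (∀ x ∈ U, Function.Surjective (fderiv ℝ F x)) ∧
    S ∩ U = {x | x ∈ U ∧ F x = 0} ∧ z ∈ S ∧
    LinearMap.ker (fderiv ℝ F z).toLinearMap = W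

/-- `φ` is a smooth local parametrization, with `φ 0 = z`, of a submanifold `S` whose tangent
space at `z` is `W`. -/
structure IsLocalParametrization {V : Type*} [NormedAddCommGroup V] [NormedSpace ℝ V]
    (S : Set V) (z : V) (W : Submodule ℝ V) {n : ℕ} (φ : (Fin n → ℝ) → V) : Prop where
  smooth : ContDiffAt ℝ ∞ φ 0
  base : φ 0 = z
  mem : ∀ᶠ x in 𝓝 (0 : Fin n → ℝ), φ x ∈ S
  injective : Function.Injective (fderiv ℝ φ 0)
  range_eq : LinearMap.range (fderiv ℝ φ 0).toLinearMap = W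

/-- The critical set of the restriction of the potential to the zero set of `f`. -/
def criticalSet {k : ℕ} (ψ : (Fin k → ℝ) → ℝ) (f : (Fin k → ℂ) → ℂ) : Set (Fin k → ℂ) :=
  {z | z ∈ zeroSet f ∧ ∀ X ∈ tangent f z, fderiv ℝ (torusPotential ψ) z X = 0}

/-- The restriction of the potential to the zero set of `f` is Morse–Bott: its critical set is a
closed (that is, compact, without boundary) submanifold, and at each critical point the kernel of
the Hessian, computed in local parametrizations of the hypersurface, is the tangent space of the
critical set. -/
def IsMorseBott {k : ℕ} (ψ : (Fin k → ℝ) → ℝ) (f : (Fin k → ℂ) → ℂ) : Prop :=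
  IsCompact (criticalSet ψ f) ∧
  ∀ z ∈ criticalSet ψ f, ∃ W : Submodule ℝ (Fin k → ℂ),
    IsSubmanifoldAt (criticalSet ψ f) z W ∧
    ∀ (n : ℕ) (φ : (Fin n → ℝ) → Fin k → ℂ),
      IsLocalParametrization (zeroSet f) z (tangent f z) φ →
      {X | ∃ x : Fin n → ℝ, fderiv ℝ φ 0 x = X ∧
        ∀ y : Fin n → ℝ, hessian (fun w => torusPotential ψ (φ w)) 0 x y = 0} =
      (W : Set (Fin k → ℂ))

/-! ### Weinstein structures -/

/-- The zero set of `f`, with the Liouville form and the potential restricted from the torus, is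
a Morse–Bott Weinstein manifold: it is an exact symplectic manifold whose Liouville vector field
is complete and gradient-like for the restricted potential, and the latter is exhausting (proper
and bounded below) and Morse–Bott. -/
structure IsMorseBottWeinstein {k : ℕ} (ψ : (Fin k → ℝ) → ℝ) (f : (Fin k → ℂ) → ℂ) : Prop where
  symplectic : IsSymplecticHypersurface ψ f
  complete : ∀ z ∈ zeroSet f, ∃ γ : ℝ → Fin k → ℂ, γ 0 = z ∧
    ∀ r : ℝ, γ r ∈ zeroSet f ∧ ∃ Z, HasDerivAt γ Z r ∧ IsLiouvilleVector ψ f (γ r) Z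
  exhausting : ∀ c : ℝ, IsCompact {z | z ∈ zeroSet f ∧ torusPotential ψ z ≤ c}
  gradientLike : IsGradientLike ψ f
  morseBott : IsMorseBott ψ f

end Tailored

end

/-!
In logarithmic coordinates `w`, with `z = exp w`, `ρ = Re w`, `L = log t` and `u = ρ / L`, the
tailored function is a sum of terms whose absolute values are `exp (L * height ν a u)` times a
cut-off factor. Its derivative at a zero is a complex linear form `q` plus the contribution `β` of
the derivatives of the cut-off functions. The derivatives of the cut-off functions are bounded
(`exists_fderiv_cutoff_bound`: this is where the condition at infinity on the level sets is used),
and `q` is at least as large as the largest term because the dominant exponents are vertices of a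
simplex (`exists_le_norm_momentVec`); since differentiating a cut-off function produces a factor
`1 / L`, the perturbation `β` is as small as desired compared with `q`. Hence the kernel of
`q + β` is close to a complex subspace, and the hypersurface is symplectic
(`omForm_nondegenerate`).

For the gradient-like property, let `X₀` be the orthogonal projection of `dψ` to the kernel of `q`.
If `X₀` is not small compared with `dψ`, a perturbation argument gives the inequality with
uniform constants (`exists_gradientLike_const`). If it is small, `dψ` is nearly a multiple of `q`,
a combination of the exponents of the dominant terms. As `0` belongs to all maximal simplices and
`φ` is adapted to the central chamber, comparing coefficients and using the monotonicity of `dφ`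
shows that `u` is close to the minimum point of `φ` on a face of this chamber and that all terms
of this face are of maximal order (`eventually_near_faceMin`, `exists_near_critical`). There all
cut-off functions are locally constant (`exists_cutoff_locally_const`), so `β = 0`, the function is
holomorphic and the inequality is that of a Kähler submanifold.

In particular, for `s = 1`, the function is an exponential sum over the vertices of a simplex near
each critical point, and `dψ` is a real multiple of its derivative (`exists_criticalData`). The
multipliers of the exponents are determined by `ρ` and are of order `L`, which makes `ρ` unique for
each simplex (`exists_Log_eq`); the phases then form a coset of a subgroup of a compact torus. The
Hessian of the Lagrange function is explicit (`hessian_lagrangian`), and its kernel is the tangent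
space of this coset as soon as `L` is large (`exists_eq_zero_of_forall`).

Finally the gradient-like property bounds the Liouville vector field by `dψ`, which grows linearly
in `w`. The field extends to a vector field of linear growth on `ℂ^k` that is tangent to all
level sets of the function, and such fields are complete (`exists_complete_liouville`).
-/

noncomputable section

namespace Tailored

/-! ### Nearly complex subspaces of a Hermitian vector space -/

/-- The componentwise real part `ℂ^k → ℝ^k`. -/
def rePart {k : ℕ} : (Fin k → ℂ) →L[ℝ] (Fin k → ℝ) :=
  ContinuousLinearMap.pi fun i => Complex.reCLM.comp (ContinuousLinearMap.proj i)

/-- The componentwise imaginary part `ℂ^k → ℝ^k`. -/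
def imPart {k : ℕ} : (Fin k → ℂ) →L[ℝ] (Fin k → ℝ) :=
  ContinuousLinearMap.pi fun i => Complex.imCLM.comp (ContinuousLinearMap.proj i)

@[simp] lemma rePart_apply {k : ℕ} (ξ : Fin k → ℂ) (i : Fin k) : rePart ξ i = (ξ i).re := rfl

@[simp] lemma imPart_apply {k : ℕ} (ξ : Fin k → ℂ) (i : Fin k) : imPart ξ i = (ξ i).im := rfl

lemma norm_rePart_le {k : ℕ} (ξ : Fin k → ℂ) : ‖rePart ξ‖ ≤ ‖ξ‖ :=
  (pi_norm_le_iff_of_nonneg (norm_nonneg _)).2 fun i =>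
    (Complex.abs_re_le_norm _).trans (norm_le_pi_norm ξ i)

lemma norm_imPart_le {k : ℕ} (ξ : Fin k → ℂ) : ‖imPart ξ‖ ≤ ‖ξ‖ :=
  (pi_norm_le_iff_of_nonneg (norm_nonneg _)).2 fun i =>
    (Complex.abs_im_le_norm _).trans (norm_le_pi_norm ξ i)

lemma norm_le_rePart_add_imPart {k : ℕ} (ξ : Fin k → ℂ) : ‖ξ‖ ≤ ‖rePart ξ‖ + ‖imPart ξ‖ :=
  (pi_norm_le_iff_of_nonneg (by positivity)).2 fun i =>
    (Complex.norm_le_abs_re_add_abs_im _).trans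
      (add_le_add (norm_le_pi_norm (rePart ξ) i) (norm_le_pi_norm (imPart ξ) i))

/-- The real inner product on `ℂ^k` obtained from a bilinear form on `ℝ^k`. -/
def gForm {k : ℕ} (B : (Fin k → ℝ) →L[ℝ] (Fin k → ℝ) →L[ℝ] ℝ) (ξ ζ : Fin k → ℂ) : ℝ :=
  B (rePart ξ) (rePart ζ) + B (imPart ξ) (imPart ζ)

/-- The skew form on `ℂ^k` obtained from a bilinear form on `ℝ^k`. -/
def omForm {k : ℕ} (B : (Fin k → ℝ) →L[ℝ] (Fin k → ℝ) →L[ℝ] ℝ) (ξ ζ : Fin k → ℂ) : ℝ :=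
  B (rePart ξ) (imPart ζ) - B (rePart ζ) (imPart ξ)

/-- The bilinear form `B` is symmetric, bounded below by `c` and above by `C`. -/
structure Pinched {k : ℕ} (c C : ℝ) (B : (Fin k → ℝ) →L[ℝ] (Fin k → ℝ) →L[ℝ] ℝ) : Prop where
  symm : ∀ u v, B u v = B v u
  lower : ∀ v, c * ‖v‖ ^ 2 ≤ B v v
  upper : ∀ u v, |B u v| ≤ C * ‖u‖ * ‖v‖

section

variable {k : ℕ} {c C : ℝ} {B : (Fin k → ℝ) →L[ℝ] (Fin k → ℝ) →L[ℝ] ℝ}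

lemma rePart_I_smul (ξ : Fin k → ℂ) : rePart (Complex.I • ξ) = -imPart ξ := by
  ext i; simp

lemma imPart_I_smul (ξ : Fin k → ℂ) : imPart (Complex.I • ξ) = rePart ξ := by
  ext i; simp

lemma norm_I_smul (ξ : Fin k → ℂ) : ‖Complex.I • ξ‖ = ‖ξ‖ := by
  rw [norm_smul]; simp

lemma omForm_I_smul (hB : Pinched c C B) (ξ ζ : Fin k → ℂ) :
    omForm B ξ (Complex.I • ζ) = gForm B ξ ζ := by
  simp only [omForm, gForm, rePart_I_smul, imPart_I_smul, map_neg, neg_apply]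
  rw [hB.symm (imPart ζ)]; ring

lemma omForm_add_right (ξ ζ ζ' : Fin k → ℂ) :
    omForm B ξ (ζ + ζ') = omForm B ξ ζ + omForm B ξ ζ' := by
  simp only [omForm, map_add, add_apply]; ring

lemma abs_omForm_le (hC : 0 ≤ C) (hB : Pinched c C B) (ξ ζ : Fin k → ℂ) :
    |omForm B ξ ζ| ≤ 2 * C * ‖ξ‖ * ‖ζ‖ := by
  have h1 := hB.upper (rePart ξ) (imPart ζ)
  have h2 := hB.upper (rePart ζ) (imPart ξ)
  have h3 : C * ‖rePart ξ‖ * ‖imPart ζ‖ ≤ C * ‖ξ‖ * ‖ζ‖ := by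
    gcongr
    exacts [norm_rePart_le _, norm_imPart_le _]
  have h4 : C * ‖rePart ζ‖ * ‖imPart ξ‖ ≤ C * ‖ζ‖ * ‖ξ‖ := by
    gcongr
    exacts [norm_rePart_le _, norm_imPart_le _]
  unfold omForm
  calc _ ≤ |B (rePart ξ) (imPart ζ)| + |B (rePart ζ) (imPart ξ)| := abs_sub _ _
    _ ≤ _ := by nlinarith

lemma abs_gForm_le (hC : 0 ≤ C) (hB : Pinched c C B) (ξ ζ : Fin k → ℂ) :
    |gForm B ξ ζ| ≤ 2 * C * ‖ξ‖ * ‖ζ‖ := by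
  rw [← omForm_I_smul hB]
  simpa [norm_I_smul] using abs_omForm_le hC hB ξ (Complex.I • ζ)

lemma le_gForm (hc : 0 ≤ c) (hB : Pinched c C B) (ξ : Fin k → ℂ) :
    c / 2 * ‖ξ‖ ^ 2 ≤ gForm B ξ ξ := by
  have h1 := hB.lower (rePart ξ)
  have h2 := hB.lower (imPart ξ)
  have h3 := norm_le_rePart_add_imPart ξ
  have h4 : ‖ξ‖ ^ 2 ≤ 2 * (‖rePart ξ‖ ^ 2 + ‖imPart ξ‖ ^ 2) := by
    nlinarith [norm_nonneg ξ, norm_nonneg (rePart ξ), norm_nonneg (imPart ξ),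
      sq_nonneg (‖rePart ξ‖ - ‖imPart ξ‖)]
  unfold gForm
  nlinarith

/-- The Cauchy–Schwarz inequality for the inner product `gForm`. -/
lemma gForm_sq_le (hc : 0 ≤ c) (hB : Pinched c C B) (ξ ζ : Fin k → ℂ) :
    gForm B ξ ζ ^ 2 ≤ gForm B ξ ξ * gForm B ζ ζ := by
  have key : ∀ x : ℝ, 0 ≤ gForm B ζ ζ * (x * x) + 2 * gForm B ξ ζ * x + gForm B ξ ξ := by
    intro x
    have h := (by positivity : 0 ≤ c / 2 * ‖ξ + x • ζ‖ ^ 2).trans (le_gForm hc hB (ξ + x • ζ))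
    have h' : gForm B (ξ + x • ζ) (ξ + x • ζ) =
        gForm B ζ ζ * (x * x) + 2 * gForm B ξ ζ * x + gForm B ξ ξ := by
      simp only [gForm, map_add, map_smul, add_apply,
        smul_apply, smul_eq_mul]
      rw [hB.symm (rePart ζ) (rePart ξ), hB.symm (imPart ζ) (imPart ξ)]
      ring
    rwa [h'] at h
  have := discrim_le_zero key
  unfold discrim at this
  nlinarith

/-- The differential of a nearly holomorphic function: the complex linear form with coefficient
vector `q`, plus a small real linear perturbation. -/
def pertForm (q : Fin k → ℂ) (β : (Fin k → ℂ) →L[ℝ] ℂ) (ξ : Fin k → ℂ) : ℂ :=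
  ∑ i, q i * ξ i + β ξ

lemma pertForm_sub (q : Fin k → ℂ) (β : (Fin k → ℂ) →L[ℝ] ℂ) (ξ ζ : Fin k → ℂ) :
    pertForm q β (ξ - ζ) = pertForm q β ξ - pertForm q β ζ := by
  simp [pertForm, mul_sub, Finset.sum_sub_distrib]; ring

/-- A right inverse of the perturbed linear form with the expected norm. -/
lemma exists_pertForm_eq {q : Fin k → ℂ} (hq : q ≠ 0) {β : (Fin k → ℂ) →L[ℝ] ℂ} {κ : ℝ}
    (hκ : κ ≤ 1 / 2) (hβ : ∀ ξ, ‖β ξ‖ ≤ κ * ‖q‖ * ‖ξ‖) (y : ℂ) :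
    ∃ D, pertForm q β D = y ∧ ‖D‖ ≤ 2 / ‖q‖ * ‖y‖ := by
  have hq0 : 0 < ‖q‖ := norm_pos_iff.2 hq
  obtain ⟨j, hj⟩ : ∃ j, ‖q‖ = ‖q j‖ := by
    have hne : Nonempty (Fin k) := by
      by_contra h
      rw [not_nonempty_iff] at h
      exact hq (Subsingleton.elim _ _)
    obtain ⟨j, hj⟩ := exists_eq_ciSup_of_finite (f := fun i => ‖q i‖)
    refine ⟨j, le_antisymm ?_ (norm_le_pi_norm q j)⟩
    refine (pi_norm_le_iff_of_nonneg (norm_nonneg _)).2 fun i => ?_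
    rw [show ‖q j‖ = _ from hj]
    exact le_ciSup (f := fun i => ‖q i‖) (Finite.bddAbove_range _) i
  have hqj : q j ≠ 0 := by rw [← norm_pos_iff, ← hj]; exact hq0
  let N : ℂ →ₗ[ℝ] (Fin k → ℂ) :=
    { toFun := fun y => Pi.single j (y / q j)
      map_add' := fun a b => by rw [add_div, Pi.single_add]
      map_smul' := fun a b => by
        ext i
        by_cases h : i = j
        · subst h; simp [mul_div_assoc]
        · simp [h] }
  have hN : ∀ y, ‖N y‖ = ‖y‖ / ‖q‖ := fun y => by
    simp only [N, LinearMap.coe_mk, AddHom.coe_mk, Pi.norm_single, norm_div, hj]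
  have hαN : ∀ y, pertForm q β (N y) = y + β (N y) := fun y => by
    simp only [pertForm, N, LinearMap.coe_mk, AddHom.coe_mk]
    rw [Finset.sum_eq_single j]
    · simp; field_simp
    · intro i _ hi; simp [hi]
    · simp
  have hβN : ∀ y, ‖β (N y)‖ ≤ 1 / 2 * ‖y‖ := fun y => by
    refine (hβ _).trans ?_
    rw [hN]
    calc κ * ‖q‖ * (‖y‖ / ‖q‖) = κ * ‖y‖ := by field_simp
      _ ≤ _ := by gcongr
  let S : ℂ →ₗ[ℝ] ℂ := LinearMap.id + β.toLinearMap.comp N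
  have hS : ∀ y, S y = pertForm q β (N y) := fun y => by rw [hαN]; rfl
  have hSn : ∀ y, ‖y‖ ≤ 2 * ‖S y‖ := fun y => by
    have h1 : ‖y‖ ≤ ‖S y‖ + ‖β (N y)‖ := by
      rw [hS, hαN]
      calc ‖y‖ = ‖(y + β (N y)) - β (N y)‖ := by simp
        _ ≤ _ := norm_sub_le _ _
    linarith [hβN y]
  have hinj : Function.Injective S := by
    rw [← LinearMap.ker_eq_bot, LinearMap.ker_eq_bot']
    intro y hy
    have := hSn y
    rw [hy] at this
    simpa using this
  obtain ⟨y', hy'⟩ := LinearMap.injective_iff_surjective.1 hinj y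
  refine ⟨N y', by rw [← hS, hy'], ?_⟩
  rw [hN, ← hy']
  calc ‖y'‖ / ‖q‖ ≤ (2 * ‖S y'‖) / ‖q‖ := by gcongr; exact hSn y'
    _ = _ := by ring

/-- A vector on which the perturbed form is small is close to the kernel of the form. -/
lemma exists_mem_ker_pertForm {q : Fin k → ℂ} (hq : q ≠ 0) {β : (Fin k → ℂ) →L[ℝ] ℂ} {κ : ℝ}
    (hκ : κ ≤ 1 / 2) (hβ : ∀ ξ, ‖β ξ‖ ≤ κ * ‖q‖ * ‖ξ‖) (Y : Fin k → ℂ) :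
    ∃ Y', pertForm q β Y' = 0 ∧ ‖Y' - Y‖ ≤ 2 / ‖q‖ * ‖pertForm q β Y‖ := by
  obtain ⟨D, hD, hDn⟩ := exists_pertForm_eq hq hκ hβ (pertForm q β Y)
  exact ⟨Y - D, by rw [pertForm_sub, hD, sub_self], by simpa using hDn⟩

/-- The kernel of a nearly complex linear form is nearly invariant under the complex structure. -/
lemma exists_near_I_smul {q : Fin k → ℂ} (hq : q ≠ 0) {β : (Fin k → ℂ) →L[ℝ] ℂ} {κ : ℝ}
    (hκ : κ ≤ 1 / 2) (hβ : ∀ ξ, ‖β ξ‖ ≤ κ * ‖q‖ * ‖ξ‖) {X : Fin k → ℂ}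
    (hX : pertForm q β X = 0) :
    ∃ X', pertForm q β X' = 0 ∧ ‖X' - Complex.I • X‖ ≤ 4 * κ * ‖X‖ := by
  have hq0 : 0 < ‖q‖ := norm_pos_iff.2 hq
  obtain ⟨X', h1, h2⟩ := exists_mem_ker_pertForm hq hκ hβ (Complex.I • X)
  refine ⟨X', h1, h2.trans ?_⟩
  have e : pertForm q β (Complex.I • X) = -(Complex.I * β X) + β (Complex.I • X) := by
    have h3 : ∑ i, q i * X i = - β X := by
      rw [pertForm] at hX; exact eq_neg_of_add_eq_zero_left hX
    have h4 : ∑ i, q i * (Complex.I • X) i = Complex.I * ∑ i, q i * X i := by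
      rw [Finset.mul_sum]
      exact Finset.sum_congr rfl fun i _ => by simp; ring
    rw [pertForm, h4, h3]; ring
  have h5 : ‖pertForm q β (Complex.I • X)‖ ≤ 2 * (κ * ‖q‖ * ‖X‖) := by
    rw [e]
    refine (norm_add_le _ _).trans ?_
    have := hβ (Complex.I • X)
    rw [norm_I_smul] at this
    rw [norm_neg, norm_mul, Complex.norm_I, one_mul]
    linarith [hβ X]
  calc 2 / ‖q‖ * ‖pertForm q β (Complex.I • X)‖ ≤ 2 / ‖q‖ * (2 * (κ * ‖q‖ * ‖X‖)) := by gcongr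
    _ = _ := by field_simp; ring

/-- The skew form is nondegenerate on the kernel of a nearly complex linear form. -/
lemma omForm_nondegenerate (hc : 0 < c) (hC : 0 < C) (hB : Pinched c C B) {q : Fin k → ℂ}
    (hq : q ≠ 0) {β : (Fin k → ℂ) →L[ℝ] ℂ} {κ : ℝ}
    (hκ : κ ≤ 1 / 2) (hκ' : 32 * C * κ ≤ c) (hβ : ∀ ξ, ‖β ξ‖ ≤ κ * ‖q‖ * ‖ξ‖) {X : Fin k → ℂ}
    (hX : pertForm q β X = 0) (h : ∀ Y, pertForm q β Y = 0 → omForm B X Y = 0) : X = 0 := by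
  obtain ⟨X', h1, h2⟩ := exists_near_I_smul hq hκ hβ hX
  have h3 := h X' h1
  have h4 : omForm B X X' = gForm B X X + omForm B X (X' - Complex.I • X) := by
    rw [← omForm_I_smul hB, ← omForm_add_right]; congr 1; abel
  have h5 := abs_omForm_le hC.le hB X (X' - Complex.I • X)
  have h6 := le_gForm hc.le hB X
  have h7 : 2 * C * ‖X‖ * ‖X' - Complex.I • X‖ ≤ 2 * C * ‖X‖ * (4 * κ * ‖X‖) := by gcongr
  have h8 := (abs_le.1 h5).1
  have h9 : ‖X‖ ^ 2 ≤ 0 := by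
    have : 2 * C * ‖X‖ * (4 * κ * ‖X‖) = 32 * C * κ / 4 * ‖X‖ ^ 2 := by ring
    have h10 : 32 * C * κ / 4 * ‖X‖ ^ 2 ≤ c / 4 * ‖X‖ ^ 2 := by gcongr
    have : c / 4 * ‖X‖ ^ 2 ≤ 0 := by linarith
    by_contra hcon
    push Not at hcon
    nlinarith
  have : ‖X‖ = 0 := by
    have := sq_nonneg ‖X‖
    exact pow_eq_zero_iff (two_ne_zero) |>.1 (le_antisymm h9 this)
  exact norm_eq_zero.1 this

set_option maxHeartbeats 1000000 in
/-- Uniform gradient-likeness. On the kernel of a nearly complex linear form, the vector dual to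
`-dψ ∘ J` is nearly the gradient. The error of this approximation is proportional to the full
differential `p`; it is harmless where the perturbation vanishes, and also where the restriction
of `p` to the complex hyperplane is not much smaller than `p` itself. -/
lemma exists_gradientLike_const (hc : 0 < c) (hC : 0 < C) {e : ℝ} (he : 0 < e) :
    ∃ κ > 0, ∃ δ > 0, κ ≤ 1 / 2 ∧ 32 * C * κ ≤ c ∧ ∀ {k : ℕ}
      {B : (Fin k → ℝ) →L[ℝ] (Fin k → ℝ) →L[ℝ] ℝ}, Pinched c C B →
      ∀ (p : (Fin k → ℝ) →L[ℝ] ℝ) {q : Fin k → ℂ}, q ≠ 0 → ∀ β : (Fin k → ℂ) →L[ℝ] ℂ,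
      (∀ ξ, ‖β ξ‖ ≤ κ * ‖q‖ * ‖ξ‖) →
      (β = 0 ∨ ∃ X₀, X₀ ≠ 0 ∧ ∑ i, q i * X₀ i = 0 ∧ e * ‖p‖ * ‖X₀‖ ≤ p (rePart X₀)) →
      ∀ Z, pertForm q β Z = 0 → (∀ X, pertForm q β X = 0 → omForm B Z X = p (imPart X)) →
      ∀ X, pertForm q β X = 0 → gForm B X X ≤ 1 →
        δ * (p (rePart X) ^ 2 + gForm B Z Z) ≤ p (rePart Z) := by
  -- `‖p‖ ≤ D * ‖Z‖` will hold in the second case, and `κ` is so small that the resulting error in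
  -- `p (rePart Z) = gForm B Z Z` is at most `c / 4 * ‖Z‖ ^ 2`
  set D : ℝ := 80 * C / e with hD
  have hD0 : 0 < D := by positivity
  set M : ℝ := 4 * D ^ 2 / c ^ 2 with hM
  have hM0 : 0 < M := by positivity
  set κ : ℝ := min (min (1 / 2) (c / (32 * C))) (min (e / 32) (c / (16 * (2 * C + D)))) with hκd
  have hκ0 : 0 < κ := by
    simp only [hκd, lt_min_iff]
    refine ⟨⟨by norm_num, by positivity⟩, by positivity, by positivity⟩
  have hκ1 : κ ≤ 1 / 2 := (min_le_left _ _).trans (min_le_left _ _)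
  have hκ2 : 32 * C * κ ≤ c := by
    have : κ ≤ c / (32 * C) := (min_le_left _ _).trans (min_le_right _ _)
    rw [le_div_iff₀ (by positivity)] at this; linarith
  have hκ3 : κ ≤ e / 32 := (min_le_right _ _).trans (min_le_left _ _)
  have hκ4 : 4 * κ * (2 * C + D) ≤ c / 4 := by
    have : κ ≤ c / (16 * (2 * C + D)) := (min_le_right _ _).trans (min_le_right _ _)
    rw [le_div_iff₀ (by positivity)] at this; linarith
  refine ⟨κ, hκ0, 1 / (2 * (M + 2)), by positivity, hκ1, hκ2, ?_⟩
  intro k B hB p q hq β hβ hcase Z hZ hZX X hX hX1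
  have hq0 : 0 < ‖q‖ := norm_pos_iff.2 hq
  have hgZ := le_gForm hc.le hB Z
  have hgZ0 : 0 ≤ gForm B Z Z := le_trans (by positivity) hgZ
  rw [div_mul_eq_mul_div, one_mul, div_le_iff₀ (by positivity)]
  rcases hcase with h0 | ⟨X₀, hX₀, hαX₀, hpX₀⟩
  · -- the kernel is a complex subspace, and `Z` is the gradient
    subst h0
    have hgrad : ∀ Y, pertForm q 0 Y = 0 → p (rePart Y) = gForm B Z Y := by
      intro Y hY
      have h1 : pertForm q 0 (Complex.I • Y) = 0 := by
        have h4 : ∑ i, q i * (Complex.I • Y) i = Complex.I * ∑ i, q i * Y i := by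
          rw [Finset.mul_sum]
          exact Finset.sum_congr rfl fun i _ => by simp; ring
        simp only [pertForm, zero_apply, add_zero] at hY ⊢
        rw [h4, hY, mul_zero]
      have h2 := hZX _ h1
      rw [omForm_I_smul hB, imPart_I_smul] at h2
      exact h2.symm
    have h1 := gForm_sq_le hc.le hB Z X
    rw [hgrad X hX, hgrad Z hZ]
    have h2 : gForm B Z Z * gForm B X X ≤ gForm B Z Z * 1 := by gcongr
    nlinarith
  · -- `Z` is the gradient up to an error of order `κ`
    have happ : ∀ Y, pertForm q β Y = 0 →
        |p (rePart Y) - gForm B Z Y| ≤ 4 * κ * ‖Y‖ * (2 * C * ‖Z‖ + ‖p‖) := by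
      intro Y hY
      obtain ⟨Y', h1, h2⟩ := exists_near_I_smul hq hκ1 hβ hY
      have h3 := hZX Y' h1
      have h4 : omForm B Z Y' = gForm B Z Y + omForm B Z (Y' - Complex.I • Y) := by
        rw [← omForm_I_smul hB, ← omForm_add_right]; congr 1; abel
      have h5 : p (imPart Y') = p (rePart Y) + p (imPart (Y' - Complex.I • Y)) := by
        rw [map_sub imPart, imPart_I_smul, map_sub]; ring
      have h6 : p (rePart Y) - gForm B Z Y =
          omForm B Z (Y' - Complex.I • Y) - p (imPart (Y' - Complex.I • Y)) := by linarith
      rw [h6]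
      have h7 := abs_omForm_le hC.le hB Z (Y' - Complex.I • Y)
      have h8 : |p (imPart (Y' - Complex.I • Y))| ≤ ‖p‖ * ‖Y' - Complex.I • Y‖ :=
        (p.le_opNorm _).trans (by gcongr; exact norm_imPart_le _)
      calc _ ≤ |omForm B Z (Y' - Complex.I • Y)| + |p (imPart (Y' - Complex.I • Y))| := abs_sub _ _
        _ ≤ (2 * C * ‖Z‖ + ‖p‖) * ‖Y' - Complex.I • Y‖ := by linarith
        _ ≤ (2 * C * ‖Z‖ + ‖p‖) * (4 * κ * ‖Y‖) := by gcongr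
        _ = _ := by ring
    -- move `X₀` into the kernel of the perturbed form
    obtain ⟨X₁, hX₁, hX₁n⟩ := exists_mem_ker_pertForm hq hκ1 hβ X₀
    have hX₀0 : 0 < ‖X₀‖ := norm_pos_iff.2 hX₀
    have hdist : ‖X₁ - X₀‖ ≤ 2 * κ * ‖X₀‖ := by
      refine hX₁n.trans ?_
      rw [pertForm, hαX₀, zero_add]
      calc 2 / ‖q‖ * ‖β X₀‖ ≤ 2 / ‖q‖ * (κ * ‖q‖ * ‖X₀‖) := by gcongr; exact hβ _
        _ = _ := by field_simp
    have hX₁2 : ‖X₁‖ ≤ 2 * ‖X₀‖ := by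
      have : ‖X₁‖ ≤ ‖X₁ - X₀‖ + ‖X₀‖ := norm_le_norm_sub_add _ _
      nlinarith
    have hpX₁ : (e - 2 * κ) * ‖p‖ * ‖X₀‖ ≤ p (rePart X₁) := by
      have h1 : p (rePart X₁) = p (rePart X₀) + p (rePart (X₁ - X₀)) := by
        rw [map_sub rePart, map_sub]; ring
      have h2 : |p (rePart (X₁ - X₀))| ≤ ‖p‖ * (2 * κ * ‖X₀‖) :=
        (p.le_opNorm _).trans (by gcongr; exact (norm_rePart_le _).trans hdist)
      rw [h1]
      linarith [(abs_le.1 h2).1]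
    have hgX₁ : gForm B Z X₁ ≤ 4 * C * ‖Z‖ * ‖X₀‖ := by
      have h1 := (abs_le.1 (abs_gForm_le hC.le hB Z X₁)).2
      have h2 : 2 * C * ‖Z‖ * ‖X₁‖ ≤ 2 * C * ‖Z‖ * (2 * ‖X₀‖) := by gcongr
      linarith
    -- testing with `X₁` bounds the full differential `p`
    have hp : ‖p‖ ≤ D * ‖Z‖ := by
      have h1 := (abs_le.1 (happ X₁ hX₁)).2
      have h2 : 4 * κ * ‖X₁‖ * (2 * C * ‖Z‖ + ‖p‖) ≤
          4 * κ * (2 * ‖X₀‖) * (2 * C * ‖Z‖ + ‖p‖) := by gcongr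
      have h3 : ‖X₀‖ * ((e - 2 * κ) * ‖p‖) ≤
          ‖X₀‖ * (4 * C * ‖Z‖ + 8 * κ * (2 * C * ‖Z‖ + ‖p‖)) := by linarith
      have h4 := le_of_mul_le_mul_left h3 hX₀0
      have h5 : (e - 10 * κ) * ‖p‖ ≤ (4 * C + 16 * κ * C) * ‖Z‖ := by linarith
      have h6 : e / 4 * ‖p‖ ≤ (e - 10 * κ) * ‖p‖ := by gcongr; linarith
      have h7 : (4 * C + 16 * κ * C) * ‖Z‖ ≤ 20 * C * ‖Z‖ := by gcongr; nlinarith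
      rw [hD, div_mul_eq_mul_div, le_div_iff₀ he]
      linarith
    have hpZ : gForm B Z Z / 2 ≤ p (rePart Z) := by
      have h1 := (abs_le.1 (happ Z hZ)).1
      have h2 : 4 * κ * ‖Z‖ * (2 * C * ‖Z‖ + ‖p‖) ≤ 4 * κ * ‖Z‖ * (2 * C * ‖Z‖ + D * ‖Z‖) := by
        gcongr
      have h3 : 4 * κ * ‖Z‖ * (2 * C * ‖Z‖ + D * ‖Z‖) = 4 * κ * (2 * C + D) * ‖Z‖ ^ 2 := by ring
      have h4 : 4 * κ * (2 * C + D) * ‖Z‖ ^ 2 ≤ c / 4 * ‖Z‖ ^ 2 := by gcongr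
      linarith
    have hpX : p (rePart X) ^ 2 ≤ M * gForm B Z Z := by
      have h1 : |p (rePart X)| ≤ D * ‖Z‖ * ‖X‖ :=
        (p.le_opNorm _).trans (by gcongr; exact norm_rePart_le _)
      have h2 : p (rePart X) ^ 2 ≤ (D * ‖Z‖ * ‖X‖) ^ 2 := by
        rw [← sq_abs]; gcongr
      have h3 := le_gForm hc.le hB X
      have h4 : ‖X‖ ^ 2 ≤ 2 / c := by
        rw [le_div_iff₀ hc]; nlinarith
      have h5 : ‖Z‖ ^ 2 ≤ 2 / c * gForm B Z Z := by
        rw [div_mul_eq_mul_div, le_div_iff₀ hc]; nlinarith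
      have h6 : ‖Z‖ ^ 2 * ‖X‖ ^ 2 ≤ (2 / c * gForm B Z Z) * (2 / c) :=
        mul_le_mul h5 h4 (sq_nonneg _) (by positivity)
      have h7 : D ^ 2 * (‖Z‖ ^ 2 * ‖X‖ ^ 2) ≤ D ^ 2 * ((2 / c * gForm B Z Z) * (2 / c)) :=
        mul_le_mul_of_nonneg_left h6 (sq_nonneg _)
      have h8 : D ^ 2 * ((2 / c * gForm B Z Z) * (2 / c)) = M * gForm B Z Z := by
        rw [hM]; field_simp; ring
      have h9 : (D * ‖Z‖ * ‖X‖) ^ 2 = D ^ 2 * (‖Z‖ ^ 2 * ‖X‖ ^ 2) := by ring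
      linarith
    have hfin : (M + 2) * gForm B Z Z ≤ (M + 2) * (2 * p (rePart Z)) :=
      mul_le_mul_of_nonneg_left (by linarith) (by positivity)
    linarith

end

/-! ### Potentials that are homogeneous of degree two at infinity -/

/-- The estimates for a potential `ψ` and its homogeneous model `φ`: uniform bounds for the
Hessian of `ψ`, and comparison of the differentials outside the ball of radius `R`. -/
structure PotentialBounds {k : ℕ} (ψ φ : (Fin k → ℝ) → ℝ) (c C R : ℝ) : Prop where
  c_pos : 0 < c
  C_pos : 0 < C
  R_pos : 0 < R
  smooth : ContDiff ℝ ∞ ψ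
  pinched : ∀ x, Pinched c C (fderiv ℝ (fderiv ℝ ψ) x)
  mono : ∀ x y, c * ‖x - y‖ ^ 2 ≤ (fderiv ℝ ψ x - fderiv ℝ ψ y) (x - y)
  lipschitz : ∀ x y, ‖fderiv ℝ ψ x - fderiv ℝ ψ y‖ ≤ C * ‖x - y‖
  eq_of_lt : ∀ x, R < ‖x‖ → ψ x = φ x
  fderiv_eq : ∀ (u : Fin k → ℝ) (r : ℝ), 0 < r → R < ‖r • u‖ →
    fderiv ℝ ψ (r • u) = r • fderiv ℝ φ u
  homog : IsHomogeneousTwo φ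

lemma IsHomogeneousTwo.fderiv_smul {k : ℕ} {φ : (Fin k → ℝ) → ℝ} (hφ : IsHomogeneousTwo φ)
    {r : ℝ} (hr : 0 < r) (u : Fin k → ℝ) : fderiv ℝ φ (r • u) = r • fderiv ℝ φ u := by
  have h1 : (fun x => φ (r • x)) = r ^ 2 • φ := by
    funext x; rw [hφ r hr x, Pi.smul_apply, smul_eq_mul]
  have h2 : fderiv ℝ (fun x => φ (r • x)) u = r • fderiv ℝ φ (r • u) := fderiv_comp_smul _
  rw [h1, fderiv_const_smul_field, Pi.smul_apply] at h2
  have h3 : r⁻¹ • (r ^ 2 • fderiv ℝ φ u) = fderiv ℝ φ (r • u) := by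
    rw [h2, smul_smul, inv_mul_cancel₀ hr.ne', one_smul]
  rw [← h3, smul_smul]
  congr 1
  field_simp

lemma contDiff_fderiv_of_contDiff {k : ℕ} {ψ : (Fin k → ℝ) → ℝ} (h : ContDiff ℝ ∞ ψ) :
    ContDiff ℝ ∞ (fderiv ℝ ψ) := h.fderiv_right (by simp)

/-- Since the Hessian is homogeneous of degree zero at infinity, it is bounded above and below on
all of `ℝ^k`. -/
lemma exists_pinched_fderiv_fderiv {k : ℕ} {ψ φ : (Fin k → ℝ) → ℝ} (hψ : IsPotential ψ)
    (hφ : IsHomogeneousTwo φ) {R : ℝ} (hR : 0 < R) (hψφ : ∀ x, R < ‖x‖ → ψ x = φ x) :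
    ∃ c > 0, ∃ C > 0, ∀ x, Pinched c C (fderiv ℝ (fderiv ℝ ψ) x) ∧
      ‖fderiv ℝ (fderiv ℝ ψ) x‖ ≤ C := by
  have hev : ∀ x : Fin k → ℝ, R < ‖x‖ → fderiv ℝ ψ x = fderiv ℝ φ x := by
    intro x hx
    have : ψ =ᶠ[𝓝 x] φ := by
      filter_upwards [(isOpen_lt continuous_const continuous_norm).mem_nhds hx] with y hy
      exact hψφ y hy
    exact this.fderiv_eq
  -- outside the ball the Hessian is invariant under dilations
  have hH : ∀ (r : ℝ) (x : Fin k → ℝ), 1 ≤ r → R < ‖x‖ →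
      fderiv ℝ (fderiv ℝ ψ) (r • x) = fderiv ℝ (fderiv ℝ ψ) x := by
    intro r x hr hx
    have hr0 : 0 < r := by linarith
    have h1 : (fun y => fderiv ℝ ψ (r • y)) =ᶠ[𝓝 x] r • fderiv ℝ ψ := by
      filter_upwards [(isOpen_lt continuous_const continuous_norm).mem_nhds hx] with y hy
      have hy' : R < ‖r • y‖ := by
        rw [norm_smul, Real.norm_of_nonneg hr0.le]
        have : R < ‖y‖ := hy
        nlinarith
      rw [Pi.smul_apply, hev _ hy', hev _ hy, hφ.fderiv_smul hr0]
    have h2 : fderiv ℝ (fun y => fderiv ℝ ψ (r • y)) x = r • fderiv ℝ (fderiv ℝ ψ) (r • x) :=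
      fderiv_comp_smul _
    have h3 : fderiv ℝ (r • fderiv ℝ ψ) x = r • fderiv ℝ (fderiv ℝ ψ) x :=
      fderiv_const_smul
        ((contDiff_fderiv_of_contDiff hψ.smooth).differentiable (by simp) x) r
    rw [h1.fderiv_eq, h3] at h2
    exact (smul_right_injective _ hr0.ne' h2).symm
  have hcont : Continuous (fderiv ℝ (fderiv ℝ ψ)) :=
    (contDiff_fderiv_of_contDiff hψ.smooth).continuous_fderiv (by simp)
  -- hence all its values are taken on a compact ball
  have hred : ∀ x : Fin k → ℝ, ∃ y ∈ Metric.closedBall (0 : Fin k → ℝ) (R + 1),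
      fderiv ℝ (fderiv ℝ ψ) x = fderiv ℝ (fderiv ℝ ψ) y := by
    intro x
    by_cases hx : ‖x‖ ≤ R + 1
    · exact ⟨x, by simpa using hx, rfl⟩
    · push Not at hx
      have hx0 : 0 < ‖x‖ := by linarith
      have hn : ‖((R + 1) / ‖x‖) • x‖ = R + 1 := by
        rw [norm_smul, Real.norm_of_nonneg (by positivity)]; field_simp
      refine ⟨((R + 1) / ‖x‖) • x, by simp [hn], ?_⟩
      rw [← hH (‖x‖ / (R + 1)) (((R + 1) / ‖x‖) • x)
        (by rw [le_div_iff₀ (by positivity)]; linarith) (by rw [hn]; linarith), smul_smul]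
      congr 1
      rw [div_mul_div_comm, mul_comm, div_self (by positivity), one_smul]
  have hK := isCompact_closedBall (0 : Fin k → ℝ) (R + 1)
  obtain ⟨C, hC⟩ := hK.exists_bound_of_continuousOn (f := fderiv ℝ (fderiv ℝ ψ))
    hcont.continuousOn
  obtain ⟨c, hc, hcle⟩ := (hK.prod (isCompact_sphere (0 : Fin k → ℝ) 1)).exists_forall_le'
    (f := fun q => fderiv ℝ (fderiv ℝ ψ) q.1 q.2 q.2) (a := (0 : ℝ))
    (((hcont.comp continuous_fst).clm_apply continuous_snd).clm_apply continuous_snd).continuousOn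
    (fun q hq => hψ.posDef q.1 q.2 (by
      rintro h
      have := hq.2
      simp [h] at this))
  refine ⟨c, hc, max C 1, by positivity, fun x => ?_⟩
  obtain ⟨y, hy, hxy⟩ := hred x
  have hbd : ‖fderiv ℝ (fderiv ℝ ψ) x‖ ≤ max C 1 := by
    rw [hxy]; exact (hC y hy).trans (le_max_left _ _)
  refine ⟨⟨fun u v => ?_, fun v => ?_, fun u v => ?_⟩, hbd⟩
  · refine second_derivative_symmetric (f := ψ) (f' := fderiv ℝ ψ) (x := x) (fun z => ?_) ?_ u v
    · exact (hψ.smooth.differentiable (by simp) z).hasFDerivAt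
    · exact ((contDiff_fderiv_of_contDiff hψ.smooth).differentiable
        (by simp) x).hasFDerivAt
  · rw [hxy]
    by_cases hv : v = 0
    · simp [hv]
    · have hv0 : 0 < ‖v‖ := norm_pos_iff.2 hv
      have h1 := hcle (y, ‖v‖⁻¹ • v) ⟨hy, by simp [norm_smul, hv0.ne']⟩
      simp only [map_smul, smul_apply, smul_eq_mul] at h1
      calc c * ‖v‖ ^ 2 ≤ (‖v‖⁻¹ * (‖v‖⁻¹ * fderiv ℝ (fderiv ℝ ψ) y v v)) * ‖v‖ ^ 2 := by gcongr
        _ = _ := by field_simp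
  · calc |fderiv ℝ (fderiv ℝ ψ) x u v| ≤ ‖fderiv ℝ (fderiv ℝ ψ) x u‖ * ‖v‖ :=
        (fderiv ℝ (fderiv ℝ ψ) x u).le_opNorm v
      _ ≤ (max C 1 * ‖u‖) * ‖v‖ := by
        gcongr
        exact ContinuousLinearMap.le_of_opNorm_le _ hbd u

lemma exists_potentialBounds {k : ℕ} {ψ φ : (Fin k → ℝ) → ℝ} (hψ : IsPotential ψ)
    (hφ : IsHomogeneousTwo φ)
    (hψφ : ∃ K : Set (Fin k → ℝ), IsCompact K ∧ ∀ x, x ∉ K → ψ x = φ x) :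
    ∃ c C R, PotentialBounds ψ φ c C R := by
  obtain ⟨K, hK, hKeq⟩ := hψφ
  obtain ⟨R, hR, hKR⟩ := hK.isBounded.subset_closedBall_lt 0 0
  have heq : ∀ x, R < ‖x‖ → ψ x = φ x := fun x hx => hKeq x fun h => by
    have := hKR h
    rw [mem_closedBall_zero_iff] at this
    linarith
  obtain ⟨c, hc, C, hC, hp⟩ := exists_pinched_fderiv_fderiv hψ hφ hR heq
  have hd := (contDiff_fderiv_of_contDiff hψ.smooth).differentiable (by simp)
  refine ⟨c, C, R, hc, hC, hR, hψ.smooth, fun x => (hp x).1, fun x y => ?_, fun x y => ?_, heq,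
    fun u r hr hu => ?_, hφ⟩
  · have hg : ∀ s : ℝ, HasDerivAt (fun s : ℝ => fderiv ℝ ψ (y + s • (x - y)) (x - y))
        (fderiv ℝ (fderiv ℝ ψ) (y + s • (x - y)) (x - y) (x - y)) s := by
      intro s
      have h1 : HasDerivAt (fun s : ℝ => y + s • (x - y)) (x - y) s := by
        simpa using ((hasDerivAt_id s).smul_const (x - y)).const_add y
      have h2 := (hd (y + s • (x - y))).hasFDerivAt.comp_hasDerivAt s h1
      exact h2.clm_apply (hasDerivAt_const s (x - y)) |>.congr_deriv (by simp)
    have := mul_sub_le_image_sub_of_le_deriv (C := c * ‖x - y‖ ^ 2)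
      (fun s => (hg s).differentiableAt) (fun s => by rw [(hg s).deriv]; exact (hp _).1.lower _)
      (zero_le_one (α := ℝ))
    simpa using this
  · exact Convex.norm_image_sub_le_of_norm_fderiv_le (𝕜 := ℝ) (fun z _ => hd z)
      (fun z _ => (hp z).2) convex_univ (Set.mem_univ y) (Set.mem_univ x)
  · rw [← hφ.fderiv_smul hr]
    refine Filter.EventuallyEq.fderiv_eq ?_
    filter_upwards [(isOpen_lt continuous_const continuous_norm).mem_nhds hu] with y hy
    exact heq y hy

namespace PotentialBounds

variable {k : ℕ} {ψ φ : (Fin k → ℝ) → ℝ} {c C R : ℝ}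

/-- Homogeneity transfers statements about `ψ` at infinity to `φ` at nonzero points: two such points
can be moved into the region where `ψ = φ` by the same dilation. -/
lemma exists_scale (h : PotentialBounds ψ φ c C R) {x y : Fin k → ℝ} (hx : x ≠ 0) (hy : y ≠ 0) :
    ∃ r : ℝ, 0 < r ∧ R < ‖r • x‖ ∧ R < ‖r • y‖ := by
  have hx0 : 0 < ‖x‖ := norm_pos_iff.2 hx
  have hy0 : 0 < ‖y‖ := norm_pos_iff.2 hy
  have hR := h.R_pos
  refine ⟨R / ‖x‖ + R / ‖y‖, by positivity, ?_, ?_⟩ <;>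
  · rw [norm_smul, Real.norm_of_nonneg (by positivity), add_mul]
    have h1 : R / ‖x‖ * ‖x‖ = R := by field_simp
    have h2 : R / ‖y‖ * ‖y‖ = R := by field_simp
    have h3 : 0 < R / ‖x‖ * ‖y‖ := by positivity
    have h4 : 0 < R / ‖y‖ * ‖x‖ := by positivity
    linarith

lemma mono_model (h : PotentialBounds ψ φ c C R) {x y : Fin k → ℝ} (hx : x ≠ 0) (hy : y ≠ 0) :
    c * ‖x - y‖ ^ 2 ≤ (fderiv ℝ φ x - fderiv ℝ φ y) (x - y) := by
  obtain ⟨r, hr, h1, h2⟩ := h.exists_scale hx hy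
  have := h.mono (r • x) (r • y)
  rw [h.fderiv_eq _ _ hr h1, h.fderiv_eq _ _ hr h2, ← smul_sub,
    ← smul_sub r (fderiv ℝ φ x) (fderiv ℝ φ y), norm_smul,
    Real.norm_of_nonneg hr.le] at this
  simp only [map_smul, smul_apply, smul_eq_mul] at this
  have h3 : r ^ 2 * (c * ‖x - y‖ ^ 2) ≤ r ^ 2 * ((fderiv ℝ φ x - fderiv ℝ φ y) (x - y)) := by
    linarith
  exact le_of_mul_le_mul_left h3 (by positivity)

lemma lipschitz_model (h : PotentialBounds ψ φ c C R) {x y : Fin k → ℝ} (hx : x ≠ 0)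
    (hy : y ≠ 0) : ‖fderiv ℝ φ x - fderiv ℝ φ y‖ ≤ C * ‖x - y‖ := by
  obtain ⟨r, hr, h1, h2⟩ := h.exists_scale hx hy
  have := h.lipschitz (r • x) (r • y)
  rw [h.fderiv_eq _ _ hr h1, h.fderiv_eq _ _ hr h2, ← smul_sub,
    ← smul_sub r (fderiv ℝ φ x) (fderiv ℝ φ y), norm_smul, norm_smul,
    Real.norm_of_nonneg hr.le] at this
  have h3 : r * ‖fderiv ℝ φ x - fderiv ℝ φ y‖ ≤ r * (C * ‖x - y‖) := by linarith
  exact le_of_mul_le_mul_left h3 hr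

lemma norm_fderiv_model_le (h : PotentialBounds ψ φ c C R) {x : Fin k → ℝ} (hx : x ≠ 0) :
    ‖fderiv ℝ φ x‖ ≤ C * ‖x‖ := by
  have h1 := h.lipschitz_model hx (smul_ne_zero (by norm_num : (2⁻¹ : ℝ) ≠ 0) hx)
  rw [h.homog.fderiv_smul (by norm_num)] at h1
  have e1 : x - (2⁻¹ : ℝ) • x = (2⁻¹ : ℝ) • x := by module
  have e2 : fderiv ℝ φ x - (2⁻¹ : ℝ) • fderiv ℝ φ x = (2⁻¹ : ℝ) • fderiv ℝ φ x := by module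
  rw [e1, e2, norm_smul, norm_smul] at h1
  norm_num at h1
  linarith

lemma le_fderiv_model_self (h : PotentialBounds ψ φ c C R) {x : Fin k → ℝ} (hx : x ≠ 0) :
    c * ‖x‖ ^ 2 ≤ fderiv ℝ φ x x := by
  have h1 := h.mono_model hx (smul_ne_zero (by norm_num : (2⁻¹ : ℝ) ≠ 0) hx)
  rw [h.homog.fderiv_smul (by norm_num)] at h1
  have e1 : x - (2⁻¹ : ℝ) • x = (2⁻¹ : ℝ) • x := by module
  have e2 : fderiv ℝ φ x - (2⁻¹ : ℝ) • fderiv ℝ φ x = (2⁻¹ : ℝ) • fderiv ℝ φ x := by module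
  rw [e1, e2, norm_smul] at h1
  simp only [map_smul, smul_apply, smul_eq_mul] at h1
  norm_num at h1
  linarith

/-- The tangent plane inequality for the convex function `ψ`. -/
lemma tangent_le (h : PotentialBounds ψ φ c C R) (x y : Fin k → ℝ) :
    ψ x + fderiv ℝ ψ x (y - x) ≤ ψ y := by
  have hd := h.smooth.differentiable (by simp)
  have hg : ∀ s : ℝ, HasDerivAt (fun s : ℝ => ψ (x + s • (y - x)))
      (fderiv ℝ ψ (x + s • (y - x)) (y - x)) s := by
    intro s
    have h1 : HasDerivAt (fun s : ℝ => x + s • (y - x)) (y - x) s := by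
      simpa using ((hasDerivAt_id s).smul_const (y - x)).const_add x
    exact (hd (x + s • (y - x))).hasFDerivAt.comp_hasDerivAt s h1
  obtain ⟨s, hs, hs'⟩ := exists_hasDerivAt_eq_slope _ _ (zero_lt_one (α := ℝ))
    (fun s _ => (hg s).continuousAt.continuousWithinAt) (fun s _ => hg s)
  simp only [zero_smul, add_zero, one_smul, add_sub_cancel, sub_zero, div_one] at hs'
  have h2 := h.mono (x + s • (y - x)) x
  rw [add_sub_cancel_left, map_smul, smul_eq_mul] at h2
  have h3 : 0 ≤ s * (fderiv ℝ ψ (x + s • (y - x)) - fderiv ℝ ψ x) (y - x) :=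
    le_trans (by have := h.c_pos; positivity) h2
  have h4 := nonneg_of_mul_nonneg_right h3 hs.1
  rw [sub_apply] at h4
  linarith

/-- The tangent plane inequality for the homogeneous model. -/
lemma tangent_le_model (h : PotentialBounds ψ φ c C R) {x : Fin k → ℝ} (hx : x ≠ 0)
    (y : Fin k → ℝ) : φ x + fderiv ℝ φ x (y - x) ≤ φ y := by
  have main : ∀ y, y ≠ 0 → φ x + fderiv ℝ φ x (y - x) ≤ φ y := by
    intro y hy
    obtain ⟨r, hr, h1, h2⟩ := h.exists_scale hx hy
    have := h.tangent_le (r • x) (r • y)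
    rw [h.fderiv_eq _ _ hr h1, h.eq_of_lt _ h1, h.eq_of_lt _ h2, h.homog r hr, h.homog r hr,
      ← smul_sub, map_smul] at this
    simp only [smul_apply, smul_eq_mul] at this
    have h3 : r ^ 2 * (φ x + fderiv ℝ φ x (y - x)) ≤ r ^ 2 * φ y := by linarith
    exact le_of_mul_le_mul_left h3 (by positivity)
  by_cases hy : y = 0
  · subst hy
    have h0 : φ 0 = 0 := by
      have := h.homog 2 (by norm_num) 0
      rw [smul_zero] at this
      linarith
    have h1 := main ((2⁻¹ : ℝ) • x) (smul_ne_zero (by norm_num) hx)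
    have h2 := le_trans (by have := h.c_pos; positivity) (h.le_fderiv_model_self hx)
    have e1 : (2⁻¹ : ℝ) • x - x = -((2⁻¹ : ℝ) • x) := by module
    rw [e1, h.homog _ (by norm_num), map_neg, map_smul, smul_eq_mul] at h1
    rw [h0, zero_sub, map_neg]
    by_cases h3 : 0 ≤ φ x <;> linarith
  · exact main y hy

/-- The sublevel sets of `ψ` are bounded. -/
lemma exists_norm_le_of_le (h : PotentialBounds ψ φ c C R) (b : ℝ) :
    ∃ M, ∀ x, ψ x ≤ b → ‖x‖ ≤ M := by
  have hc := h.c_pos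
  set p := fderiv ℝ ψ 0
  refine ⟨max 1 ((|b| + |ψ 0| + ‖p‖) * 4 / c), fun x hx => ?_⟩
  have h1 := h.tangent_le 0 ((2⁻¹ : ℝ) • x)
  have h2 := h.tangent_le ((2⁻¹ : ℝ) • x) x
  have h3 := h.mono ((2⁻¹ : ℝ) • x) 0
  have e1 : x - (2⁻¹ : ℝ) • x = (2⁻¹ : ℝ) • x := by module
  rw [e1] at h2
  rw [sub_zero, sub_apply, norm_smul] at h3
  rw [sub_zero] at h1
  have h4 : |p ((2⁻¹ : ℝ) • x)| ≤ ‖p‖ * (2⁻¹ * ‖x‖) := by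
    refine (p.le_opNorm _).trans (le_of_eq ?_)
    rw [norm_smul]; norm_num
  norm_num at h3
  have h5 := (abs_le.1 h4).1
  have h6 := neg_abs_le (ψ 0)
  have h7 := le_abs_self b
  by_contra hcon
  push Not at hcon
  obtain ⟨h8, h9⟩ := max_lt_iff.1 hcon
  rw [div_lt_iff₀ hc] at h9
  have h10 : (|b| + |ψ 0| + ‖p‖) * ‖x‖ < c * ‖x‖ ^ 2 / 4 := by nlinarith
  have h11 : 0 ≤ (|b| + |ψ 0|) * (‖x‖ - 1) :=
    mul_nonneg (by positivity) (by linarith)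
  norm_num at h1 h2 h5
  nlinarith [norm_nonneg p]

end PotentialBounds

/-! ### Regular faces and near-maximal sets of affine functions -/

/-- The linear form `u ↦ a · u`. -/
def pairing {k : ℕ} (a : Fin k → ℤ) : (Fin k → ℝ) →L[ℝ] ℝ :=
  ∑ i, (a i : ℝ) • ContinuousLinearMap.proj (R := ℝ) (φ := fun _ : Fin k => ℝ) i

lemma pairing_apply {k : ℕ} (a : Fin k → ℤ) (u : Fin k → ℝ) :
    pairing a u = ∑ i, (a i : ℝ) * u i := by
  simp [pairing]

lemma height_eq {k : ℕ} (ν : (Fin k → ℤ) → ℝ) (a : Fin k → ℤ) (u : Fin k → ℝ) :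
    height ν a u = pairing a u - ν a := by
  rw [height, pairing_apply]

@[simp] lemma pairing_zero {k : ℕ} : pairing (0 : Fin k → ℤ) = 0 := by
  ext u; simp [pairing]

lemma latticePt_injective {k : ℕ} : Function.Injective (latticePt (k := k)) := by
  intro a b h
  funext i
  have := congrFun h i
  simpa [latticePt] using this

/-- The facts about the subdivision `Δ_ν` that are used: it is a simplicial complex with vertex
set `A`, and elements of `A` that are simultaneously nearly maximal span, together with the
vertex `0`, a simplex. -/
structure IsCentralTriangulation {k : ℕ} (A : Finset (Fin k → ℤ)) (ν : (Fin k → ℤ) → ℝ) : Prop where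
  zero_mem : 0 ∈ A
  nu_zero : ν 0 = 0
  nu_pos : ∀ a ∈ A, a ≠ 0 → 0 < ν a
  subset : ∀ σ τ, IsRegularFace A ν σ → τ ⊆ σ → τ.Nonempty → IsRegularFace A ν τ
  singleton : ∀ a ∈ A, IsRegularFace A ν {a}
  indep : ∀ σ, IsRegularFace A ν σ → ∀ r : (Fin k → ℤ) → ℝ,
    ∑ a ∈ σ, r a • latticePt a = 0 → ∑ a ∈ σ, r a = 0 → ∀ a ∈ σ, r a = 0
  near_max : ∃ η > 0, ∀ u, ∃ σ, IsRegularFace A ν σ ∧ 0 ∈ σ ∧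
    ∀ a ∈ A, (∀ b ∈ A, height ν b u < height ν a u + η) → a ∈ σ

lemma exists_ball_of_mem_intrinsicInterior {k : ℕ} {s : Set (Fin k → ℝ)} {x : Fin k → ℝ}
    (hx : x ∈ intrinsicInterior ℝ s) :
    ∃ ε > 0, ∀ y ∈ affineSpan ℝ s, dist y x < ε → y ∈ s := by
  obtain ⟨x', hx', rfl⟩ := mem_intrinsicInterior.1 hx
  obtain ⟨ε, hε, h⟩ := Metric.mem_nhds_iff.1 (mem_interior_iff_mem_nhds.1 hx')
  refine ⟨ε, hε, fun y hy hd => ?_⟩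
  exact @h ⟨y, hy⟩ (by simpa [Subtype.dist_eq] using hd)

/-- Moving from a point of a convex set towards a relative interior point leads into the relative
interior. -/
lemma notMem_intrinsicFrontier_combo {k : ℕ} {s : Set (Fin k → ℝ)} (hs : Convex ℝ s)
    {x y : Fin k → ℝ} (hx : x ∈ intrinsicInterior ℝ s) (hy : y ∈ s) {r : ℝ} (hr : 0 < r)
    (hr1 : r < 1) : y + r • (x - y) ∉ intrinsicFrontier ℝ s := by
  obtain ⟨ε, hε, h⟩ := exists_ball_of_mem_intrinsicInterior hx
  intro hf
  obtain ⟨z, hz, hzy⟩ := mem_intrinsicFrontier.1 hf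
  refine Set.disjoint_left.1 disjoint_interior_frontier (mem_interior_iff_mem_nhds.2 ?_) hz
  refine Metric.mem_nhds_iff.2 ⟨r * ε, by positivity, fun w hw => ?_⟩
  rw [Metric.mem_ball, Subtype.dist_eq, hzy] at hw
  set q : Fin k → ℝ := (w : Fin k → ℝ)
  have hq1 : AffineMap.lineMap y q r⁻¹ ∈ affineSpan ℝ s :=
    AffineMap.lineMap_mem _ (subset_affineSpan ℝ s hy) w.2
  have hq2 : dist (AffineMap.lineMap y q r⁻¹) x < ε := by
    have e : AffineMap.lineMap y q r⁻¹ - x = r⁻¹ • (q - (y + r • (x - y))) := by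
      rw [AffineMap.lineMap_apply, vsub_eq_sub, vadd_eq_add, smul_sub, smul_sub, smul_add,
        smul_smul, inv_mul_cancel₀ hr.ne', one_smul]
      abel
    rw [dist_eq_norm, e, norm_smul, Real.norm_of_nonneg (by positivity), ← dist_eq_norm]
    rw [inv_mul_lt_iff₀ hr]
    exact hw
  have hq3 := h _ hq1 hq2
  have hq4 : q = (1 - r) • y + r • AffineMap.lineMap y q r⁻¹ := by
    rw [AffineMap.lineMap_apply, vsub_eq_sub, vadd_eq_add, smul_add, smul_smul,
      mul_inv_cancel₀ hr.ne']
    module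
  show q ∈ s
  rw [hq4]
  exact hs hy hq3 (by linarith) hr.le (by ring)

section

variable {k : ℕ} {A : Finset (Fin k → ℤ)} {ν : (Fin k → ℤ) → ℝ}
  {T : Geometry.SimplicialComplex ℝ (Fin k → ℝ)}

lemma coe_image_latticePt [DecidableEq (Fin k → ℝ)] (τ : Finset (Fin k → ℤ)) :
    ((τ.image latticePt : Finset (Fin k → ℝ)) : Set (Fin k → ℝ)) =
      latticePt '' (τ : Set (Fin k → ℤ)) := by simp

open Classical in
lemma isRegularFace_iff (hν : Induces A ν T) (τ : Finset (Fin k → ℤ)) :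
    IsRegularFace A ν τ ↔ τ.image latticePt ∈ T.faces := by
  rw [hν]
  constructor
  · intro h
    exact ⟨τ, h, coe_image_latticePt τ⟩
  · rintro ⟨τ', h', he⟩
    rw [coe_image_latticePt] at he
    have := Set.image_injective.2 latticePt_injective he
    rw [Finset.coe_inj] at this
    rwa [this]

open Classical in
lemma exists_regularFace_of_mem_polytope (hT : IsStarShapedTriangulation A T)
    (hν : Induces A ν T) {y : Fin k → ℝ} (hy : y ∈ polytope A) :
    ∃ σ, IsRegularFace A ν σ ∧ σ.image latticePt ∈ T.faces ∧
      y ∈ convexHull ℝ (σ.image latticePt : Set (Fin k → ℝ)) := by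
  rw [← hT.space_eq, Geometry.SimplicialComplex.mem_space_iff] at hy
  obtain ⟨s, hs, hys⟩ := hy
  obtain ⟨σ, hσ, he⟩ := (hν s).1 hs
  rw [← coe_image_latticePt, Finset.coe_inj] at he
  exact ⟨σ, hσ, he ▸ hs, he ▸ hys⟩

open Classical in
lemma exists_weights {σ : Finset (Fin k → ℤ)} {y : Fin k → ℝ}
    (hy : y ∈ convexHull ℝ (σ.image latticePt : Set (Fin k → ℝ))) :
    ∃ w : (Fin k → ℤ) → ℝ, (∀ a ∈ σ, 0 ≤ w a) ∧ ∑ a ∈ σ, w a = 1 ∧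
      ∑ a ∈ σ, w a • latticePt a = y := by
  obtain ⟨w, h1, h2, h3⟩ := Finset.mem_convexHull'.1 hy
  refine ⟨fun a => w (latticePt a), fun a ha => h1 _ (Finset.mem_image_of_mem _ ha), ?_, ?_⟩
  · rwa [Finset.sum_image fun a _ b _ h => latticePt_injective h] at h2
  · rwa [Finset.sum_image fun a _ b _ h => latticePt_injective h] at h3

lemma sum_pairing_eq (τ : Finset (Fin k → ℤ)) (v : (Fin k → ℤ) → ℝ) (u : Fin k → ℝ) :
    ∑ a ∈ τ, v a * pairing a u = ∑ i, (∑ a ∈ τ, v a • latticePt a) i * u i := by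
  simp only [pairing_apply, Finset.sum_apply, Pi.smul_apply, latticePt, smul_eq_mul,
    Finset.mul_sum, Finset.sum_mul]
  rw [Finset.sum_comm]
  exact Finset.sum_congr rfl fun i _ => Finset.sum_congr rfl fun a _ => by ring

/-- Two convex combinations of the same point, one of them on a regular face: either the first is
supported on that face as well, or its average value of `ν` is larger. -/
lemma subset_or_sum_lt {σ τ : Finset (Fin k → ℤ)} (hσ : IsRegularFace A ν σ) (hτ : τ ⊆ A)
    {v w : (Fin k → ℤ) → ℝ} (hv : ∀ a ∈ τ, 0 < v a) (hv1 : ∑ a ∈ τ, v a = 1)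
    (hw1 : ∑ a ∈ σ, w a = 1)
    (heq : ∑ a ∈ τ, v a • latticePt a = ∑ a ∈ σ, w a • latticePt a) :
    τ ⊆ σ ∨ ∑ a ∈ σ, w a * ν a < ∑ a ∈ τ, v a * ν a := by
  by_cases h : τ ⊆ σ
  · exact Or.inl h
  refine Or.inr ?_
  obtain ⟨-, -, u, c, h1, h2⟩ := hσ
  simp only [← pairing_apply] at h1 h2
  have e1 : ∑ a ∈ σ, w a * ν a = ∑ a ∈ τ, v a * (pairing a u + c) := by
    have : ∑ a ∈ σ, w a * ν a = ∑ a ∈ σ, w a * (pairing a u + c) :=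
      Finset.sum_congr rfl fun a ha => by rw [h1 a ha]
    rw [this]
    simp only [mul_add, Finset.sum_add_distrib, ← Finset.sum_mul, hv1, hw1]
    rw [sum_pairing_eq, sum_pairing_eq, heq]
  rw [e1]
  obtain ⟨b, hb, hbσ⟩ := Finset.not_subset.1 h
  refine Finset.sum_lt_sum (fun a ha => ?_) ⟨b, hb, ?_⟩
  · refine mul_le_mul_of_nonneg_left ?_ (hv a ha).le
    by_cases haσ : a ∈ σ
    · exact (h1 a haσ).le
    · exact (h2 a (hτ ha) haσ).le
  · exact mul_lt_mul_of_pos_left (h2 b (hτ hb) hbσ) (hv b hb)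

lemma barycenter_mem_polytope {τ : Finset (Fin k → ℤ)} (hτ : τ ⊆ A) (hne : τ.Nonempty) :
    ∑ a ∈ τ, (τ.card : ℝ)⁻¹ • latticePt a ∈ polytope A := by
  have hc : (0 : ℝ) < τ.card := by exact_mod_cast hne.card_pos
  refine (convex_convexHull ℝ _).sum_mem (fun _ _ => by positivity) ?_
    fun a ha => subset_convexHull ℝ _ ⟨a, hτ ha, rfl⟩
  rw [Finset.sum_const, nsmul_eq_mul, mul_inv_cancel₀ hc.ne']

open Classical in
/-- Star-shapedness: every regular face is contained in one that has `0` as a vertex. -/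
lemma exists_central_superset (hT : IsStarShapedTriangulation A T) (hν : Induces A ν T)
    {τ : Finset (Fin k → ℤ)} (hτ : IsRegularFace A ν τ) :
    ∃ σ, IsRegularFace A ν σ ∧ 0 ∈ σ ∧ τ ⊆ σ := by
  have hc : (0 : ℝ) < τ.card := by exact_mod_cast hτ.1.card_pos
  set y : Fin k → ℝ := ∑ a ∈ τ, (τ.card : ℝ)⁻¹ • latticePt a with hy
  have hyP : y ∈ polytope A := barycenter_mem_polytope hτ.2.1 hτ.1
  have hconv : Convex ℝ (polytope A) := convex_convexHull ℝ _
  obtain ⟨x, hx⟩ := (Set.Nonempty.intrinsicInterior hconv ⟨y, hyP⟩)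
  -- The simplices with vertex `0` form a closed set containing all points of the relative interior.
  set U : Set (Fin k → ℝ) := ⋃ σ ∈ {σ | σ ∈ A.powerset ∧ IsRegularFace A ν σ ∧ 0 ∈ σ},
    convexHull ℝ (σ.image latticePt : Set (Fin k → ℝ)) with hU
  have hUc : IsClosed U := by
    refine Set.Finite.isClosed_biUnion ((Finset.finite_toSet A.powerset).subset fun σ h => h.1)
      fun σ _ => ?_
    exact (Set.Finite.isCompact_convexHull ℝ (Finset.finite_toSet _)).isClosed
  have hface : ∀ n : ℕ, y + (1 / ((n : ℝ) + 1 + 1)) • (x - y) ∈ U := by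
    intro n
    have hn : (0 : ℝ) < (n : ℝ) + 1 + 1 := by positivity
    have h1 : 1 / ((n : ℝ) + 1 + 1) < 1 := by
      rw [div_lt_one hn]; have := n.cast_nonneg (α := ℝ); linarith
    have hmem : y + (1 / ((n : ℝ) + 1 + 1)) • (x - y) ∈ polytope A :=
      hconv.add_smul_sub_mem hyP (intrinsicInterior_subset hx) ⟨by positivity, h1.le⟩
    obtain ⟨σ, hσ, hσT, hσy⟩ := exists_regularFace_of_mem_polytope hT hν hmem
    refine Set.mem_biUnion (x := σ) ⟨Finset.mem_powerset.2 hσ.2.1, hσ, ?_⟩ hσy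
    have h0 := hT.star _ hσT fun hsub =>
      notMem_intrinsicFrontier_combo hconv hx hyP (by positivity) h1 (hsub hσy)
    rw [Finset.mem_image] at h0
    obtain ⟨a, ha, ha0⟩ := h0
    have : a = 0 := latticePt_injective (by rw [ha0]; funext i; simp [latticePt])
    rwa [this] at ha
  have hlim : Filter.Tendsto (fun n : ℕ => y + (1 / ((n : ℝ) + 1 + 1)) • (x - y)) Filter.atTop
      (𝓝 (y + (0 : ℝ) • (x - y))) := by
    refine tendsto_const_nhds.add (Filter.Tendsto.smul_const ?_ _)
    have := (tendsto_one_div_add_atTop_nhds_zero_nat (𝕜 := ℝ)).comp (Filter.tendsto_add_atTop_nat 1)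
    simpa [Function.comp_def] using this
  rw [zero_smul, add_zero] at hlim
  have hyU : y ∈ U := hUc.mem_of_tendsto hlim (Filter.Eventually.of_forall hface)
  obtain ⟨σ, ⟨-, hσ, h0⟩, hyσ⟩ := Set.mem_iUnion₂.1 hyU
  refine ⟨σ, hσ, h0, ?_⟩
  -- The barycenter of `τ` lies in the simplex on `σ`, and the roles of the two can be exchanged.
  obtain ⟨w, hw, hw1, hwy⟩ := exists_weights hyσ
  rcases subset_or_sum_lt hσ hτ.2.1 (v := fun _ => (τ.card : ℝ)⁻¹) (fun _ _ => by positivity)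
    (by rw [Finset.sum_const, nsmul_eq_mul, mul_inv_cancel₀ hc.ne']) hw1
    (by rw [← hy, hwy]) with h | h
  · exact h
  · exfalso
    obtain ⟨-, -, u, c, h1, h2⟩ := hτ
    simp only [← pairing_apply] at h1 h2
    have e1 : ∑ a ∈ τ, (τ.card : ℝ)⁻¹ * ν a = ∑ a ∈ σ, w a * (pairing a u + c) := by
      have : ∑ a ∈ τ, (τ.card : ℝ)⁻¹ * ν a = ∑ a ∈ τ, (τ.card : ℝ)⁻¹ * (pairing a u + c) :=
        Finset.sum_congr rfl fun a ha => by rw [h1 a ha]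
      rw [this]
      simp only [mul_add, Finset.sum_add_distrib, ← Finset.sum_mul, hw1]
      rw [Finset.sum_const, nsmul_eq_mul, mul_inv_cancel₀ hc.ne',
        sum_pairing_eq τ (fun _ => (τ.card : ℝ)⁻¹), sum_pairing_eq, hwy, ← hy]
    rw [e1] at h
    refine absurd h (not_lt.2 (Finset.sum_le_sum fun a ha => ?_))
    refine mul_le_mul_of_nonneg_left ?_ (hw a ha)
    by_cases haτ : a ∈ τ
    · exact (h1 a haτ).le
    · exact (h2 a (hσ.2.1 ha) haτ).le

open Classical in
/-- If all elements of `τ` are nearly maximal at some point, then `τ` lies in a regular face: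
otherwise the average over `τ` of the heights is smaller, by a fixed amount, than an average of
heights over the face that contains the barycenter of `τ`. -/
lemma eventually_subset_regularFace (hT : IsStarShapedTriangulation A T) (hν : Induces A ν T)
    {τ : Finset (Fin k → ℤ)} (hτ : τ ⊆ A) (hne : τ.Nonempty) :
    ∀ᶠ η in 𝓝[>] (0 : ℝ), ∀ u, (∀ a ∈ τ, ∀ b ∈ A, height ν b u < height ν a u + η) →
      ∃ σ, IsRegularFace A ν σ ∧ τ ⊆ σ := by
  have hc : (0 : ℝ) < τ.card := by exact_mod_cast hne.card_pos
  have hc1 : ∑ a ∈ τ, (τ.card : ℝ)⁻¹ = 1 := by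
    rw [Finset.sum_const, nsmul_eq_mul, mul_inv_cancel₀ hc.ne']
  obtain ⟨σ, hσ, -, hyσ⟩ := exists_regularFace_of_mem_polytope hT hν
    (barycenter_mem_polytope hτ hne)
  obtain ⟨w, hw, hw1, hwy⟩ := exists_weights hyσ
  rcases subset_or_sum_lt hσ hτ (v := fun _ => (τ.card : ℝ)⁻¹) (fun _ _ => by positivity)
    hc1 hw1 hwy.symm with h | h
  · exact Filter.Eventually.of_forall fun _ _ _ => ⟨σ, hσ, h⟩
  · filter_upwards [Ioo_mem_nhdsGT (sub_pos.2 h)] with η hη u hu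
    exfalso
    have h1 : ∀ a ∈ τ, ∑ b ∈ σ, w b * height ν b u < height ν a u + η := by
      intro a ha
      have : ∑ b ∈ σ, w b * height ν b u < ∑ b ∈ σ, w b * (height ν a u + η) := by
        have hpos : ∃ b ∈ σ, 0 < w b := by
          by_contra! hcon
          have := Finset.sum_nonpos hcon
          linarith
        obtain ⟨b, hb, hb0⟩ := hpos
        exact Finset.sum_lt_sum (fun b hb => mul_le_mul_of_nonneg_left
          (hu a ha b (hσ.2.1 hb)).le (hw b hb))
          ⟨b, hb, mul_lt_mul_of_pos_left (hu a ha b (hσ.2.1 hb)) hb0⟩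
      rwa [← Finset.sum_mul, hw1, one_mul] at this
    have h2 : ∑ b ∈ σ, w b * height ν b u <
        ∑ a ∈ τ, (τ.card : ℝ)⁻¹ * (height ν a u + η) := by
      have := Finset.sum_lt_sum_of_nonempty hne fun a ha =>
        mul_lt_mul_of_pos_left (h1 a ha) (by positivity : 0 < (τ.card : ℝ)⁻¹)
      rwa [← Finset.sum_mul, hc1, one_mul] at this
    simp only [height_eq, mul_add, mul_sub, Finset.sum_add_distrib, Finset.sum_sub_distrib] at h2
    rw [← Finset.sum_mul, hc1, one_mul, sum_pairing_eq, hwy,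
      sum_pairing_eq τ (fun _ => (τ.card : ℝ)⁻¹)] at h2
    linarith [hη.2]

open Classical in
/-- A star-shaped triangulation induced by `ν` has the properties of its simplices that are used
below. -/
lemma isCentralTriangulation (hzero : (0 : Fin k → ℤ) ∈ A) (hT : IsStarShapedTriangulation A T)
    (hν : Induces A ν T) (hν0 : ν 0 = 0) (hνpos : ∀ a ∈ A, a ≠ 0 → 0 < ν a) :
    IsCentralTriangulation A ν where
  zero_mem := hzero
  nu_zero := hν0
  nu_pos := hνpos
  subset σ τ hσ hτσ hτ := by
    rw [isRegularFace_iff hν] at hσ ⊢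
    exact T.down_closed hσ (Finset.image_subset_image hτσ) (hτ.image _)
  singleton a ha := by
    rw [isRegularFace_iff hν, Finset.image_singleton, ← Geometry.SimplicialComplex.mem_vertices,
      hT.vertices_eq]
    exact ⟨a, ha, rfl⟩
  indep σ hσ r h1 h2 a ha := by
    have hind := T.indep ((isRegularFace_iff hν σ).1 hσ)
    have hcomp : AffineIndependent ℝ (fun a : σ => latticePt (a : Fin k → ℤ)) := by
      refine hind.comp_embedding ⟨fun a : σ => ⟨latticePt (a : Fin k → ℤ),
        Finset.mem_image_of_mem _ a.2⟩, fun a b hab => ?_⟩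
      exact Subtype.ext (latticePt_injective (congrArg Subtype.val hab))
    refine affineIndependent_iff.1 hcomp Finset.univ (fun a => r a) ?_ ?_ ⟨a, ha⟩
      (Finset.mem_univ _)
    · rw [← h2]; exact Finset.sum_coe_sort σ r
    · rw [← h1]; exact Finset.sum_coe_sort σ (fun a => r a • latticePt a)
  near_max := by
    have h : ∀ᶠ η in 𝓝[>] (0 : ℝ), ∀ τ ∈ A.powerset, τ.Nonempty → ∀ u,
        (∀ a ∈ τ, ∀ b ∈ A, height ν b u < height ν a u + η) →
          ∃ σ, IsRegularFace A ν σ ∧ τ ⊆ σ := by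
      rw [Filter.eventually_all_finset]
      intro τ hτ
      by_cases hne : τ.Nonempty
      · filter_upwards [eventually_subset_regularFace hT hν (Finset.mem_powerset.1 hτ) hne]
          with η h _ using h
      · exact Filter.Eventually.of_forall fun _ h => absurd h hne
    obtain ⟨η, h, hη⟩ := (h.and self_mem_nhdsWithin).exists
    refine ⟨η, hη, fun u => ?_⟩
    set τ := A.filter fun a => ∀ b ∈ A, height ν b u < height ν a u + η with hτ
    have hτne : τ.Nonempty := by
      obtain ⟨a, ha, hmax⟩ := A.exists_max_image (fun a => height ν a u) ⟨0, hzero⟩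
      exact ⟨a, Finset.mem_filter.2 ⟨ha, fun b hb => by
        have := hmax b hb; have : (0 : ℝ) < η := hη; linarith⟩⟩
    obtain ⟨σ₁, hσ₁, hτσ₁⟩ := h τ (Finset.mem_powerset.2 (Finset.filter_subset _ _)) hτne u
      fun a ha => (Finset.mem_filter.1 ha).2
    obtain ⟨σ, hσ, h0, hsub⟩ := exists_central_superset hT hν hσ₁
    exact ⟨σ, hσ, h0, fun a ha hmax => hsub (hτσ₁ (Finset.mem_filter.2 ⟨ha, hmax⟩))⟩

end

/-! ### The minimum points of the homogeneous potential on the faces of the central chamber -/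

lemma PotentialBounds.differentiableAt_model {k : ℕ} {ψ φ : (Fin k → ℝ) → ℝ} {c C R : ℝ}
    (h : PotentialBounds ψ φ c C R) {x : Fin k → ℝ} (hx : x ≠ 0) : DifferentiableAt ℝ φ x := by
  obtain ⟨r, hr, h1, -⟩ := h.exists_scale hx hx
  have hev : φ =ᶠ[𝓝 x] fun y => (r ^ 2)⁻¹ * ψ (r • y) := by
    have ho : IsOpen {y : Fin k → ℝ | R < ‖r • y‖} :=
      isOpen_lt continuous_const (continuous_const_smul r).norm
    filter_upwards [ho.mem_nhds h1] with y hy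
    rw [h.eq_of_lt _ hy, h.homog r hr]
    field_simp
  refine DifferentiableAt.congr_of_eventuallyEq ?_ hev
  have hd := h.smooth.differentiable (by simp)
  fun_prop

/-- The face of the central chamber on which the affine functions of `σ` vanish. -/
def centralFace {k : ℕ} (A : Finset (Fin k → ℤ)) (ν : (Fin k → ℤ) → ℝ)
    (σ : Finset (Fin k → ℤ)) : Set (Fin k → ℝ) :=
  {u | (∀ b ∈ A, height ν b u ≤ 0) ∧ ∀ a ∈ σ, height ν a u = 0}

/-- `x` is the minimum point of `φ` on the face of the central chamber given by `σ`, with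
Lagrange multipliers `r`, normalized to have sum zero. -/
structure IsFaceMin {k : ℕ} (A : Finset (Fin k → ℤ)) (ν : (Fin k → ℤ) → ℝ)
    (φ : (Fin k → ℝ) → ℝ) (σ : Finset (Fin k → ℤ)) (x : Fin k → ℝ) (r : (Fin k → ℤ) → ℝ) :
    Prop where
  height_eq : ∀ a ∈ σ, height ν a x = 0
  height_lt : ∀ b ∈ A, b ∉ σ → height ν b x < 0
  ne_zero : x ≠ 0
  fderiv_eq : fderiv ℝ φ x = ∑ a ∈ σ, r a • pairing a
  sum_eq : ∑ a ∈ σ, r a = 0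
  pos : ∀ a ∈ σ, a ≠ 0 → 0 < r a
  neg : r 0 < 0

section

variable {k : ℕ} {A : Finset (Fin k → ℤ)} {ν : (Fin k → ℤ) → ℝ}

lemma height_zero (hA : IsCentralTriangulation A ν) (u : Fin k → ℝ) : height ν 0 u = 0 := by
  rw [height_eq, hA.nu_zero, pairing_zero]; simp

lemma height_add_smul_sub (a : Fin k → ℤ) (x y : Fin k → ℝ) (s : ℝ) :
    height ν a (x + s • (x - y)) = (1 + s) * height ν a x - s * height ν a y := by
  simp only [height_eq, map_add, map_smul, map_sub, smul_eq_mul]; ring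

/-- An adapted function has a unique minimum point on each central face, at which only the
defining inequalities of that face are equalities. -/
lemma exists_min_centralFace (hA : IsCentralTriangulation A ν) {φ : (Fin k → ℝ) → ℝ}
    (hadapted : IsAdapted φ (chamber A ν 0)) {σ : Finset (Fin k → ℤ)}
    (hσ : IsRegularFace A ν σ) (h0 : 0 ∈ σ) :
    ∃ x ∈ centralFace A ν σ, (∀ b ∈ A, b ∉ σ → height ν b x < 0) ∧
      ∀ y ∈ centralFace A ν σ, y ≠ x → φ x < φ y := by
  obtain ⟨-, hσA, u, c, hu1, hu2⟩ := hσ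
  simp only [← pairing_apply] at hu1 hu2
  have hc : c = 0 := by
    have := hu1 0 h0
    rw [hA.nu_zero, pairing_zero] at this
    simpa using this
  subst hc
  simp only [add_zero] at hu1 hu2
  have hu : u ∈ centralFace A ν σ := by
    refine ⟨fun b hb => ?_, fun a ha => by rw [height_eq, hu1 a ha, sub_self]⟩
    rw [height_eq, sub_nonpos]
    by_cases hbσ : b ∈ σ
    · exact (hu1 b hbσ).le
    · exact (hu2 b hb hbσ).le
  have hch : ∀ v, v ∈ chamber A ν 0 ↔ ∀ b ∈ A, height ν b v ≤ 0 := fun v => by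
    simp [chamber, cell, height_zero hA]
  have hsum : ∀ v, (∑ a ∈ σ, pairing a) v = ∑ a ∈ σ, (height ν a v + ν a) := fun v => by
    rw [sum_apply]
    exact Finset.sum_congr rfl fun a _ => by rw [height_eq]; ring
  -- the sum of the linear forms given by `σ` exposes this face
  have hexp : IsExposed ℝ (chamber A ν 0) (centralFace A ν σ) := by
    intro _
    refine ⟨∑ a ∈ σ, pairing a, ?_⟩
    ext v
    constructor
    · rintro ⟨h1, h2⟩
      refine ⟨(hch v).2 h1, fun y hy => ?_⟩
      rw [hsum, hsum]
      refine Finset.sum_le_sum fun a ha => ?_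
      rw [h2 a ha]
      linarith [(hch y).1 hy a (hσA ha)]
    · rintro ⟨h1, h2⟩
      rw [hch] at h1
      refine ⟨h1, fun a ha => ?_⟩
      have h3 := h2 u ((hch u).2 hu.1)
      rw [hsum, hsum] at h3
      by_contra hne
      have hlt : height ν a v < 0 := lt_of_le_of_ne (h1 a (hσA ha)) hne
      refine absurd h3 (not_le.2 (Finset.sum_lt_sum (fun b hb => ?_) ⟨a, ha, ?_⟩))
      · rw [hu.2 b hb]; linarith [h1 b (hσA hb)]
      · rw [hu.2 a ha]; linarith
  obtain ⟨x, hx, hmin⟩ := hadapted _ ⟨u, hu⟩ hexp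
  have hxF : x ∈ centralFace A ν σ := intrinsicInterior_subset hx
  refine ⟨x, hxF, fun b hb hbσ => ?_, hmin⟩
  -- the segment from `u` to `x` can be prolonged inside the face, which forces the height of `b`,
  -- negative at `u`, to be negative at `x`
  obtain ⟨ε, hε, hball⟩ := exists_ball_of_mem_intrinsicInterior hx
  obtain ⟨s, hs, hsε⟩ : ∃ s > 0, s * ‖x - u‖ < ε := by
    refine ⟨ε / (‖x - u‖ + 1), by positivity, ?_⟩
    rw [div_mul_eq_mul_div, div_lt_iff₀ (by positivity)]
    nlinarith [norm_nonneg (x - u)]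
  have hmem : x + s • (x - u) ∈ affineSpan ℝ (centralFace A ν σ) := by
    have := AffineMap.lineMap_mem (Q := affineSpan ℝ (centralFace A ν σ)) (-s)
      (subset_affineSpan ℝ _ hxF) (subset_affineSpan ℝ _ hu)
    have e : AffineMap.lineMap x u (-s) = x + s • (x - u) := by
      rw [AffineMap.lineMap_apply, vsub_eq_sub, vadd_eq_add]; module
    rwa [e] at this
  have hin := hball _ hmem (by
    rw [dist_eq_norm, add_sub_cancel_left, norm_smul, Real.norm_of_nonneg hs.le]; exact hsε)
  have h1 := hin.1 b hb
  rw [height_add_smul_sub] at h1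
  have h2 : height ν b u < 0 := by rw [height_eq]; linarith [hu2 b hb hbσ]
  by_contra hcon
  push Not at hcon
  nlinarith

/-- A functional vanishing where all vertices of `σ` vanish is a combination of these vertices. As
the vertex `0` contributes nothing to it, the coefficients may be normalized to have sum zero. -/
lemma sum_erase_zero_multiplier {σ : Finset (Fin k → ℤ)} (h0 : 0 ∈ σ)
    (K : (Fin k → ℝ) →L[ℝ] ℝ)
    (hK : ∀ v, (∀ a ∈ σ, pairing a v = 0) → K v = 0) :
    ∃ r : (Fin k → ℤ) → ℝ, K = ∑ a ∈ σ, r a • pairing a ∧ ∑ a ∈ σ, r a = 0 := by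
  classical
  have hspan := mem_span_of_iInf_ker_le_ker
    (L := fun a : σ => (pairing (a : Fin k → ℤ)).toLinearMap) (K := K.toLinearMap) (by
      intro v hv
      simp only [Submodule.mem_iInf, LinearMap.mem_ker] at hv
      exact hK v fun a ha => hv ⟨a, ha⟩)
  obtain ⟨c, hc⟩ := (Submodule.mem_span_range_iff_exists_fun ℝ).1 hspan
  set r₁ : (Fin k → ℤ) → ℝ := fun a => if h : a ∈ σ then c ⟨a, h⟩ else 0 with hr₁
  have h1 : K = ∑ a ∈ σ, r₁ a • pairing a := by
    ext v
    have := congrArg (fun l => l v) hc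
    simp only [LinearMap.sum_apply, LinearMap.smul_apply] at this
    rw [sum_apply, ← Finset.sum_coe_sort]
    refine this.symm.trans (Finset.sum_congr rfl fun a _ => ?_)
    simp [hr₁]
  refine ⟨Function.update r₁ 0 (-∑ a ∈ σ.erase 0, r₁ a), ?_, ?_⟩
  · rw [h1]
    refine Finset.sum_congr rfl fun a _ => ?_
    by_cases h : a = 0
    · subst h; simp
    · rw [Function.update_of_ne h]
  · rw [← Finset.add_sum_erase _ _ h0, Function.update_self,
      Finset.sum_congr rfl fun a ha => Function.update_of_ne (Finset.ne_of_mem_erase ha) _ _]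
    ring

/-- The minimum points of an adapted potential have positive Lagrange multipliers: releasing one
of the constraints decreases the minimum. -/
lemma exists_isFaceMin (hA : IsCentralTriangulation A ν) {ψ φ : (Fin k → ℝ) → ℝ} {c C R : ℝ}
    (hB : PotentialBounds ψ φ c C R) (hadapted : IsAdapted φ (chamber A ν 0))
    {σ : Finset (Fin k → ℤ)} (hσ : IsRegularFace A ν σ) (h0 : 0 ∈ σ) (hne : ∃ a ∈ σ, a ≠ 0) :
    ∃ x r, IsFaceMin A ν φ σ x r := by
  classical
  obtain ⟨x, hxF, hxlt, hmin⟩ := exists_min_centralFace hA hadapted hσ h0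
  obtain ⟨a₀, ha₀, ha₀0⟩ := hne
  have hx0 : x ≠ 0 := by
    rintro rfl
    have := hxF.2 a₀ ha₀
    rw [height_eq, map_zero] at this
    linarith [hA.nu_pos a₀ (hσ.2.1 ha₀) ha₀0]
  -- `x` is a local minimum along all directions that keep the heights of `σ` equal to zero
  have hcrit : ∀ v, (∀ a ∈ σ, pairing a v = 0) → fderiv ℝ φ x v = 0 := by
    intro v hv
    have hcont : ∀ b : Fin k → ℤ, Continuous fun s : ℝ => height ν b (x + s • v) := fun b => by
      simp only [height_eq]; fun_prop
    have hev : ∀ᶠ s : ℝ in 𝓝 0, ∀ b ∈ A, b ∉ σ → height ν b (x + s • v) < 0 := by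
      rw [Filter.eventually_all_finset]
      intro b hb
      by_cases hbσ : b ∈ σ
      · exact Filter.Eventually.of_forall fun _ h => absurd hbσ h
      · have := (hcont b).continuousAt.eventually_lt (x₀ := (0 : ℝ)) (g := fun _ => (0 : ℝ))
          continuousAt_const (by simpa using hxlt b hb hbσ)
        filter_upwards [this] with s hs _ using hs
    have hmem : ∀ᶠ s : ℝ in 𝓝 0, x + s • v ∈ centralFace A ν σ := by
      filter_upwards [hev] with s hs
      have h1 : ∀ a ∈ σ, height ν a (x + s • v) = 0 := fun a ha => by
        have := hxF.2 a ha
        rw [height_eq] at this ⊢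
        rw [map_add, map_smul, hv a ha]; simpa using this
      refine ⟨fun b hb => ?_, h1⟩
      by_cases hbσ : b ∈ σ
      · exact (h1 b hbσ).le
      · exact (hs b hb hbσ).le
    have hloc : IsLocalMin (fun s : ℝ => φ (x + s • v)) 0 := by
      filter_upwards [hmem] with s hs
      simp only [zero_smul, add_zero]
      by_cases h : x + s • v = x
      · rw [h]
      · exact (hmin _ hs h).le
    have hder : HasDerivAt (fun s : ℝ => φ (x + s • v)) (fderiv ℝ φ x v) 0 := by
      have h1 : HasDerivAt (fun s : ℝ => x + s • v) v 0 := by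
        simpa using ((hasDerivAt_id (0 : ℝ)).smul_const v).const_add x
      have h2 : HasFDerivAt φ (fderiv ℝ φ x) (x + (0 : ℝ) • v) := by
        simpa using (hB.differentiableAt_model hx0).hasFDerivAt
      exact h2.comp_hasDerivAt (0 : ℝ) h1
    exact hloc.hasDerivAt_eq_zero hder
  obtain ⟨r, hr, hr0⟩ := sum_erase_zero_multiplier h0 _ hcrit
  -- compare with the smaller minimum on the larger face given by `σ.erase a`, where the height of
  -- `a` is negative
  have hpos : ∀ a ∈ σ, a ≠ 0 → 0 < r a := by
    intro a ha ha0
    have h0' : (0 : Fin k → ℤ) ∈ σ.erase a := Finset.mem_erase.2 ⟨ha0.symm, h0⟩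
    have hσ' : IsRegularFace A ν (σ.erase a) :=
      hA.subset σ _ hσ (Finset.erase_subset _ _) ⟨0, h0'⟩
    obtain ⟨x', hx'F, hx'lt, hmin'⟩ := exists_min_centralFace hA hadapted hσ' h0'
    have hlt := hx'lt a (hσ.2.1 ha) (Finset.notMem_erase _ _)
    have h1 : φ x' < φ x := by
      refine hmin' x ⟨hxF.1, fun b hb => hxF.2 b (Finset.mem_of_mem_erase hb)⟩ ?_
      rintro rfl
      exact hlt.ne (hxF.2 a ha)
    have h2 := hB.tangent_le_model hx0 x'
    have h3 : fderiv ℝ φ x (x' - x) = r a * height ν a x' := by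
      rw [hr, sum_apply, Finset.sum_eq_single a]
      · have := hxF.2 a ha
        rw [height_eq] at this ⊢
        simp only [smul_apply, smul_eq_mul, map_sub]
        linear_combination (-r a) * this
      · intro b hb hba
        have e1 := hxF.2 b hb
        have e2 := hx'F.2 b (Finset.mem_erase.2 ⟨hba, hb⟩)
        rw [height_eq] at e1 e2
        simp only [smul_apply, smul_eq_mul, map_sub]
        linear_combination r b * (e2 - e1)
      · exact fun h => absurd ha h
    rw [h3] at h2
    by_contra hcon
    push Not at hcon
    nlinarith
  refine ⟨x, r, hxF.2, hxlt, hx0, hr, hr0, hpos, ?_⟩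
  rw [← Finset.add_sum_erase _ _ h0] at hr0
  have : 0 < ∑ a ∈ σ.erase 0, r a := Finset.sum_pos
    (fun a ha => hpos a (Finset.mem_of_mem_erase ha) (Finset.ne_of_mem_erase ha))
    ⟨a₀, Finset.mem_erase.2 ⟨ha₀0, ha₀⟩⟩
  linarith

end

/-! ### Quantitative independence of the vertices of a simplex -/

section

variable {k : ℕ} {A : Finset (Fin k → ℤ)} {ν : (Fin k → ℤ) → ℝ}

lemma pairing_single (a : Fin k → ℤ) (i : Fin k) : pairing a (Pi.single i 1) = a i := by
  rw [pairing_apply, Finset.sum_eq_single i]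
  · simp
  · intro j _ hj; simp [hj]
  · simp

lemma sum_smul_latticePt_eq_zero {σ : Finset (Fin k → ℤ)} {r : (Fin k → ℤ) → ℝ}
    (h : ∑ a ∈ σ, r a • pairing a = 0) : ∑ a ∈ σ, r a • latticePt a = 0 := by
  ext i
  have := congrArg (fun l => l (Pi.single i 1)) h
  simp only [sum_apply, smul_apply, pairing_single, zero_apply] at this
  simpa [Finset.sum_apply, latticePt] using this

/-- The coefficients of a combination of the vertices of a regular face are controlled by the
combination and their sum. -/
lemma exists_coeff_bound (hA : IsCentralTriangulation A ν) :
    ∃ K > 0, ∀ σ, IsRegularFace A ν σ → ∀ r : (Fin k → ℤ) → ℝ, ∀ a ∈ σ,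
      |r a| ≤ K * (‖∑ a ∈ σ, r a • pairing a‖ + |∑ a ∈ σ, r a|) := by
  classical
  have h : ∀ᶠ K in Filter.atTop, ∀ σ ∈ A.powerset, IsRegularFace A ν σ →
      ∀ r : (Fin k → ℤ) → ℝ, ∀ a ∈ σ,
      |r a| ≤ K * (‖∑ a ∈ σ, r a • pairing a‖ + |∑ a ∈ σ, r a|) := by
    rw [Filter.eventually_all_finset]
    intro σ _
    by_cases hσ : IsRegularFace A ν σ
    swap
    · exact Filter.Eventually.of_forall fun _ h => absurd h hσ
    let f : (σ → ℝ) →ₗ[ℝ] ((Fin k → ℝ) →L[ℝ] ℝ) × ℝ :=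
      { toFun := fun r => (∑ a, r a • pairing (a : Fin k → ℤ), ∑ a, r a)
        map_add' := fun r s => by
          simp [add_smul, Finset.sum_add_distrib]
        map_smul' := fun c r => by
          simp [Finset.mul_sum, Finset.smul_sum, smul_smul] }
    have hf : LinearMap.ker f = ⊥ := by
      rw [LinearMap.ker_eq_bot']
      intro r hr
      obtain ⟨h1, h2⟩ := Prod.ext_iff.1 hr
      set r' : (Fin k → ℤ) → ℝ := fun a => if h : a ∈ σ then r ⟨a, h⟩ else 0 with hr'
      have hrr : ∀ a : σ, r' a = r a := fun a => by simp [hr']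
      have h3 := hA.indep σ hσ r'
        (sum_smul_latticePt_eq_zero (by
          rw [← Finset.sum_coe_sort]; simp only [hrr]; exact h1))
        (by rw [← Finset.sum_coe_sort]; simp only [hrr]; exact h2)
      ext a
      rw [← hrr]; exact h3 a a.2
    obtain ⟨K, hK, hanti⟩ := f.exists_antilipschitzWith hf
    filter_upwards [Filter.eventually_ge_atTop (K : ℝ)] with K' hK' _ r a ha
    have h1 := hanti.le_mul_dist (fun a : σ => r a) 0
    rw [map_zero, dist_zero_right, dist_zero_right] at h1
    have h2 : ‖f fun a : σ => r a‖ ≤ ‖∑ a ∈ σ, r a • pairing a‖ + |∑ a ∈ σ, r a| := by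
      have e : f (fun a : σ => r a) = (∑ a ∈ σ, r a • pairing a, ∑ a ∈ σ, r a) := by
        rw [← Finset.sum_coe_sort σ, ← Finset.sum_coe_sort σ]; rfl
      rw [e, Prod.norm_def]
      exact max_le (le_add_of_nonneg_right (abs_nonneg _)) (le_add_of_nonneg_left (norm_nonneg _))
    calc |r a| ≤ ‖fun a : σ => r a‖ := norm_le_pi_norm (fun a : σ => r a) ⟨a, ha⟩
      _ ≤ K * ‖f fun a : σ => r a‖ := h1
      _ ≤ K' * (‖∑ a ∈ σ, r a • pairing a‖ + |∑ a ∈ σ, r a|) := by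
        have := K.2.trans hK'
        gcongr
  obtain ⟨K, h, hK⟩ := (h.and (Filter.eventually_gt_atTop 0)).exists
  exact ⟨K, hK, fun σ hσ => h σ (Finset.mem_powerset.2 hσ.2.1) hσ⟩

/-- Prescribed values of the linear forms given by the nonzero vertices of a central simplex are
attained, at a vector of comparable size. -/
lemma exists_solution_bound (hA : IsCentralTriangulation A ν) :
    ∃ K > 0, ∀ σ, IsRegularFace A ν σ → 0 ∈ σ → ∀ (y : (Fin k → ℤ) → ℝ) (b : ℝ), 0 ≤ b →
      (∀ a ∈ σ, |y a| ≤ b) → ∃ v, ‖v‖ ≤ K * b ∧ ∀ a ∈ σ, a ≠ 0 → pairing a v = y a := by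
  classical
  have h : ∀ᶠ K in Filter.atTop, ∀ σ ∈ A.powerset, IsRegularFace A ν σ → 0 ∈ σ →
      ∀ (y : (Fin k → ℤ) → ℝ) (b : ℝ), 0 ≤ b →
      (∀ a ∈ σ, |y a| ≤ b) → ∃ v, ‖v‖ ≤ K * b ∧ ∀ a ∈ σ, a ≠ 0 → pairing a v = y a := by
    rw [Filter.eventually_all_finset]
    intro σ _
    by_cases hσ : IsRegularFace A ν σ ∧ 0 ∈ σ
    swap
    · exact Filter.Eventually.of_forall fun _ h h' => absurd ⟨h, h'⟩ hσ
    obtain ⟨hσ, h0⟩ := hσ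
    let f : (Fin k → ℝ) →L[ℝ] (σ.erase 0 → ℝ) :=
      ContinuousLinearMap.pi fun a => pairing (a : Fin k → ℤ)
    -- a linear functional vanishing on the range is a linear relation between the vertices
    have hf : Function.Surjective f := by
      by_contra hns
      have hlt : LinearMap.range f.toLinearMap < ⊤ :=
        lt_top_iff_ne_top.2 fun h => hns (LinearMap.range_eq_top.1 h)
      obtain ⟨g, hg, hgle⟩ := Submodule.exists_le_ker_of_lt_top _ hlt
      apply hg
      have hgsum : ∀ y, g y = ∑ a, y a * g (Pi.single a 1) := fun y => by
        conv_lhs => rw [pi_eq_sum_univ' y]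
        simp [map_sum]
      set r₁ : (Fin k → ℤ) → ℝ := fun a => if h : a ∈ σ.erase 0 then g (Pi.single ⟨a, h⟩ 1) else 0
        with hr₁
      have hrr : ∀ a : σ.erase 0, r₁ a = g (Pi.single a 1) := fun a => by
        simp only [hr₁]; rw [dif_pos a.2]
      have hvan : ∑ a ∈ σ.erase 0, r₁ a • pairing a = 0 := by
        ext v
        have := hgle ⟨v, rfl⟩
        rw [LinearMap.mem_ker, hgsum] at this
        rw [sum_apply, zero_apply, ← this, ← Finset.sum_coe_sort]
        exact Finset.sum_congr rfl fun a _ => by rw [smul_apply, hrr, smul_eq_mul, mul_comm]; rfl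
      set r : (Fin k → ℤ) → ℝ := Function.update r₁ 0 (-∑ a ∈ σ.erase 0, r₁ a) with hr
      have hup : ∀ a ∈ σ.erase 0, r a = r₁ a := fun a ha =>
        Function.update_of_ne (Finset.ne_of_mem_erase ha) _ _
      have hr0 : ∀ a ∈ σ, r a = 0 := by
        refine hA.indep σ hσ r (sum_smul_latticePt_eq_zero ?_) ?_
        · rw [← Finset.add_sum_erase _ _ h0, pairing_zero, smul_zero, zero_add, ← hvan]
          exact Finset.sum_congr rfl fun a ha => by rw [hup a ha]
        · rw [← Finset.add_sum_erase _ _ h0, Finset.sum_congr rfl hup, hr, Function.update_self]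
          ring
      ext a
      have := hr0 a (Finset.mem_of_mem_erase a.2)
      rw [hup a a.2, hrr] at this
      simpa using this
    obtain ⟨K, hK, hpre⟩ := f.exists_preimage_norm_le hf
    filter_upwards [Filter.eventually_ge_atTop K] with K' hK' _ _ y b hb hy
    obtain ⟨v, hv, hvn⟩ := hpre fun a => y a
    refine ⟨v, hvn.trans ?_, fun a ha ha0 => ?_⟩
    · have : ‖fun a : σ.erase 0 => y a‖ ≤ b :=
        (pi_norm_le_iff_of_nonneg hb).2 fun a => hy a (Finset.mem_of_mem_erase a.2)
      have := hK.le.trans hK'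
      gcongr
    · exact congrFun hv ⟨a, Finset.mem_erase.2 ⟨ha0, ha⟩⟩
  obtain ⟨K, h, hK⟩ := (h.and (Filter.eventually_gt_atTop 0)).exists
  exact ⟨K, hK, fun σ hσ => h σ (Finset.mem_powerset.2 hσ.2.1) hσ⟩

lemma exists_pairing_bound (A : Finset (Fin k → ℤ)) :
    ∃ N > 0, ∀ a ∈ A, ‖pairing a‖ ≤ N := by
  have h : ∀ᶠ N in Filter.atTop, ∀ a ∈ A, ‖pairing a‖ ≤ N := by
    rw [Filter.eventually_all_finset]
    exact fun a _ => Filter.eventually_ge_atTop _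
  obtain ⟨N, h, hN⟩ := (h.and (Filter.eventually_gt_atTop 0)).exists
  exact ⟨N, hN, h⟩

lemma abs_height_sub_le {N : ℝ} {a : Fin k → ℤ} (hN : ‖pairing a‖ ≤ N) (u v : Fin k → ℝ) :
    |height ν a u - height ν a v| ≤ N * ‖u - v‖ := by
  rw [height_eq, height_eq, show pairing a u - ν a - (pairing a v - ν a) = pairing a (u - v) by
    rw [map_sub]; ring]
  exact (pairing a).le_of_opNorm_le hN _

/-! ### Distances to the chambers -/

lemma exists_metricNorm_bounds {G : Matrix (Fin k) (Fin k) ℝ} (hG : G.PosDef) :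
    ∃ g₁ > 0, ∃ g₂ > 0, ∀ v, g₁ * ‖v‖ ≤ metricNorm G v ∧ metricNorm G v ≤ g₂ * ‖v‖ := by
  set Q : (Fin k → ℝ) → ℝ := fun v => ∑ i, ∑ j, G i j * v i * v j with hQ
  have hQc : Continuous Q := by fun_prop
  have hQpos : ∀ v, v ≠ 0 → 0 < Q v := fun v hv => by
    have := hG.dotProduct_mulVec_pos hv
    simp only [dotProduct, Matrix.mulVec, Finset.mul_sum] at this
    refine this.trans_eq (Finset.sum_congr rfl fun i _ => Finset.sum_congr rfl fun j _ => ?_)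
    simp; ring
  have hQs : ∀ (s : ℝ) v, Q (s • v) = s ^ 2 * Q v := fun s v => by
    simp only [hQ, Pi.smul_apply, smul_eq_mul, Finset.mul_sum]
    exact Finset.sum_congr rfl fun i _ => Finset.sum_congr rfl fun j _ => by ring
  have hS := isCompact_sphere (0 : Fin k → ℝ) 1
  obtain ⟨m, hm, hmle⟩ := hS.exists_forall_le' hQc.continuousOn (a := 0) fun v hv =>
    hQpos v (by rintro rfl; simp at hv)
  obtain ⟨M, hM⟩ := hS.exists_bound_of_continuousOn (f := Q) hQc.continuousOn
  refine ⟨√m, Real.sqrt_pos.2 hm, √(max M 1), Real.sqrt_pos.2 (by positivity), fun v => ?_⟩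
  by_cases hv : v = 0
  · subst hv
    simp [metricNorm]
  have hv0 : 0 < ‖v‖ := norm_pos_iff.2 hv
  have hmem : ‖v‖⁻¹ • v ∈ Metric.sphere (0 : Fin k → ℝ) 1 := by simp [norm_smul, hv0.ne']
  have e : Q v = ‖v‖ ^ 2 * Q (‖v‖⁻¹ • v) := by rw [hQs]; field_simp
  have e' : metricNorm G v = √(Q v) := rfl
  rw [e', ← Real.sqrt_sq hv0.le, ← Real.sqrt_mul hm.le, ← Real.sqrt_mul (by positivity),
    e]
  constructor
  · refine Real.sqrt_le_sqrt ?_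
    have := hmle _ hmem
    nlinarith [sq_nonneg ‖v‖]
  · refine Real.sqrt_le_sqrt ?_
    have := (Real.le_norm_self _).trans ((hM _ hmem).trans (le_max_left M 1))
    nlinarith [sq_nonneg ‖v‖]

lemma metricDist_le {G : Matrix (Fin k) (Fin k) ℝ} {S : Set (Fin k → ℝ)} (p : Fin k → ℝ)
    {q : Fin k → ℝ} (hq : q ∈ S) : metricDist G p S ≤ metricNorm G (p - q) :=
  csInf_le ⟨0, by rintro _ ⟨x, -, rfl⟩; exact Real.sqrt_nonneg _⟩ ⟨q, hq, rfl⟩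

lemma mem_chamber {a : Fin k → ℤ} {u : Fin k → ℝ} :
    u ∈ chamber A ν a ↔ ∀ b ∈ A, height ν b u ≤ height ν a u := by
  simp [chamber, cell]

lemma chamber_nonempty (hA : IsCentralTriangulation A ν) {a : Fin k → ℤ} (ha : a ∈ A) :
    (chamber A ν a).Nonempty := by
  obtain ⟨-, -, u, c, h1, h2⟩ := hA.singleton a ha
  simp only [← pairing_apply] at h1 h2
  refine ⟨u, mem_chamber.2 fun b hb => ?_⟩
  rw [height_eq, height_eq]
  by_cases hba : b = a
  · rw [hba]
  · have := h1 a (Finset.mem_singleton_self a)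
    have := h2 b hb (by simpa using hba)
    linarith

/-- Near the chamber of `a` the affine function of `a` is nearly maximal. -/
lemma exists_height_lt_of_metricDist_le (hA : IsCentralTriangulation A ν)
    {G : Matrix (Fin k) (Fin k) ℝ} (hG : G.PosDef) :
    ∃ D > 0, ∀ ε > 0, ∀ a ∈ A, ∀ p, metricDist G p (chamber A ν a) ≤ ε →
      ∀ b ∈ A, height ν b p < height ν a p + D * ε := by
  obtain ⟨g₁, hg₁, _, -, hg⟩ := exists_metricNorm_bounds hG
  obtain ⟨N, hN, hNa⟩ := exists_pairing_bound A
  refine ⟨4 * N / g₁, by positivity, fun ε hε a ha p hp b hb => ?_⟩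
  obtain ⟨_, ⟨q, hq, rfl⟩, hlt⟩ := exists_lt_of_csInf_lt
    ((chamber_nonempty hA ha).image fun q => metricNorm G (p - q))
    (lt_of_le_of_lt hp (by linarith : ε < 2 * ε))
  have h1 : ‖p - q‖ < 2 * ε / g₁ := by
    rw [lt_div_iff₀ hg₁]; linarith [(hg (p - q)).1]
  have h2 := (abs_le.1 (abs_height_sub_le (ν := ν) (hNa b hb) p q)).2
  have h3 := (abs_le.1 (abs_height_sub_le (ν := ν) (hNa a ha) p q)).1
  have h4 := mem_chamber.1 hq b hb
  have h5 : 2 * N * ‖p - q‖ < 2 * N * (2 * ε / g₁) := by gcongr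
  have h6 : 2 * N * (2 * ε / g₁) = 4 * N / g₁ * ε := by ring
  linarith

end

/-! ### Boundedness of the differentials of the cut-off functions -/

section

variable {k : ℕ} {A : Finset (Fin k → ℤ)} {ν : (Fin k → ℤ) → ℝ}

lemma subset_vectorSpan_cell {τ : Finset (Fin k → ℤ)} (hτ : IsRegularFace A ν τ)
    {v : Fin k → ℝ} (hv : ∀ b ∈ τ, ∀ c ∈ τ, pairing b v = pairing c v) :
    v ∈ vectorSpan ℝ (cell A ν τ) := by
  obtain ⟨-, hτA, u, c, h1, h2⟩ := hτ
  simp only [← pairing_apply] at h1 h2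
  have hcont : ∀ b : Fin k → ℤ, Continuous fun s : ℝ => height ν b (u + s • v) := fun b => by
    simp only [height_eq]; fun_prop
  have hev : ∀ᶠ s : ℝ in 𝓝 0, ∀ a ∈ τ, ∀ b ∈ A, height ν b (u + s • v) ≤ height ν a (u + s • v) := by
    rw [Filter.eventually_all_finset]
    intro a ha
    rw [Filter.eventually_all_finset]
    intro b hb
    by_cases hbτ : b ∈ τ
    · refine Filter.Eventually.of_forall fun s => ?_
      simp only [height_eq, map_add, map_smul, smul_eq_mul]
      rw [hv b hbτ a ha]
      linarith [h1 a ha, h1 b hbτ]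
    · have h3 := h1 a ha
      have h4 := h2 b hb hbτ
      have := (hcont b).continuousAt.eventually_lt (x₀ := (0 : ℝ)) (hcont a).continuousAt (by
        simp only [zero_smul, add_zero, height_eq]; linarith)
      filter_upwards [this] with s hs using hs.le
  have h0 := hev.self_of_nhds
  obtain ⟨s, hs, hs0⟩ := (hev.filter_mono nhdsWithin_le_nhds |>.and
    (self_mem_nhdsWithin (a := (0 : ℝ)) (s := {0}ᶜ))).exists
  have hm : (u + s • v) -ᵥ u ∈ vectorSpan ℝ (cell A ν τ) := by
    refine vsub_mem_vectorSpan ℝ hs ?_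
    simp only [zero_smul, add_zero] at h0
    exact h0
  rw [vsub_eq_sub, add_sub_cancel_left] at hm
  exact (Submodule.smul_mem_iff _ hs0).1 hm

/-- Outside a compact set, the differential of each cut-off function vanishes on all directions
along which the affine functions of the nearby chambers grow equally. Where the function is
neither zero nor one this is the assumption on its level sets, and elsewhere it has an extremum. -/
lemma exists_compact_fderiv_eq_zero (hA : IsCentralTriangulation A ν)
    {G : Matrix (Fin k) (Fin k) ℝ} {ε₁ ε₂ : ℝ} {χ : (Fin k → ℤ) → (Fin k → ℝ) → ℝ}
    (hχ : IsCutoffFamily A ν G ε₁ ε₂ χ)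
    (hface : ∀ p, ∃ σ, IsRegularFace A ν σ ∧ nearby A ν G ε₂ p ⊆ (σ : Set (Fin k → ℤ))) :
    ∃ K : Set (Fin k → ℝ), IsCompact K ∧ ∀ p, p ∉ K → ∀ a ∈ A, ∀ v,
      (∀ b ∈ nearby A ν G ε₂ p, ∀ c ∈ nearby A ν G ε₂ p, pairing b v = pairing c v) →
      fderiv ℝ (χ a) p v = 0 := by
  classical
  have hpar : ∀ τ a, ∃ K : Set (Fin k → ℝ), IsCompact K ∧ (IsRegularFace A ν τ → a ∈ τ →
    ∀ p, p ∉ K → nearby A ν G ε₂ p = (τ : Set (Fin k → ℤ)) → χ a p ∈ Set.Ioo (0 : ℝ) 1 →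
      ∀ v ∈ vectorSpan ℝ (cell A ν τ), fderiv ℝ (χ a) p v = 0) := by
    intro τ a
    by_cases h : IsRegularFace A ν τ ∧ a ∈ τ
    · obtain ⟨K, hK, hK'⟩ := hχ.parallel τ h.1 a h.2
      exact ⟨K, hK, fun _ _ => hK'⟩
    · exact ⟨∅, isCompact_empty, fun h1 h2 => absurd ⟨h1, h2⟩ h⟩
  choose K hK hKp using hpar
  refine ⟨⋃ τ ∈ A.powerset, ⋃ a ∈ A, K τ a, ?_, fun p hp a ha v hv => ?_⟩
  · exact A.powerset.isCompact_biUnion fun τ _ => A.isCompact_biUnion fun a _ => hK τ a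
  have hext : χ a p = 0 ∨ χ a p = 1 → fderiv ℝ (χ a) p v = 0 := by
    rintro (h | h)
    · have : IsLocalMin (χ a) p := Filter.Eventually.of_forall fun q => by
        rw [h]; exact (hχ.mem_Icc a ha q).1
      rw [this.fderiv_eq_zero, zero_apply]
    · have : IsLocalMax (χ a) p := Filter.Eventually.of_forall fun q => by
        rw [h]; exact (hχ.mem_Icc a ha q).2
      rw [this.fderiv_eq_zero, zero_apply]
  by_cases han : a ∈ nearby A ν G ε₂ p
  swap
  · refine hext (Or.inl (hχ.eq_zero a ha p ?_))
    by_contra hcon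
    exact han ⟨ha, (not_le.1 hcon).le⟩
  by_cases hx : χ a p ∈ Set.Ioo (0 : ℝ) 1
  swap
  · refine hext ?_
    obtain ⟨h0, h1⟩ := hχ.mem_Icc a ha p
    by_contra! hcon
    exact hx ⟨lt_of_le_of_ne h0 (Ne.symm hcon.1), lt_of_le_of_ne h1 hcon.2⟩
  set τ : Finset (Fin k → ℤ) := A.filter fun b => b ∈ nearby A ν G ε₂ p with hτ
  have hτn : nearby A ν G ε₂ p = (τ : Set (Fin k → ℤ)) := by
    ext b
    simp only [hτ, Finset.coe_filter, Set.mem_ofPred_eq]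
    exact ⟨fun h => ⟨h.1, h⟩, fun h => h.2⟩
  obtain ⟨σ, hσ, hsub⟩ := hface p
  rw [hτn, Finset.coe_subset] at hsub
  have haτ : a ∈ τ := by rw [← Finset.mem_coe, ← hτn]; exact han
  have hτr : IsRegularFace A ν τ := hA.subset σ τ hσ hsub ⟨a, haτ⟩
  refine hKp τ a hτr haτ p (fun h => hp ?_) hτn hx v (subset_vectorSpan_cell hτr ?_)
  · exact Set.mem_biUnion (Finset.mem_powerset.2 (Finset.filter_subset _ _))
      (Set.mem_biUnion ha h)
  · rw [hτn] at hv
    exact hv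

/-- Along an ultrafilter a real function is bounded, tends to `∞`, or tends to `-∞`. -/
lemma ultrafilter_trichotomy {E : Type*} (U : Ultrafilter E) (l : E → ℝ) :
    (∃ M, ∀ᶠ p in U, |l p| ≤ M) ∨ Filter.Tendsto l U Filter.atTop ∨
      Filter.Tendsto (fun p => -l p) U Filter.atTop := by
  by_cases h : ∃ M, ∀ᶠ p in U, |l p| ≤ M
  · exact Or.inl h
  refine Or.inr ?_
  push Not at h
  by_cases hs : ∀ᶠ p in U, 0 ≤ l p
  · refine Or.inl (Filter.tendsto_atTop.2 fun M => ?_)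
    filter_upwards [hs, h M] with p h1 h2
    rw [abs_of_nonneg h1] at h2
    exact h2.le
  · rw [← Ultrafilter.eventually_not] at hs
    refine Or.inr (Filter.tendsto_atTop.2 fun M => ?_)
    filter_upwards [hs, h M] with p h1 h2
    rw [abs_of_neg (not_le.1 h1)] at h2
    exact h2.le

/-- Splitting off the part of a vector that a family of linear forms sees. -/
lemma exists_bounded_part {ι : Type*} [Fintype ι] (l : ι → (Fin k → ℝ) →L[ℝ] ℝ) :
    ∃ r : (Fin k → ℝ) → (Fin k → ℝ), (∀ i v, l i (v - r v) = 0) ∧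
      ∃ M, 0 ≤ M ∧ ∀ v (b : ℝ), 0 ≤ b → (∀ i, |l i v| ≤ b) → ‖r v‖ ≤ M * b := by
  let f : (Fin k → ℝ) →ₗ[ℝ] (ι → ℝ) := LinearMap.pi fun i => (l i).toLinearMap
  obtain ⟨g, hg⟩ := f.rangeRestrict.exists_rightInverse_of_surjective f.range_rangeRestrict
  have hgv : ∀ v, f (g (f.rangeRestrict v)) = f v := fun v => by
    have := LinearMap.congr_fun hg (f.rangeRestrict v)
    exact congrArg Subtype.val this
  refine ⟨fun v => g (f.rangeRestrict v), fun i v => ?_, ?_⟩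
  · have := congrFun (hgv v) i
    rw [map_sub, sub_eq_zero]
    exact this.symm
  · refine ⟨‖g.toContinuousLinearMap‖, ContinuousLinearMap.opNorm_nonneg _, fun v b hb h => ?_⟩
    refine (g.toContinuousLinearMap.le_opNorm _).trans ?_
    gcongr
    exact (pi_norm_le_iff_of_nonneg hb).2 fun i => h i

/-- The differentials of the cut-off functions are bounded. Otherwise they are unbounded along an
ultrafilter tending to infinity. Split each point into a bounded part and a part on which the
differences of affine functions that stay bounded vanish. By `exists_compact_fderiv_eq_zero` the
functions do not change when only the second part varies, so that their differentials only depend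
on the first part. -/
lemma exists_fderiv_cutoff_bound (hA : IsCentralTriangulation A ν)
    {G : Matrix (Fin k) (Fin k) ℝ} {ε₁ ε₂ E₀ : ℝ} {χ : (Fin k → ℤ) → (Fin k → ℝ) → ℝ}
    (hχ : IsCutoffFamily A ν G ε₁ ε₂ χ)
    (hface : ∀ p, ∃ σ, IsRegularFace A ν σ ∧ nearby A ν G ε₂ p ⊆ (σ : Set (Fin k → ℤ)))
    (hnear : ∀ p, ∀ a ∈ nearby A ν G ε₂ p, ∀ b ∈ A, height ν b p < height ν a p + E₀) :
    ∃ M, ∀ a ∈ A, ∀ p, ‖fderiv ℝ (χ a) p‖ ≤ M := by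
  classical
  suffices h : ∀ a ∈ A, ∃ M, ∀ p, ‖fderiv ℝ (χ a) p‖ ≤ M by
    have h' : ∀ᶠ M in Filter.atTop, ∀ a ∈ A, ∀ p, ‖fderiv ℝ (χ a) p‖ ≤ M := by
      rw [Filter.eventually_all_finset]
      intro a ha
      obtain ⟨M, hM⟩ := h a ha
      filter_upwards [Filter.eventually_ge_atTop M] with M' hM' p using (hM p).trans hM'
    exact h'.exists
  intro a ha
  by_contra! hunb
  have hcont : Continuous (fderiv ℝ (χ a)) := (hχ.smooth a ha).continuous_fderiv (by simp)
  set F : Filter (Fin k → ℝ) := Filter.comap (fun p => ‖fderiv ℝ (χ a) p‖) Filter.atTop with hF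
  have hFne : F.NeBot := by
    refine Filter.comap_neBot fun t ht => ?_
    obtain ⟨M, hM⟩ := Filter.mem_atTop_sets.1 ht
    obtain ⟨p, hp⟩ := hunb M
    exact ⟨p, hM _ hp.le⟩
  set U : Ultrafilter (Fin k → ℝ) := Ultrafilter.of F
  have hU : Filter.Tendsto (fun p => ‖fderiv ℝ (χ a) p‖) U Filter.atTop :=
    (Filter.tendsto_comap).mono_left (Ultrafilter.of_le F)
  obtain ⟨K, hK, hKz⟩ := exists_compact_fderiv_eq_zero hA hχ hface
  obtain ⟨R, hKR⟩ := hK.isBounded.subset_closedBall (0 : Fin k → ℝ)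
  -- some signed coordinate tends to infinity
  obtain ⟨l₀, hl₀, hl₀U⟩ : ∃ l₀ : (Fin k → ℝ) →L[ℝ] ℝ, ‖l₀‖ ≤ 1 ∧
      Filter.Tendsto l₀ U Filter.atTop := by
    have hproj : ∀ i, ‖ContinuousLinearMap.proj (R := ℝ) (φ := fun _ : Fin k => ℝ) i‖ ≤ 1 :=
      fun i => ContinuousLinearMap.opNorm_le_bound _ zero_le_one fun v => by
        rw [one_mul]; exact norm_le_pi_norm v i
    by_contra! hcon
    have hb : ∀ i : Fin k, ∃ M : ℝ, ∀ᶠ p : Fin k → ℝ in U, |p i| ≤ M := fun i => by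
      rcases ultrafilter_trichotomy U fun p : Fin k → ℝ => p i with h | h | h
      · exact h
      · exact absurd h (hcon (ContinuousLinearMap.proj i) (hproj i))
      · exact absurd h (hcon (-ContinuousLinearMap.proj i) (by rw [norm_neg]; exact hproj i))
    choose M hM using hb
    have hball : ∀ᶠ p in U, p ∈ Metric.closedBall (0 : Fin k → ℝ) (∑ i, |M i|) := by
      filter_upwards [Filter.eventually_all.2 hM] with p hp
      rw [mem_closedBall_zero_iff, pi_norm_le_iff_of_nonneg (by positivity)]
      intro i
      exact ((hp i).trans (le_abs_self _)).trans
        (Finset.single_le_sum (f := fun i => |M i|) (fun _ _ => abs_nonneg _) (Finset.mem_univ i))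
    obtain ⟨B, hB⟩ := (isCompact_closedBall (0 : Fin k → ℝ) (∑ i, |M i|)).exists_bound_of_continuousOn
      (f := fderiv ℝ (χ a)) hcont.continuousOn
    obtain ⟨p, hp1, hp2⟩ := (hball.and (hU.eventually_gt_atTop B)).exists
    exact absurd (hB p hp1) (not_le.2 hp2)
  -- the differences that stay bounded
  set S : Finset ((Fin k → ℤ) × (Fin k → ℤ)) := (A ×ˢ A).filter fun bc =>
    ∃ M, ∀ᶠ p in U, |(pairing bc.1 - pairing bc.2) p| ≤ M with hS
  -- `r p` is the bounded part of `p`; these differences vanish on `w p = p - r p`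
  obtain ⟨r, hr0, M₁, hM₁, hr⟩ := exists_bounded_part
    (fun bc : S => pairing bc.1.1 - pairing bc.1.2)
  obtain ⟨ϱ, hϱ0, hϱ⟩ : ∃ ϱ ≥ 0, ∀ᶠ p in U, ‖r p‖ ≤ ϱ := by
    have hb : ∀ bc : S, ∃ M, ∀ᶠ p in U, |(pairing bc.1.1 - pairing bc.1.2) p| ≤ M :=
      fun bc => (Finset.mem_filter.1 bc.2).2
    choose M hM using hb
    refine ⟨M₁ * ∑ bc, |M bc|, by positivity, ?_⟩
    filter_upwards [Filter.eventually_all.2 hM] with p hp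
    refine hr p _ (by positivity) fun bc => ?_
    exact ((hp bc).trans (le_abs_self _)).trans
      (Finset.single_le_sum (f := fun i => |M i|) (fun _ _ => abs_nonneg _) (Finset.mem_univ bc))
  -- a lower bound `thr l M` for `l` at `p` and `p₀` gives the bound `M` for `l` at all points
  -- `x + y` with `‖x‖ ≤ ϱ + 1` and `y` on the segment from `w p₀` to `w p`
  set thr : ((Fin k → ℝ) →L[ℝ] ℝ) → ℝ → ℝ := fun l M => M + ‖l‖ * (2 * ϱ + 1) with hthr
  have hS' : ∀ b ∈ A, ∀ c ∈ A, (b, c) ∉ S →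
      Filter.Tendsto (pairing b - pairing c) U Filter.atTop ∨
        Filter.Tendsto (pairing c - pairing b) U Filter.atTop := by
    intro b hb c hc hbc
    rcases ultrafilter_trichotomy U (pairing b - pairing c) with h | h | h
    · exact absurd (Finset.mem_filter.2 ⟨Finset.mem_product.2 ⟨hb, hc⟩, h⟩) hbc
    · exact Or.inl h
    · refine Or.inr (h.congr fun p => ?_)
      simp [sub_apply]
  have hbig : ∀ᶠ p in U, ∀ b ∈ A, ∀ c ∈ A,
      Filter.Tendsto (pairing b - pairing c) U Filter.atTop →
      thr (pairing b - pairing c) (E₀ + |ν b| + |ν c|) ≤ (pairing b - pairing c) p := by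
    rw [Filter.eventually_all_finset]
    intro b _
    rw [Filter.eventually_all_finset]
    intro c _
    by_cases h : Filter.Tendsto (pairing b - pairing c) U Filter.atTop
    · filter_upwards [h.eventually_ge_atTop
        (thr (pairing b - pairing c) (E₀ + |ν b| + |ν c|))] with p hp _ using hp
    · exact Filter.Eventually.of_forall fun _ h' => absurd h' h
  have hgood := (hϱ.and (hl₀U.eventually_ge_atTop (thr l₀ (R + 1)))).and hbig
  obtain ⟨p₀, ⟨hp₀r, hp₀l⟩, hp₀b⟩ := hgood.exists
  set w : (Fin k → ℝ) → (Fin k → ℝ) := fun p => p - r p with hw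
  have hseg : ∀ (l : (Fin k → ℝ) →L[ℝ] ℝ) (M : ℝ) (p x : Fin k → ℝ) (s : ℝ), ‖r p‖ ≤ ϱ →
      thr l M ≤ l p → thr l M ≤ l p₀ → ‖x‖ ≤ ϱ + 1 → 0 ≤ s → s ≤ 1 →
      M ≤ l (x + w p₀ + s • (w p - w p₀)) := by
    intro l M p x s hrp hlp hlp₀ hx hs hs1
    have hone : ∀ q, ‖r q‖ ≤ ϱ → thr l M ≤ l q → M ≤ l (x + w q) := by
      intro q hq hlq
      have h1 : l (x + w q) = l q + l (x - r q) := by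
        rw [← map_add]; congr 1; simp only [hw]; abel
      have h2 : |l (x - r q)| ≤ ‖l‖ * (2 * ϱ + 1) := by
        refine (l.le_opNorm _).trans ?_
        gcongr
        exact (norm_sub_le _ _).trans (by linarith)
      have h3 := (abs_le.1 h2).1
      simp only [hthr] at hlq
      linarith
    have h1 := hone p hrp hlp
    have h2 := hone p₀ hp₀r hlp₀
    have h3 : l (x + w p₀ + s • (w p - w p₀)) = (1 - s) * l (x + w p₀) + s * l (x + w p) := by
      simp only [map_add, map_smul, map_sub, smul_eq_mul]; ring
    rw [h3]
    nlinarith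
  -- the function is constant along this segment: the differences of exponents that are nearby at
  -- its points belong to `S`, so that `w p - w p₀` is parallel to the level sets
  have hconst : ∀ p x, ‖r p‖ ≤ ϱ → thr l₀ (R + 1) ≤ l₀ p → (∀ b ∈ A, ∀ c ∈ A,
      Filter.Tendsto (pairing b - pairing c) U Filter.atTop →
      thr (pairing b - pairing c) (E₀ + |ν b| + |ν c|) ≤ (pairing b - pairing c) p) →
      ‖x‖ ≤ ϱ + 1 → χ a (x + w p) = χ a (x + w p₀) := by
    intro p x hpr hpl hpb hx
    have hder : ∀ s : ℝ, HasDerivAt (fun s : ℝ => χ a (x + w p₀ + s • (w p - w p₀)))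
        (fderiv ℝ (χ a) (x + w p₀ + s • (w p - w p₀)) (w p - w p₀)) s := by
      intro s
      have h1 : HasDerivAt (fun s : ℝ => x + w p₀ + s • (w p - w p₀)) (w p - w p₀) s := by
        simpa using ((hasDerivAt_id s).smul_const (w p - w p₀)).const_add (x + w p₀)
      exact ((hχ.smooth a ha).differentiable (by simp) _).hasFDerivAt.comp_hasDerivAt s h1
    have hzero : ∀ s : ℝ, 0 ≤ s → s ≤ 1 →
        fderiv ℝ (χ a) (x + w p₀ + s • (w p - w p₀)) (w p - w p₀) = 0 := by
      intro s hs hs1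
      refine hKz _ (fun hmem => ?_) a ha _ fun b hb c hc => ?_
      · have h1 := hseg l₀ (R + 1) p x s hpr hpl hp₀l hx hs hs1
        have h2 := hKR hmem
        rw [mem_closedBall_zero_iff] at h2
        have h3 := (le_abs_self _).trans (l₀.le_of_opNorm_le hl₀ (x + w p₀ + s • (w p - w p₀)))
        linarith
      · by_cases hbc : (b, c) ∈ S
        · have h1 := hr0 ⟨(b, c), hbc⟩ p
          have h2 := hr0 ⟨(b, c), hbc⟩ p₀
          simp only [sub_apply] at h1 h2
          simp only [map_sub, hw] at h1 h2 ⊢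
          linarith
        · exfalso
          have h1 := hnear _ b hb c hc.1
          have h2 := hnear _ c hc b hb.1
          rcases hS' b hb.1 c hc.1 hbc with h | h
          · have h3 := hseg _ _ p x s hpr (hpb b hb.1 c hc.1 h) (hp₀b b hb.1 c hc.1 h) hx hs hs1
            rw [sub_apply] at h3
            rw [height_eq, height_eq] at h2
            linarith [le_abs_self (ν b), neg_abs_le (ν c)]
          · have h3 := hseg _ _ p x s hpr (hpb c hc.1 b hb.1 h) (hp₀b c hc.1 b hb.1 h) hx hs hs1
            rw [sub_apply] at h3
            rw [height_eq, height_eq] at h1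
            linarith [le_abs_self (ν c), neg_abs_le (ν b)]
    have := constant_of_has_deriv_right_zero
      (f := fun s : ℝ => χ a (x + w p₀ + s • (w p - w p₀))) (a := 0) (b := 1)
      (fun s _ => (hder s).continuousAt.continuousWithinAt)
      (fun s hs => by
        have := (hder s).hasDerivWithinAt (s := Set.Ici s)
        rwa [hzero s hs.1 hs.2.le] at this) 1 (by simp)
    simp only [one_smul, zero_smul, add_zero] at this
    rw [← this]
    congr 1
    abel
  -- so the differential at `p` is the one at the bounded point `r p + w p₀`
  have hfd : ∀ᶠ p in U, ‖fderiv ℝ (χ a) p‖ = ‖fderiv ℝ (χ a) (r p + w p₀)‖ ∧ ‖r p‖ ≤ ϱ := by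
    filter_upwards [hgood] with p hp
    obtain ⟨⟨hpr, hpl⟩, hpb⟩ := hp
    refine ⟨?_, hpr⟩
    have hev : (fun x => χ a (x + w p)) =ᶠ[𝓝 (r p)] fun x => χ a (x + w p₀) := by
      have : Metric.ball (0 : Fin k → ℝ) (ϱ + 1) ∈ 𝓝 (r p) :=
        Metric.isOpen_ball.mem_nhds (by rw [mem_ball_zero_iff]; linarith)
      filter_upwards [this] with x hx
      exact hconst p x hpr hpl hpb (mem_ball_zero_iff.1 hx).le
    have h1 := hev.fderiv_eq (𝕜 := ℝ)
    rw [fderiv_comp_add_right, fderiv_comp_add_right] at h1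
    rw [← h1]
    congr 2
    simp [hw]
  obtain ⟨B, hB⟩ := (isCompact_closedBall (w p₀) ϱ).exists_bound_of_continuousOn
    (f := fderiv ℝ (χ a)) hcont.continuousOn
  obtain ⟨p, ⟨h1, h2⟩, h3⟩ := (hfd.and (hU.eventually_gt_atTop B)).exists
  rw [h1] at h3
  refine absurd (hB _ ?_) (not_le.2 h3)
  rw [Metric.mem_closedBall, dist_eq_norm, add_sub_cancel_right]
  exact h2

end

/-! ### Nearly critical points are near the minimum points of the faces -/

lemma eventually_mul_le (B : ℝ) {b : ℝ} (hb : 0 < b) : ∀ᶠ e in 𝓝[>] (0 : ℝ), e * B ≤ b := by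
  have h : Filter.Tendsto (fun e : ℝ => e * B) (𝓝[>] 0) (𝓝 (0 * B)) :=
    ((continuous_id.mul continuous_const).tendsto 0).mono_left nhdsWithin_le_nhds
  rw [zero_mul] at h
  exact h.eventually_le_const hb

/-- `σ` is a simplex that has `0` as a vertex, and at least one more vertex. -/
def IsCentral {k : ℕ} (A : Finset (Fin k → ℤ)) (ν : (Fin k → ℤ) → ℝ)
    (σ : Finset (Fin k → ℤ)) : Prop :=
  IsRegularFace A ν σ ∧ 0 ∈ σ ∧ ∃ a ∈ σ, a ≠ 0

/-- The affine function of `a` is within `η` of the maximum at `u`. -/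
def NearMax {k : ℕ} (A : Finset (Fin k → ℤ)) (ν : (Fin k → ℤ) → ℝ) (η : ℝ) (u : Fin k → ℝ)
    (a : Fin k → ℤ) : Prop :=
  ∀ b ∈ A, height ν b u < height ν a u + η

/-- A choice of minimum points `X σ`, with multipliers `S σ`, for all central simplices. -/
structure FaceMinima {k : ℕ} (A : Finset (Fin k → ℤ)) (ν : (Fin k → ℤ) → ℝ)
    (φ : (Fin k → ℝ) → ℝ) (X : Finset (Fin k → ℤ) → Fin k → ℝ)
    (S : Finset (Fin k → ℤ) → (Fin k → ℤ) → ℝ) : Prop where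
  isFaceMin : ∀ σ, IsCentral A ν σ → IsFaceMin A ν φ σ (X σ) (S σ)

section

variable {k : ℕ} {A : Finset (Fin k → ℤ)} {ν : (Fin k → ℤ) → ℝ} {ψ φ : (Fin k → ℝ) → ℝ}
  {c C R : ℝ} {X : Finset (Fin k → ℤ) → Fin k → ℝ} {S : Finset (Fin k → ℤ) → (Fin k → ℤ) → ℝ}

lemma exists_faceMinima (hA : IsCentralTriangulation A ν) (hB : PotentialBounds ψ φ c C R)
    (hadapted : IsAdapted φ (chamber A ν 0)) : ∃ X S, FaceMinima A ν φ X S := by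
  have h : ∀ σ, ∃ x r, IsCentral A ν σ → IsFaceMin A ν φ σ x r := by
    intro σ
    by_cases hσ : IsCentral A ν σ
    · obtain ⟨x, r, h⟩ := exists_isFaceMin hA hB hadapted hσ.1 hσ.2.1 hσ.2.2
      exact ⟨x, r, fun _ => h⟩
    · exact ⟨0, 0, fun h => absurd h hσ⟩
  choose X S hXS using h
  exact ⟨X, S, ⟨hXS⟩⟩

set_option maxHeartbeats 1000000 in
/-- If `∇φ` is, up to a small error, a combination with coefficient sum zero of the nearly maximal
vertices at `u`, then `u` is close to the minimum point of `φ` on a face of the central chamber,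
and the coefficients are close to the Lagrange multipliers there. -/
lemma eventually_near_faceMin (hA : IsCentralTriangulation A ν) (hB : PotentialBounds ψ φ c C R)
    (hX : FaceMinima A ν φ X S) {ϱ : ℝ} (hϱ : 0 < ϱ) :
    ∀ᶠ e in 𝓝[>] (0 : ℝ), ∀ (u : Fin k → ℝ) (r : (Fin k → ℤ) → ℝ),
      (∃ a ∈ A, a ≠ 0 ∧ NearMax A ν e u a) →
      ‖fderiv ℝ φ u - ∑ a ∈ A, r a • pairing a‖ ≤ e * (1 + ‖u‖) →
      |∑ a ∈ A, r a| ≤ e * (1 + ‖u‖) →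
      (∀ a ∈ A, ¬ NearMax A ν e u a → |r a| ≤ e * (1 + ‖u‖)) →
      ∃ σ, IsCentral A ν σ ∧ ‖u - X σ‖ ≤ ϱ ∧ ∀ a ∈ σ, |r a - S σ a| ≤ ϱ := by
  classical
  obtain ⟨η₀, hη₀, hnear⟩ := hA.near_max
  obtain ⟨K, hK, hKb⟩ := exists_coeff_bound hA
  obtain ⟨N, hN, hNb⟩ := exists_pairing_bound A
  have hc := hB.c_pos
  have hC := hB.C_pos
  obtain ⟨V, hV, hVb⟩ : ∃ V ≥ 0, ∀ a ∈ A, |ν a| ≤ V :=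
    ⟨∑ a ∈ A, |ν a|, by positivity, fun a ha =>
      Finset.single_le_sum (f := fun a => |ν a|) (fun _ _ => abs_nonneg _) ha⟩
  obtain ⟨X₀, hX₀, hX₀b⟩ : ∃ X₀ ≥ 0, ∀ σ ⊆ A, ‖X σ‖ ≤ X₀ :=
    ⟨∑ σ ∈ A.powerset, ‖X σ‖, by positivity, fun σ hσ =>
      Finset.single_le_sum (f := fun σ => ‖X σ‖) (fun _ _ => norm_nonneg _)
        (Finset.mem_powerset.2 hσ)⟩
  obtain ⟨S₀, hS₀, hS₀b⟩ : ∃ S₀ ≥ 0, ∀ σ ⊆ A, ∀ a ∈ A, |S σ a| ≤ S₀ := by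
    refine ⟨∑ σ ∈ A.powerset, ∑ a ∈ A, |S σ a|, by positivity, fun σ hσ a ha => ?_⟩
    exact (Finset.single_le_sum (f := fun a => |S σ a|) (fun _ _ => abs_nonneg _) ha).trans
      (Finset.single_le_sum (f := fun σ => ∑ a ∈ A, |S σ a|)
        (fun _ _ => Finset.sum_nonneg fun _ _ => abs_nonneg _) (Finset.mem_powerset.2 hσ))
  set n : ℝ := (A.card : ℝ) with hn
  have hn0 : 0 ≤ n := Nat.cast_nonneg _
  set R₁ : ℝ := 1 + K * ((C + 1 + n * N) + (1 + n)) with hR₁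
  set B₁ : ℝ := R₁ + N * (1 + X₀) + N + V with hB₁
  set B₃ : ℝ := (N + V) + n * B₁ + (1 + X₀) + n * S₀ with hB₃
  set ϱ' : ℝ := min (min ϱ 1) (ϱ / (2 * K * C)) with hϱ'
  have hϱ'0 : 0 < ϱ' := by simp only [hϱ', lt_min_iff]; exact ⟨⟨hϱ, one_pos⟩, by positivity⟩
  have hνe : ∀ᶠ e in 𝓝[>] (0 : ℝ), ∀ a ∈ A, a ≠ 0 → e < ν a := by
    rw [Filter.eventually_all_finset]
    intro a ha
    by_cases ha0 : a = 0
    · exact Filter.Eventually.of_forall fun _ h => absurd ha0 h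
    · filter_upwards [Ioo_mem_nhdsGT (hA.nu_pos a ha ha0)] with e he _ using he.2
  filter_upwards [self_mem_nhdsWithin, eventually_mul_le 1 one_pos, eventually_mul_le 1 hη₀, hνe,
    eventually_mul_le (2 * B₃) (half_pos hc),
    eventually_mul_le (4 * B₃ * (1 + X₀) ^ 2 / c) (pow_pos hϱ'0 2),
    eventually_mul_le (K * ((1 + n * N + 1 + n) * (2 + X₀))) (half_pos hϱ)] with e he0 he1 heη heν
    heB heϱ heK
  intro u r ⟨a₀, ha₀, ha₀0, ha₀m⟩ herr hsum hfar
  have he0 : 0 < e := he0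
  rw [mul_one] at he1 heη
  set U : ℝ := 1 + ‖u‖ with hU
  have hU1 : 1 ≤ U := by simp [hU]
  have huU : ‖u‖ ≤ U := by simp [hU]
  have hu0 : u ≠ 0 := by
    rintro rfl
    have h1 := ha₀m 0 hA.zero_mem
    rw [height_zero hA, height_eq, map_zero] at h1
    linarith [heν a₀ ha₀ ha₀0]
  -- the simplex spanned by `0` and the nearly maximal vertices
  set σ : Finset (Fin k → ℤ) := insert 0 (A.filter (NearMax A ν e u)) with hσdef
  have hσmem : ∀ a ∈ σ, a ≠ 0 → NearMax A ν e u a := fun a ha ha0 => by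
    rcases Finset.mem_insert.1 ha with h | h
    · exact absurd h ha0
    · exact (Finset.mem_filter.1 h).2
  have hσA : σ ⊆ A := Finset.insert_subset hA.zero_mem (Finset.filter_subset _ _)
  have hσout : ∀ a ∈ A, a ∉ σ → |r a| ≤ e * U := fun a ha haσ => hfar a ha fun h =>
    haσ (Finset.mem_insert_of_mem (Finset.mem_filter.2 ⟨ha, h⟩))
  have hσ : IsCentral A ν σ := by
    refine ⟨?_, Finset.mem_insert_self _ _, a₀,
      Finset.mem_insert_of_mem (Finset.mem_filter.2 ⟨ha₀, ha₀m⟩), ha₀0⟩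
    obtain ⟨σ', hσ', h0, hsub⟩ := hnear u
    refine hA.subset σ' σ hσ' (Finset.insert_subset h0 fun a ha => ?_) ⟨0, Finset.mem_insert_self _ _⟩
    obtain ⟨haA, ham⟩ := Finset.mem_filter.1 ha
    exact hsub a haA fun b hb => (ham b hb).trans_le (by linarith)
  have hmin := hX.isFaceMin σ hσ
  have hXσ := hX₀b σ hσA
  have hcard : ((A \ σ).card : ℝ) ≤ n := by
    rw [hn]; exact_mod_cast Finset.card_le_card (Finset.sdiff_subset (s := A) (t := σ))
  have hsplit : ∀ f : (Fin k → ℤ) → (Fin k → ℝ) →L[ℝ] ℝ,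
      ∑ a ∈ σ, f a = ∑ a ∈ A, f a - ∑ a ∈ A \ σ, f a := fun f => by
    rw [← Finset.sum_sdiff hσA]; abel
  have hsplit' : ∑ a ∈ σ, r a = ∑ a ∈ A, r a - ∑ a ∈ A \ σ, r a := by
    rw [← Finset.sum_sdiff hσA]; abel
  have heU : 0 ≤ e * U := by positivity
  have hrest : ‖∑ a ∈ A \ σ, r a • pairing a‖ ≤ n * N * (e * U) := by
    calc _ ≤ ∑ a ∈ A \ σ, ‖r a • pairing a‖ := norm_sum_le _ _
      _ ≤ ∑ a ∈ A \ σ, (e * U) * N := by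
        refine Finset.sum_le_sum fun a ha => ?_
        obtain ⟨haA, haσ⟩ := Finset.mem_sdiff.1 ha
        rw [norm_smul, Real.norm_eq_abs]
        exact mul_le_mul (hσout a haA haσ) (hNb a haA) (norm_nonneg _) heU
      _ = ((A \ σ).card : ℝ) * (e * U * N) := by rw [Finset.sum_const, nsmul_eq_mul]
      _ ≤ n * (e * U * N) := by gcongr
      _ = _ := by ring
  have hrest' : |∑ a ∈ A \ σ, r a| ≤ n * (e * U) := by
    calc _ ≤ ∑ a ∈ A \ σ, |r a| := Finset.abs_sum_le_sum_abs _ _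
      _ ≤ ∑ a ∈ A \ σ, (e * U) := Finset.sum_le_sum fun a ha =>
        hσout a (Finset.mem_sdiff.1 ha).1 (Finset.mem_sdiff.1 ha).2
      _ = ((A \ σ).card : ℝ) * (e * U) := by rw [Finset.sum_const, nsmul_eq_mul]
      _ ≤ _ := by gcongr
  have heU' : e * U ≤ U := mul_le_of_le_one_left (by linarith) he1
  have hsum' : |∑ a ∈ σ, r a| ≤ (1 + n) * (e * U) := by
    rw [hsplit']
    exact (abs_sub _ _).trans (by linarith)
  have hPu : ‖fderiv ℝ φ u‖ ≤ C * U := (hB.norm_fderiv_model_le hu0).trans (by gcongr)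
  -- all coefficients are at most of the order of `u`
  have hr : ∀ a ∈ A, |r a| ≤ R₁ * U := by
    intro a ha
    by_cases haσ : a ∈ σ
    · have h1 : ‖∑ a ∈ σ, r a • pairing a‖ ≤ (C + 1 + n * N) * U := by
        have e1 : ∑ a ∈ σ, r a • pairing a = fderiv ℝ φ u -
            (fderiv ℝ φ u - ∑ a ∈ A, r a • pairing a) - ∑ a ∈ A \ σ, r a • pairing a := by
          rw [hsplit]; abel
        rw [e1]
        refine (norm_sub_le _ _).trans ?_
        have h2 := norm_sub_le (fderiv ℝ φ u) (fderiv ℝ φ u - ∑ a ∈ A, r a • pairing a)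
        have h3 : n * N * (e * U) ≤ n * N * U := by gcongr
        linarith
      have h2 : |∑ a ∈ σ, r a| ≤ (1 + n) * U := hsum'.trans (by gcongr)
      calc |r a| ≤ K * (‖∑ a ∈ σ, r a • pairing a‖ + |∑ a ∈ σ, r a|) := hKb σ hσ.1 r a haσ
        _ ≤ K * ((C + 1 + n * N) * U + (1 + n) * U) := by gcongr
        _ ≤ R₁ * U := by rw [hR₁]; linarith
    · refine (hσout a ha haσ).trans (heU'.trans ?_)
      have : 0 ≤ K * ((C + 1 + n * N) + (1 + n)) := by positivity
      have := mul_nonneg this (by linarith : 0 ≤ U)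
      rw [hR₁]; linarith
  have hR₁0 : 0 ≤ R₁ := by rw [hR₁]; positivity
  have hB₁0 : 0 ≤ B₁ := by rw [hB₁]; positivity
  have hB₃0 : 0 ≤ B₃ := by rw [hB₃]; positivity
  have hux : ‖u - X σ‖ ≤ (1 + X₀) * U := by
    refine (norm_sub_le _ _).trans ?_
    have := le_mul_of_one_le_right hX₀ hU1
    linarith
  -- the maximum of the affine functions at `u`
  obtain ⟨b₀, hb₀, hmax⟩ := A.exists_max_image (fun a => height ν a u) ⟨0, hA.zero_mem⟩
  set H : ℝ := height ν b₀ u with hH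
  have hH0 : 0 ≤ H := by
    have := hmax 0 hA.zero_mem
    rwa [height_zero hA] at this
  have hHU : |H| ≤ (N + V) * U := by
    rw [hH, height_eq]
    have h1 := (pairing b₀).le_of_opNorm_le (hNb b₀ hb₀) u
    rw [Real.norm_eq_abs] at h1
    have h2 := abs_sub (pairing b₀ u) (ν b₀)
    have h3 := hVb b₀ hb₀
    have h4 := mul_le_mul_of_nonneg_left huU hN.le
    have h5 := le_mul_of_one_le_right hV hU1
    linarith
  have hpair : ∀ a ∈ σ, pairing a (u - X σ) = height ν a u := fun a ha => by
    have := hmin.height_eq a ha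
    rw [height_eq] at this ⊢
    rw [map_sub]; linarith
  -- either `a` is nearly maximal, or its coefficient is small
  have hterm : ∀ a ∈ A, |r a * (pairing a (u - X σ) - H)| ≤ B₁ * (e * U ^ 2) := by
    intro a ha
    rw [abs_mul]
    by_cases hnm : NearMax A ν e u a
    · have haσ : a ∈ σ := Finset.mem_insert_of_mem (Finset.mem_filter.2 ⟨ha, hnm⟩)
      have h1 : |pairing a (u - X σ) - H| ≤ e := by
        rw [hpair a haσ, abs_le]
        constructor <;> linarith [hnm b₀ hb₀, hmax a ha]
      calc |r a| * |pairing a (u - X σ) - H| ≤ (R₁ * U) * e :=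
            mul_le_mul (hr a ha) h1 (abs_nonneg _) (by positivity)
        _ = R₁ * (e * U) := by ring
        _ ≤ R₁ * (e * U ^ 2) := by gcongr; exact le_self_pow₀ hU1 two_ne_zero
        _ ≤ B₁ * (e * U ^ 2) := by
          gcongr
          rw [hB₁]
          have : 0 ≤ N * (1 + X₀) := by positivity
          linarith
    · have h1 : |pairing a (u - X σ) - H| ≤ (N * (1 + X₀) + N + V) * U := by
        have h2 := (pairing a).le_of_opNorm_le (hNb a ha) (u - X σ)
        rw [Real.norm_eq_abs] at h2
        have h3 := abs_sub (pairing a (u - X σ)) H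
        have h4 : N * ‖u - X σ‖ ≤ N * ((1 + X₀) * U) := by gcongr
        linarith
      calc |r a| * |pairing a (u - X σ) - H| ≤ (e * U) * ((N * (1 + X₀) + N + V) * U) :=
            mul_le_mul (hfar a ha hnm) h1 (abs_nonneg _) heU
        _ = (N * (1 + X₀) + N + V) * (e * U ^ 2) := by ring
        _ ≤ B₁ * (e * U ^ 2) := by
          gcongr
          rw [hB₁]; linarith
  -- `r a` may be paired with the common value `H` of the nearly maximal heights; as the
  -- coefficients have sum nearly zero, nothing remains
  have hupper : fderiv ℝ φ u (u - X σ) ≤ ((N + V) + n * B₁ + (1 + X₀)) * (e * U ^ 2) := by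
    have e1 : fderiv ℝ φ u (u - X σ) =
        (fderiv ℝ φ u - ∑ a ∈ A, r a • pairing a) (u - X σ) + H * ∑ a ∈ A, r a +
        ∑ a ∈ A, r a * (pairing a (u - X σ) - H) := by
      have e2 : ∑ a ∈ A, r a * (pairing a (u - X σ) - H) =
          ∑ a ∈ A, r a * pairing a (u - X σ) - (∑ a ∈ A, r a) * H := by
        rw [Finset.sum_mul, ← Finset.sum_sub_distrib]
        exact Finset.sum_congr rfl fun a _ => mul_sub _ _ _
      rw [e2, sub_apply, sum_apply]
      simp only [smul_apply, smul_eq_mul]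
      ring
    have h1 := (le_abs_self _).trans
      ((fderiv ℝ φ u - ∑ a ∈ A, r a • pairing a).le_of_opNorm_le herr (u - X σ))
    have h2 : e * U * ‖u - X σ‖ ≤ e * U * ((1 + X₀) * U) := by gcongr
    have h3 : H * ∑ a ∈ A, r a ≤ ((N + V) * U) * (e * U) := by
      refine (le_abs_self _).trans ?_
      rw [abs_mul]
      exact mul_le_mul hHU hsum (abs_nonneg _) (by positivity)
    have h4 : ∑ a ∈ A, r a * (pairing a (u - X σ) - H) ≤ n * (B₁ * (e * U ^ 2)) := by
      rw [hn, ← nsmul_eq_mul]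
      exact Finset.sum_le_card_nsmul _ _ _ fun a ha => (le_abs_self _).trans (hterm a ha)
    rw [e1]
    linarith
  -- nonzero vertices have positive multipliers at `X σ` and nearly nonnegative heights at `u`
  have hlower : -(n * S₀ * (e * U ^ 2)) ≤ fderiv ℝ φ (X σ) (u - X σ) := by
    rw [hmin.fderiv_eq, sum_apply]
    have h1 : ∀ a ∈ σ, -(S₀ * (e * U ^ 2)) ≤ (S σ a • pairing a) (u - X σ) := by
      intro a ha
      have hU2 : e ≤ e * U ^ 2 := le_mul_of_one_le_right he0.le (one_le_pow₀ hU1)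
      rw [smul_apply, smul_eq_mul, hpair a ha]
      by_cases ha0 : a = 0
      · subst ha0
        rw [height_zero hA, mul_zero]
        have : 0 ≤ S₀ * (e * U ^ 2) := by positivity
        linarith
      · have h2 := hσmem a ha ha0 0 hA.zero_mem
        rw [height_zero hA] at h2
        have h3 := hmin.pos a ha ha0
        have h4 := (le_abs_self _).trans (hS₀b σ hσA a (hσA ha))
        have h5 : S σ a * (-(e * U ^ 2)) ≤ S σ a * height ν a u := by
          gcongr; linarith
        have h6 : S σ a * (e * U ^ 2) ≤ S₀ * (e * U ^ 2) := by gcongr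
        linarith
    have h2 := Finset.card_nsmul_le_sum _ _ _ h1
    have h3 : (σ.card : ℝ) ≤ n := by rw [hn]; exact_mod_cast Finset.card_le_card hσA
    have h4 : (σ.card : ℝ) * (S₀ * (e * U ^ 2)) ≤ n * (S₀ * (e * U ^ 2)) := by gcongr
    rw [nsmul_eq_mul] at h2
    linarith
  -- the difference of these bounds is bounded below by strong monotonicity
  have hmono := hB.mono_model hu0 hmin.ne_zero
  rw [sub_apply] at hmono
  have hmain : c * ‖u - X σ‖ ^ 2 ≤ B₃ * (e * U ^ 2) := by
    rw [hB₃]; linarith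
  have hdist : ‖u - X σ‖ ≤ ϱ' := by
    have hUle : U ≤ (1 + X₀) + ‖u - X σ‖ := by
      have : ‖u‖ ≤ ‖u - X σ‖ + ‖X σ‖ := norm_le_norm_sub_add _ _
      linarith
    have hU2 : U ^ 2 ≤ 2 * (1 + X₀) ^ 2 + 2 * ‖u - X σ‖ ^ 2 := by
      have : U ^ 2 ≤ ((1 + X₀) + ‖u - X σ‖) ^ 2 := by gcongr
      linarith [add_sq_le (a := 1 + X₀) (b := ‖u - X σ‖)]
    have h1 : B₃ * (e * U ^ 2) ≤ B₃ * (e * (2 * (1 + X₀) ^ 2 + 2 * ‖u - X σ‖ ^ 2)) := by gcongr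
    have h2 : e * (2 * B₃) * ‖u - X σ‖ ^ 2 ≤ c / 2 * ‖u - X σ‖ ^ 2 := by gcongr
    have h3 : c / 2 * ‖u - X σ‖ ^ 2 ≤ e * (2 * B₃) * (1 + X₀) ^ 2 := by linarith
    have h4 : ‖u - X σ‖ ^ 2 ≤ e * (4 * B₃ * (1 + X₀) ^ 2 / c) := by
      rw [← mul_div_assoc, le_div_iff₀ hc]; linarith
    exact le_of_sq_le_sq (h4.trans heϱ) hϱ'0.le
  have hϱ1 : ϱ' ≤ ϱ := (min_le_left _ _).trans (min_le_left _ _)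
  have hϱ2 : ϱ' ≤ 1 := (min_le_left _ _).trans (min_le_right _ _)
  have hϱ3 : K * (C * ϱ') ≤ ϱ / 2 := by
    have : ϱ' ≤ ϱ / (2 * K * C) := min_le_right _ _
    rw [le_div_iff₀ (by positivity)] at this
    linarith
  -- the coefficients are determined by the differential, up to a bounded factor
  refine ⟨σ, hσ, hdist.trans hϱ1, fun a ha => ?_⟩
  have hU2 : U ≤ 2 + X₀ := by
    have : ‖u‖ ≤ ‖u - X σ‖ + ‖X σ‖ := norm_le_norm_sub_add _ _
    linarith
  have h1 : ‖∑ a ∈ σ, (r a - S σ a) • pairing a‖ ≤ C * ϱ' + (1 + n * N) * (e * U) := by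
    have e1 : ∑ a ∈ σ, (r a - S σ a) • pairing a = (fderiv ℝ φ u - fderiv ℝ φ (X σ)) -
        (fderiv ℝ φ u - ∑ a ∈ A, r a • pairing a) - ∑ a ∈ A \ σ, r a • pairing a := by
      have e2 : ∑ a ∈ σ, (r a - S σ a) • pairing a =
          ∑ a ∈ σ, r a • pairing a - ∑ a ∈ σ, S σ a • pairing a := by
        rw [← Finset.sum_sub_distrib]
        exact Finset.sum_congr rfl fun a _ => sub_smul (r a) (S σ a) (pairing a)
      rw [e2, hsplit fun a => r a • pairing a, hmin.fderiv_eq]; abel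
    rw [e1]
    have h2 := norm_sub_le ((fderiv ℝ φ u - fderiv ℝ φ (X σ)) -
      (fderiv ℝ φ u - ∑ a ∈ A, r a • pairing a)) (∑ a ∈ A \ σ, r a • pairing a)
    have h3 := norm_sub_le (fderiv ℝ φ u - fderiv ℝ φ (X σ))
      (fderiv ℝ φ u - ∑ a ∈ A, r a • pairing a)
    have h4 : ‖fderiv ℝ φ u - fderiv ℝ φ (X σ)‖ ≤ C * ϱ' :=
      (hB.lipschitz_model hu0 hmin.ne_zero).trans (by gcongr)
    linarith
  have h2 : |∑ a ∈ σ, (r a - S σ a)| ≤ (1 + n) * (e * U) := by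
    rw [Finset.sum_sub_distrib, hmin.sum_eq, sub_zero]; exact hsum'
  calc |r a - S σ a| ≤ K * (‖∑ a ∈ σ, (r a - S σ a) • pairing a‖ + |∑ a ∈ σ, (r a - S σ a)|) :=
        hKb σ hσ.1 (fun a => r a - S σ a) a ha
    _ ≤ K * ((C * ϱ' + (1 + n * N) * (e * U)) + (1 + n) * (e * U)) := by gcongr
    _ = K * (C * ϱ') + e * (K * ((1 + n * N + 1 + n) * U)) := by ring
    _ ≤ K * (C * ϱ') + e * (K * ((1 + n * N + 1 + n) * (2 + X₀))) := by gcongr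
    _ ≤ ϱ := by linarith

/-! ### Cut-off functions near the minimum points of the faces -/

lemma exists_height_le_neg (hX : FaceMinima A ν φ X S) :
    ∃ m > 0, ∀ σ, IsCentral A ν σ → ∀ b ∈ A, b ∉ σ → height ν b (X σ) ≤ -m := by
  classical
  have h : ∀ᶠ m in 𝓝[>] (0 : ℝ), ∀ σ ∈ A.powerset, ∀ b ∈ A, IsCentral A ν σ → b ∉ σ →
      height ν b (X σ) ≤ -m := by
    rw [Filter.eventually_all_finset]
    intro σ _
    rw [Filter.eventually_all_finset]
    intro b hb
    by_cases hσ : IsCentral A ν σ ∧ b ∉ σ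
    · have := (hX.isFaceMin σ hσ.1).height_lt b hb hσ.2
      filter_upwards [Ioo_mem_nhdsGT (neg_pos.2 this)] with m hm _ _
      linarith [hm.2]
    · exact Filter.Eventually.of_forall fun _ h1 h2 => absurd ⟨h1, h2⟩ hσ
  obtain ⟨m, h, hm⟩ := (h.and self_mem_nhdsWithin).exists
  exact ⟨m, hm, fun σ hσ b hb hbσ => h σ (Finset.mem_powerset.2 hσ.1.2.1) b hb hσ hbσ⟩

/-- Close to the minimum point of a central face, and where the functions of that face are nearly
maximal, all cut-off functions are locally constant. -/
lemma exists_cutoff_locally_const (hA : IsCentralTriangulation A ν) (hX : FaceMinima A ν φ X S)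
    {G : Matrix (Fin k) (Fin k) ℝ} (hG : G.PosDef) :
    ∃ ϱ > 0, ∃ ε₀ > 0, ∀ ε₁ ε₂, 0 < ε₁ → 0 < ε₂ → ε₂ < ε₀ →
      ∀ χ, IsCutoffFamily A ν G ε₁ ε₂ χ → ∃ ι > 0, ∀ σ, IsCentral A ν σ → ∀ u,
        ‖u - X σ‖ < ϱ → (∀ a ∈ σ, NearMax A ν ι u a) →
        ∀ᶠ u' in 𝓝 u, (∀ a ∈ σ, χ a u' = 1) ∧ ∀ b ∈ A, b ∉ σ → χ b u' = 0 := by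
  obtain ⟨m, hm, hmX⟩ := exists_height_le_neg hX
  obtain ⟨N, hN, hNb⟩ := exists_pairing_bound A
  obtain ⟨K, hK, hKs⟩ := exists_solution_bound hA
  obtain ⟨_, -, g₂, hg₂, hg⟩ := exists_metricNorm_bounds hG
  obtain ⟨D, hD, hDh⟩ := exists_height_lt_of_metricDist_le hA hG
  have hclose : ∀ σ, IsCentral A ν σ → ∀ u, ‖u - X σ‖ ≤ m / (2 * N) → ∀ b ∈ A, b ∉ σ →
      height ν b u ≤ -(m / 2) := by
    intro σ hσ u hu b hb hbσ
    have h1 := hmX σ hσ b hb hbσ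
    have h2 := (abs_le.1 (abs_height_sub_le (ν := ν) (hNb b hb) u (X σ))).2
    have h3 : N * ‖u - X σ‖ ≤ N * (m / (2 * N)) := by gcongr
    have h4 : N * (m / (2 * N)) = m / 2 := by field_simp
    linarith
  refine ⟨m / (4 * N), by positivity, m / (2 * D), by positivity, ?_⟩
  intro ε₁ ε₂ hε₁ hε₂ hε₂0 χ hχ
  obtain ⟨ι, hι, hι1, hι2⟩ : ∃ ι > 0, K * ι ≤ m / (4 * N) ∧ g₂ * (K * ι) ≤ ε₁ := by
    obtain ⟨ι, ⟨h1, h2⟩, h3⟩ := (((eventually_mul_le K (by positivity : 0 < m / (4 * N))).and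
      (eventually_mul_le (g₂ * K) hε₁)).and self_mem_nhdsWithin).exists
    exact ⟨ι, h3, by linarith, by linarith⟩
  refine ⟨ι, hι, fun σ hσ u hu hnm => ?_⟩
  have hev : ∀ᶠ u' in 𝓝 u, ‖u' - X σ‖ < m / (4 * N) ∧ ∀ a ∈ σ, NearMax A ν ι u' a := by
    refine Filter.Eventually.and ?_ ?_
    · exact ((continuous_id.sub continuous_const).norm.continuousAt).eventually_lt
        continuousAt_const hu
    · rw [Filter.eventually_all_finset]
      intro a ha
      simp only [NearMax]
      rw [Filter.eventually_all_finset]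
      intro b hb
      have hc : ∀ b : Fin k → ℤ, Continuous fun u => height ν b u := fun b => by
        simp only [height_eq]; fun_prop
      exact (hc b).continuousAt.eventually_lt ((hc a).add continuous_const).continuousAt
        (hnm a ha b hb)
  filter_upwards [hev] with u' hu'
  obtain ⟨hd, hn⟩ := hu'
  constructor
  · -- a point of the cell of `σ` close to `u'`
    have hy : ∀ a ∈ σ, |-(height ν a u')| ≤ ι := by
      intro a ha
      have h1 := hn a ha 0 hA.zero_mem
      have h2 := hn 0 hσ.2.1 a (hσ.1.2.1 ha)
      rw [height_zero hA] at h1 h2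
      rw [abs_le]; constructor <;> linarith
    obtain ⟨v, hv, hva⟩ := hKs σ hσ.1 hσ.2.1 (fun a => -(height ν a u')) ι hι.le hy
    have h0 : ∀ a ∈ σ, height ν a (u' + v) = 0 := by
      intro a ha
      by_cases ha0 : a = 0
      · rw [ha0, height_zero hA]
      · have := hva a ha ha0
        rw [height_eq] at this ⊢
        rw [map_add, this]; ring
    have hvm : ‖v‖ ≤ m / (4 * N) := hv.trans hι1
    have hout : ∀ b ∈ A, b ∉ σ → height ν b (u' + v) ≤ 0 := by
      intro b hb hbσ
      refine (hclose σ hσ (u' + v) ?_ b hb hbσ).trans (by linarith)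
      have : ‖u' + v - X σ‖ ≤ ‖u' - X σ‖ + ‖v‖ := by
        rw [add_sub_right_comm]; exact norm_add_le _ _
      have e : m / (2 * N) = m / (4 * N) + m / (4 * N) := by field_simp; ring
      linarith
    intro a ha
    refine hχ.eq_one a (hσ.1.2.1 ha) u' ?_
    have hmem : u' + v ∈ chamber A ν a := mem_chamber.2 fun b hb => by
      rw [h0 a ha]
      by_cases hbσ : b ∈ σ
      · exact (h0 b hbσ).le
      · exact hout b hb hbσ
    calc metricDist G u' (chamber A ν a) ≤ metricNorm G (u' - (u' + v)) := metricDist_le u' hmem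
      _ ≤ g₂ * ‖u' - (u' + v)‖ := (hg _).2
      _ ≤ g₂ * (K * ι) := by
        gcongr
        rw [sub_add_cancel_left, norm_neg]; exact hv
      _ ≤ ε₁ := hι2
  · intro b hb hbσ
    refine hχ.eq_zero b hb u' ?_
    by_contra hcon
    push Not at hcon
    have h1 := hDh ε₂ hε₂ b hb u' hcon.le 0 hA.zero_mem
    have h2 : m / (4 * N) ≤ m / (2 * N) := by gcongr; norm_num
    have h3 := hclose σ hσ u' (hd.le.trans h2) b hb hbσ
    rw [height_zero hA] at h1
    have h4 : D * ε₂ < D * (m / (2 * D)) := by gcongr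
    have h5 : D * (m / (2 * D)) = m / 2 := by field_simp
    linarith

end

/-! ### Zeros of exponential sums whose terms cancel -/

/-- The vector `∑ m_a a` in `ℂ^k`. -/
def momentVec {k : ℕ} (A : Finset (Fin k → ℤ)) (m : (Fin k → ℤ) → ℂ) : Fin k → ℂ :=
  fun i => ∑ a ∈ A, m a * (a i : ℂ)

/-- The coordinate vector of a linear form on `ℝ^k`, as a complex vector. -/
def covec {k : ℕ} (p : (Fin k → ℝ) →L[ℝ] ℝ) : Fin k → ℂ := fun i => (p (Pi.single i 1) : ℂ)

/-- The complex numbers `m_a` cancel, are at most of the size `exp (L h_a(u))`, and have this size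
where `h_a(u)` is maximal. -/
structure Balanced {k : ℕ} (A : Finset (Fin k → ℤ)) (ν : (Fin k → ℤ) → ℝ) (L : ℝ)
    (u : Fin k → ℝ) (m : (Fin k → ℤ) → ℂ) : Prop where
  sum_eq : ∑ a ∈ A, m a = 0
  le : ∀ a ∈ A, ‖m a‖ ≤ Real.exp (L * height ν a u)
  eq_of_max : ∀ b ∈ A, (∀ a ∈ A, height ν a u ≤ height ν b u) →
    ‖m b‖ = Real.exp (L * height ν b u)

section

variable {k : ℕ} {A : Finset (Fin k → ℤ)} {ν : (Fin k → ℤ) → ℝ} {ψ φ : (Fin k → ℝ) → ℝ}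
  {c C R : ℝ} {X : Finset (Fin k → ℤ) → Fin k → ℝ} {S : Finset (Fin k → ℤ) → (Fin k → ℤ) → ℝ}

lemma eq_sum_single (v : Fin k → ℝ) : v = ∑ i, v i • Pi.single i (1 : ℝ) := by
  ext j
  simp [Finset.sum_apply, Pi.single_apply]

lemma apply_eq_sum (l : (Fin k → ℝ) →L[ℝ] ℝ) (v : Fin k → ℝ) :
    l v = ∑ i, v i * l (Pi.single i 1) := by
  conv_lhs => rw [eq_sum_single v]
  simp [map_sum]

lemma opNorm_le_of_coord {l : (Fin k → ℝ) →L[ℝ] ℝ} {b : ℝ}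
    (h : ∀ i, |l (Pi.single i 1)| ≤ b) (hb : 0 ≤ b) : ‖l‖ ≤ k * b := by
  refine l.opNorm_le_bound (by positivity) fun v => ?_
  rw [apply_eq_sum l v]
  calc ‖∑ i, v i * l (Pi.single i 1)‖ ≤ ∑ i, ‖v i * l (Pi.single i 1)‖ := norm_sum_le _ _
    _ ≤ ∑ _i : Fin k, ‖v‖ * b := by
      refine Finset.sum_le_sum fun i _ => ?_
      rw [norm_mul]
      exact mul_le_mul (norm_le_pi_norm v i) (h i) (norm_nonneg _) (norm_nonneg _)
    _ = k * b * ‖v‖ := by simp; ring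

lemma norm_covec_le (p : (Fin k → ℝ) →L[ℝ] ℝ) : ‖covec p‖ ≤ ‖p‖ := by
  refine (pi_norm_le_iff_of_nonneg (norm_nonneg _)).2 fun i => ?_
  rw [covec, Complex.norm_real]
  refine (p.le_opNorm _).trans ?_
  rw [Pi.norm_single, norm_one, mul_one]

/-- The complex version of `exists_coeff_bound`. -/
lemma exists_complex_coeff_bound (hA : IsCentralTriangulation A ν) :
    ∃ K > 0, ∀ σ, IsRegularFace A ν σ → ∀ m : (Fin k → ℤ) → ℂ, ∀ a ∈ σ,
      ‖m a‖ ≤ K * (‖momentVec σ m‖ + ‖∑ a ∈ σ, m a‖) := by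
  obtain ⟨K, hK, hKb⟩ := exists_coeff_bound hA
  refine ⟨2 * K * (k + 1), by positivity, fun σ hσ m a ha => ?_⟩
  have hre : |(m a).re| ≤ K * (k * ‖momentVec σ m‖ + ‖∑ a ∈ σ, m a‖) := by
    refine (hKb σ hσ (fun a => (m a).re) a ha).trans ?_
    gcongr
    · refine opNorm_le_of_coord (fun i => ?_) (norm_nonneg _)
      refine le_trans (le_of_eq ?_)
        ((Complex.abs_re_le_norm _).trans (norm_le_pi_norm (momentVec σ m) i))
      simp [sum_apply, smul_apply, pairing_single, momentVec]
    · refine le_trans (le_of_eq ?_) (Complex.abs_re_le_norm _)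
      rw [Complex.re_sum]
  have him : |(m a).im| ≤ K * (k * ‖momentVec σ m‖ + ‖∑ a ∈ σ, m a‖) := by
    refine (hKb σ hσ (fun a => (m a).im) a ha).trans ?_
    gcongr
    · refine opNorm_le_of_coord (fun i => ?_) (norm_nonneg _)
      refine le_trans (le_of_eq ?_)
        ((Complex.abs_im_le_norm _).trans (norm_le_pi_norm (momentVec σ m) i))
      simp [sum_apply, smul_apply, pairing_single, momentVec]
    · refine le_trans (le_of_eq ?_) (Complex.abs_im_le_norm _)
      rw [Complex.im_sum]
  have h1 := Complex.norm_le_abs_re_add_abs_im (m a)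
  have h2 : 0 ≤ (k : ℝ) * ‖∑ a ∈ σ, m a‖ := by positivity
  have h3 : K * (k * ‖momentVec σ m‖ + ‖∑ a ∈ σ, m a‖) ≤
      K * ((k + 1) * (‖momentVec σ m‖ + ‖∑ a ∈ σ, m a‖)) := by
    gcongr
    linarith [norm_nonneg (momentVec σ m)]
  linarith

lemma eventually_exp_neg_mul_le {e : ℝ} (he : 0 < e) (B : ℝ) {b : ℝ} (hb : 0 < b) :
    ∀ᶠ L in Filter.atTop, Real.exp (-(L * e)) * B ≤ b := by
  have h1 : Filter.Tendsto (fun L : ℝ => Real.exp (-(L * e)) * B) Filter.atTop (𝓝 (0 * B)) :=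
    (Real.tendsto_exp_neg_atTop_nhds_zero.comp
      (Filter.tendsto_id.atTop_mul_const he)).mul_const B
  rw [zero_mul] at h1
  exact h1.eventually_le_const hb

lemma exists_max_height (hA : IsCentralTriangulation A ν) (u : Fin k → ℝ) :
    ∃ b ∈ A, ∀ a ∈ A, height ν a u ≤ height ν b u :=
  A.exists_max_image (fun a => height ν a u) ⟨0, hA.zero_mem⟩

lemma Balanced.norm_le_of_not_nearMax {L e : ℝ} {u : Fin k → ℝ} {m : (Fin k → ℤ) → ℂ}
    (hm : Balanced A ν L u m) (hL : 0 ≤ L) {b : Fin k → ℤ}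
    (hb : ∀ a ∈ A, height ν a u ≤ height ν b u) {a : Fin k → ℤ} (ha : a ∈ A)
    (hn : ¬ NearMax A ν e u a) :
    ‖m a‖ ≤ Real.exp (-(L * e)) * Real.exp (L * height ν b u) := by
  obtain ⟨b', hb', hle⟩ : ∃ b' ∈ A, height ν a u + e ≤ height ν b' u := by
    simpa [NearMax] using hn
  refine (hm.le a ha).trans ?_
  rw [← Real.exp_add]
  refine Real.exp_le_exp.2 ?_
  have := hb b' hb'
  nlinarith

/-- The terms cannot cancel if only the constant term is nearly maximal. -/
lemma eventually_exists_nearMax (hA : IsCentralTriangulation A ν) {e : ℝ} (he : 0 < e) :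
    ∀ᶠ L in Filter.atTop, ∀ u m, Balanced A ν L u m → ∃ a ∈ A, a ≠ 0 ∧ NearMax A ν e u a := by
  classical
  filter_upwards [eventually_exp_neg_mul_le he A.card (one_half_pos (α := ℝ)),
    Filter.eventually_ge_atTop 0] with L hL hL0 u m hm
  obtain ⟨b, hb, hmax⟩ := exists_max_height hA u
  by_contra! hcon
  have hbn : NearMax A ν e u b := fun a ha => by linarith [hmax a ha]
  have hb0 : b = 0 := by
    by_contra h
    exact hcon b hb h hbn
  subst hb0
  set M := Real.exp (L * height ν 0 u) with hM
  have hM0 : 0 < M := Real.exp_pos _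
  have h1 : m 0 = -∑ a ∈ A.erase 0, m a := by
    have := hm.sum_eq
    rw [← Finset.add_sum_erase _ _ hb] at this
    exact eq_neg_of_add_eq_zero_left this
  have h2 : M ≤ A.card * (Real.exp (-(L * e)) * M) := by
    calc M = ‖m 0‖ := (hm.eq_of_max 0 hb hmax).symm
      _ ≤ ∑ a ∈ A.erase 0, ‖m a‖ := by rw [h1, norm_neg]; exact norm_sum_le _ _
      _ ≤ ∑ a ∈ A.erase 0, Real.exp (-(L * e)) * M := by
        refine Finset.sum_le_sum fun a ha => ?_
        have haA := Finset.mem_of_mem_erase ha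
        exact hm.norm_le_of_not_nearMax hL0 hmax haA (hcon a haA (Finset.ne_of_mem_erase ha))
      _ = ((A.erase 0).card : ℝ) * (Real.exp (-(L * e)) * M) := by
        rw [Finset.sum_const, nsmul_eq_mul]
      _ ≤ _ := by
        gcongr
        exact Finset.erase_subset _ _
  have h3 : Real.exp (-(L * e)) * A.card * M ≤ 1 / 2 * M := by gcongr
  linarith

/-- At a zero the differential of the exponential sum is at least of the order of its terms, and
the zero is far from the origin. -/
lemma exists_le_norm_momentVec (hA : IsCentralTriangulation A ν) (R : ℝ) :
    ∃ K > 0, ∀ᶠ L in Filter.atTop, ∀ u m, Balanced A ν L u m →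
      (∀ b ∈ A, Real.exp (L * height ν b u) ≤ K * ‖momentVec A m‖) ∧ R < ‖L • u‖ := by
  classical
  obtain ⟨η₀, hη₀, hnear⟩ := hA.near_max
  obtain ⟨K, hK, hKb⟩ := exists_complex_coeff_bound hA
  obtain ⟨N, hN, hNb⟩ := exists_pairing_bound A
  set n : ℝ := (A.card : ℝ) with hn
  have hνe : ∀ᶠ e in 𝓝[>] (0 : ℝ), ∀ a ∈ A, a ≠ 0 → 2 * e < ν a := by
    rw [Filter.eventually_all_finset]
    intro a ha
    by_cases ha0 : a = 0
    · exact Filter.Eventually.of_forall fun _ h => absurd ha0 h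
    · filter_upwards [Ioo_mem_nhdsGT (half_pos (hA.nu_pos a ha ha0))] with e he _
      linarith [he.2]
  -- with this `e`, a nonzero exponent can only be nearly maximal away from the origin
  obtain ⟨e, heν, he0⟩ := (hνe.and self_mem_nhdsWithin).exists
  have he0 : 0 < e := he0
  refine ⟨2 * K, by positivity, ?_⟩
  filter_upwards [eventually_exp_neg_mul_le hη₀ (K * (n * (N + 1))) (one_half_pos (α := ℝ)),
    eventually_exists_nearMax hA he0, Filter.eventually_gt_atTop 0,
    Filter.eventually_gt_atTop (R * (N / e))] with L hL1 hL2 hL0 hLR u m hm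
  constructor
  · obtain ⟨b₀, hb₀, hmax⟩ := exists_max_height hA u
    set M := Real.exp (L * height ν b₀ u) with hM
    have hM0 : 0 < M := Real.exp_pos _
    -- the maximal term is a vertex of a simplex outside of which all terms are small
    suffices hmain : M ≤ 2 * K * ‖momentVec A m‖ by
      intro b hb
      refine le_trans (Real.exp_le_exp.2 ?_) hmain
      have := hmax b hb
      gcongr
    obtain ⟨σ, hσ, h0, hsub⟩ := hnear u
    have hb₀σ : b₀ ∈ σ := hsub b₀ hb₀ fun a ha => by linarith [hmax a ha]
    have hσA := hσ.2.1
    set d := Real.exp (-(L * η₀)) with hd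
    have hd0 : 0 < d := Real.exp_pos _
    have hout : ∀ a ∈ A \ σ, ‖m a‖ ≤ d * M := fun a ha => by
      obtain ⟨haA, haσ⟩ := Finset.mem_sdiff.1 ha
      exact hm.norm_le_of_not_nearMax hL0.le hmax haA fun h => haσ (hsub a haA h)
    have hcard : ((A \ σ).card : ℝ) ≤ n := by
      rw [hn]; exact_mod_cast Finset.card_le_card (Finset.sdiff_subset (s := A) (t := σ))
    have h1 : ‖∑ a ∈ σ, m a‖ ≤ n * (d * M) := by
      have e1 : ∑ a ∈ σ, m a = -∑ a ∈ A \ σ, m a := by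
        have := hm.sum_eq
        rw [← Finset.sum_sdiff hσA] at this
        exact eq_neg_of_add_eq_zero_right this
      rw [e1, norm_neg]
      refine (norm_sum_le_of_le _ hout).trans ?_
      rw [Finset.sum_const, nsmul_eq_mul]
      gcongr
    have h2 : ‖momentVec σ m‖ ≤ ‖momentVec A m‖ + n * (d * M * N) := by
      refine (pi_norm_le_iff_of_nonneg (by positivity)).2 fun i => ?_
      have e1 : momentVec σ m i = momentVec A m i - ∑ a ∈ A \ σ, m a * (a i : ℂ) := by
        simp only [momentVec]
        rw [← Finset.sum_sdiff hσA]; ring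
      rw [e1]
      refine (norm_sub_le _ _).trans (add_le_add (norm_le_pi_norm _ i) ?_)
      have h3 : ∀ a ∈ A \ σ, ‖m a * (a i : ℂ)‖ ≤ d * M * N := fun a ha => by
        rw [norm_mul]
        refine mul_le_mul (hout a ha) ?_ (norm_nonneg _) (by positivity)
        have := (pairing a).le_of_opNorm_le (hNb a (Finset.mem_sdiff.1 ha).1) (Pi.single i 1)
        rw [pairing_single, Pi.norm_single, norm_one, mul_one] at this
        rwa [Complex.norm_intCast, ← Real.norm_eq_abs]
      refine (norm_sum_le_of_le _ h3).trans ?_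
      rw [Finset.sum_const, nsmul_eq_mul]
      gcongr
    have h3 := hKb σ hσ m b₀ hb₀σ
    rw [hm.eq_of_max b₀ hb₀ hmax, ← hM] at h3
    have h4 : K * (‖momentVec σ m‖ + ‖∑ a ∈ σ, m a‖) ≤
        K * ((‖momentVec A m‖ + n * (d * M * N)) + n * (d * M)) := by gcongr
    have h5 : d * (K * (n * (N + 1))) * M ≤ 1 / 2 * M := by gcongr
    linarith
  · -- the terms cancel, so a nonzero exponent is nearly maximal
    obtain ⟨a, ha, ha0, hn⟩ := hL2 u m hm
    have h1 := hn 0 hA.zero_mem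
    rw [height_zero hA, height_eq] at h1
    have h2 := (le_abs_self _).trans ((pairing a).le_of_opNorm_le (hNb a ha) u)
    have h3 : e / N ≤ ‖u‖ := by
      rw [div_le_iff₀ hN]; linarith [heν a ha ha0]
    rw [norm_smul, Real.norm_of_nonneg hL0.le]
    have h4 : L * (e / N) ≤ L * ‖u‖ := by gcongr
    have h5 : R * (N / e) * (e / N) < L * (e / N) := by gcongr
    have h6 : R * (N / e) * (e / N) = R := by field_simp
    linarith

/-- The multipliers of the finitely many face minima are bounded away from zero. -/
lemma FaceMinima.exists_le_abs (hX : FaceMinima A ν φ X S) :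
    ∃ s > 0, ∀ σ, IsCentral A ν σ → ∀ a ∈ σ, 2 * s ≤ |S σ a| := by
  have h : ∀ᶠ s in 𝓝[>] (0 : ℝ), ∀ σ ∈ A.powerset, ∀ a ∈ A, IsCentral A ν σ → a ∈ σ →
      2 * s ≤ |S σ a| := by
    rw [Filter.eventually_all_finset]
    intro σ _
    rw [Filter.eventually_all_finset]
    intro a ha
    by_cases hσ : IsCentral A ν σ ∧ a ∈ σ
    · have hmin := hX.isFaceMin σ hσ.1
      have hne : S σ a ≠ 0 := by
        by_cases ha0 : a = 0
        · rw [ha0]; exact hmin.neg.ne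
        · exact (hmin.pos a hσ.2 ha0).ne'
      filter_upwards [Ioo_mem_nhdsGT (half_pos (abs_pos.2 hne))] with s hs _ _
      linarith [hs.2]
    · exact Filter.Eventually.of_forall fun _ h1 h2 => absurd ⟨h1, h2⟩ hσ
  obtain ⟨s, h, hs⟩ := (h.and self_mem_nhdsWithin).exists
  exact ⟨s, hs, fun σ hσ a ha => h σ (Finset.mem_powerset.2 hσ.1.2.1) a (hσ.1.2.1 ha) hσ ha⟩

/-- If `dψ` is nearly a complex multiple of the differential of the exponential sum at one of its
zeros, then the zero is near the minimum point of a face of the central chamber, and all terms of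
this face are of maximal order. -/
lemma exists_near_critical (hA : IsCentralTriangulation A ν) (hB : PotentialBounds ψ φ c C R)
    (hX : FaceMinima A ν φ X S) {ϱ : ℝ} (hϱ : 0 < ϱ) :
    ∃ e > 0, ∀ ι > 0, ∀ᶠ L in Filter.atTop, ∀ u m, Balanced A ν L u m → ∀ μ : ℂ,
      ‖covec (fderiv ℝ ψ (L • u)) - μ • momentVec A m‖ ≤ e * ‖fderiv ℝ ψ (L • u)‖ →
      ∃ σ, IsCentral A ν σ ∧ ‖u - X σ‖ < ϱ ∧
        (∀ a ∈ σ, |(μ * m a).re - L * S σ a| ≤ ϱ * L) ∧ ∀ a ∈ σ, NearMax A ν ι u a := by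
  classical
  have hC := hB.C_pos
  obtain ⟨K, hK, hKev⟩ := exists_le_norm_momentVec hA R
  obtain ⟨s, hs0, hs⟩ := hX.exists_le_abs
  obtain ⟨X₀, hX₀, hX₀b⟩ : ∃ X₀ ≥ 0, ∀ σ ⊆ A, ‖X σ‖ ≤ X₀ :=
    ⟨∑ σ ∈ A.powerset, ‖X σ‖, by positivity, fun σ hσ =>
      Finset.single_le_sum (f := fun σ => ‖X σ‖) (fun _ _ => norm_nonneg _)
        (Finset.mem_powerset.2 hσ)⟩
  set ϱ' : ℝ := min (min (ϱ / 2) 1) s with hϱ'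
  have hϱ'0 : 0 < ϱ' := by simp only [hϱ', lt_min_iff]; exact ⟨⟨half_pos hϱ, one_pos⟩, hs0⟩
  have hϱ1 : ϱ' ≤ ϱ / 2 := (min_le_left _ _).trans (min_le_left _ _)
  have hϱ2 : ϱ' ≤ 1 := (min_le_left _ _).trans (min_le_right _ _)
  have hϱ3 : ϱ' ≤ s := min_le_right _ _
  obtain ⟨e, hclaim, he0⟩ := ((eventually_near_faceMin hA hB hX hϱ'0).and
    self_mem_nhdsWithin).exists
  have he0 : 0 < e := he0
  obtain ⟨e₁, ⟨he₁1, he₁e⟩, he₁0⟩ := (((eventually_mul_le 1 one_pos).and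
    (eventually_mul_le ((k : ℝ) * C) he0)).and self_mem_nhdsWithin).exists
  have he₁0 : 0 < e₁ := he₁0
  rw [mul_one] at he₁1
  set Q : ℝ := 2 * K * C * (X₀ + 1) with hQ
  have hQ0 : 0 < Q := by positivity
  refine ⟨e₁, he₁0, fun ι hι => ?_⟩
  filter_upwards [hKev, eventually_exists_nearMax hA he0, Filter.eventually_gt_atTop 0,
    eventually_exp_neg_mul_le he0 (2 * K * C) he0,
    eventually_exp_neg_mul_le hι Q (half_pos hs0)] with L hLK hLn hL0 hLe hLι u m hm μ hμ
  obtain ⟨hMle, hR⟩ := hLK u m hm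
  have hp := hB.fderiv_eq u L hL0 hR
  have hu0 : u ≠ 0 := by
    rintro rfl
    rw [smul_zero, norm_zero] at hR
    linarith [hB.R_pos]
  have hPn : ‖fderiv ℝ φ u‖ ≤ C * ‖u‖ := hB.norm_fderiv_model_le hu0
  have hpn : ‖fderiv ℝ ψ (L • u)‖ = L * ‖fderiv ℝ φ u‖ := by
    rw [hp, norm_smul, Real.norm_of_nonneg hL0.le]
  set p := fderiv ℝ ψ (L • u) with hpdef
  set q := momentVec A m with hq
  obtain ⟨b₀, hb₀, hmax⟩ := exists_max_height hA u
  set M := Real.exp (L * height ν b₀ u) with hM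
  have hM0 : 0 < M := Real.exp_pos _
  have hμM : ‖μ‖ * M ≤ 2 * K * C * (L * ‖u‖) := by
    have h1 : ‖μ‖ * ‖q‖ ≤ 2 * ‖p‖ := by
      rw [← norm_smul]
      have h2 : ‖μ • q‖ ≤ ‖covec p‖ + ‖covec p - μ • q‖ := by
        have : μ • q = covec p - (covec p - μ • q) := by abel
        rw [this]
        exact (norm_sub_le _ _).trans (by simp)
      have h3 := norm_covec_le p
      have h4 : e₁ * ‖p‖ ≤ 1 * ‖p‖ := by gcongr
      linarith
    calc ‖μ‖ * M ≤ ‖μ‖ * (K * ‖q‖) := by gcongr; exact hMle b₀ hb₀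
      _ = K * (‖μ‖ * ‖q‖) := by ring
      _ ≤ K * (2 * (L * (C * ‖u‖))) :=
        mul_le_mul_of_nonneg_left (h1.trans (by rw [hpn]; gcongr)) hK.le
      _ = _ := by ring
  set r : (Fin k → ℤ) → ℝ := fun a => (μ * m a).re / L with hr
  have hrabs : ∀ a, |r a| ≤ ‖μ‖ * ‖m a‖ / L := fun a => by
    rw [hr, abs_div, abs_of_pos hL0, ← norm_mul]
    gcongr
    exact Complex.abs_re_le_norm _
  obtain ⟨σ, hσ, hdist, hcoef⟩ : ∃ σ, IsCentral A ν σ ∧ ‖u - X σ‖ ≤ ϱ' ∧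
      ∀ a ∈ σ, |r a - S σ a| ≤ ϱ' := by
    refine hclaim u r (hLn u m hm) ?_ ?_ ?_
    · have h1 : ‖fderiv ℝ φ u - ∑ a ∈ A, r a • pairing a‖ ≤ k * (‖covec p - μ • q‖ / L) := by
        refine opNorm_le_of_coord (fun i => ?_) (by positivity)
        have h2 : (fderiv ℝ φ u - ∑ a ∈ A, r a • pairing a) (Pi.single i 1) =
            ((covec p - μ • q) i).re / L := by
          have h3 : p (Pi.single i 1) = L * fderiv ℝ φ u (Pi.single i 1) := by
            rw [hp, smul_apply, smul_eq_mul]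
          have h4 : (μ * q i).re = L * ∑ a ∈ A, r a * (a i : ℝ) := by
            rw [hq, momentVec, Finset.mul_sum, Complex.re_sum, Finset.mul_sum]
            refine Finset.sum_congr rfl fun a _ => ?_
            rw [← mul_assoc, ← Complex.ofReal_intCast, Complex.re_mul_ofReal, hr]
            field_simp
          rw [Pi.sub_apply, Pi.smul_apply, smul_eq_mul, Complex.sub_re, h4, covec,
            Complex.ofReal_re, h3]
          simp only [sub_apply, sum_apply, smul_apply, pairing_single, smul_eq_mul]
          field_simp
        rw [h2, abs_div, abs_of_pos hL0]
        gcongr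
        exact (Complex.abs_re_le_norm _).trans (norm_le_pi_norm (covec p - μ • q) i)
      calc ‖fderiv ℝ φ u - ∑ a ∈ A, r a • pairing a‖
          ≤ k * (‖covec p - μ • q‖ / L) := h1
        _ ≤ k * (e₁ * (L * (C * ‖u‖)) / L) := by
          gcongr
          refine hμ.trans ?_
          rw [hpn]
          gcongr
        _ = e₁ * (k * C) * ‖u‖ := by field_simp
        _ ≤ e * ‖u‖ := by gcongr
        _ ≤ e * (1 + ‖u‖) := mul_le_mul_of_nonneg_left (by linarith) he0.le
    · have h1 : ∑ a ∈ A, r a = 0 := by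
        simp only [hr]
        rw [← Finset.sum_div, ← Complex.re_sum, ← Finset.mul_sum, hm.sum_eq, mul_zero,
          Complex.zero_re, zero_div]
      rw [h1, abs_zero]
      positivity
    · intro a ha hn
      have h1 := hm.norm_le_of_not_nearMax hL0.le hmax ha hn
      calc |r a| ≤ ‖μ‖ * ‖m a‖ / L := hrabs a
        _ ≤ ‖μ‖ * (Real.exp (-(L * e)) * M) / L := by gcongr
        _ = Real.exp (-(L * e)) * (‖μ‖ * M) / L := by ring
        _ ≤ Real.exp (-(L * e)) * (2 * K * C * (L * ‖u‖)) / L := by gcongr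
        _ = Real.exp (-(L * e)) * (2 * K * C) * ‖u‖ := by field_simp
        _ ≤ e * ‖u‖ := by gcongr
        _ ≤ _ := by gcongr; linarith
  have huX : ‖u‖ ≤ X₀ + 1 := by
    have : ‖u‖ ≤ ‖u - X σ‖ + ‖X σ‖ := norm_le_norm_sub_add _ _
    linarith [hX₀b σ hσ.1.2.1]
  refine ⟨σ, hσ, by linarith, fun a ha => ?_, fun a ha => ?_⟩
  · have h1 := hcoef a ha
    have h2 : (μ * m a).re - L * S σ a = L * (r a - S σ a) := by
      rw [hr]; field_simp
    rw [h2, abs_mul, abs_of_pos hL0]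
    have : L * |r a - S σ a| ≤ L * ϱ' := by gcongr
    have : L * ϱ' ≤ L * ϱ := by gcongr; linarith
    linarith
  · -- the term of `a` is bounded below by a fixed multiple of the largest term
    by_contra hn
    have h1 := hm.norm_le_of_not_nearMax hL0.le hmax (hσ.1.2.1 ha) hn
    have h2 : s ≤ |r a| := by
      have h3 := hcoef a ha
      have h4 := hs σ hσ a ha
      have h5 := abs_sub_abs_le_abs_sub (S σ a) (r a)
      rw [abs_sub_comm (S σ a)] at h5
      linarith
    have h3 : |r a| ≤ Real.exp (-(L * ι)) * Q := by
      calc |r a| ≤ ‖μ‖ * ‖m a‖ / L := hrabs a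
        _ ≤ ‖μ‖ * (Real.exp (-(L * ι)) * M) / L := by gcongr
        _ = Real.exp (-(L * ι)) * (‖μ‖ * M) / L := by ring
        _ ≤ Real.exp (-(L * ι)) * (2 * K * C * (L * ‖u‖)) / L := by gcongr
        _ = Real.exp (-(L * ι)) * (2 * K * C * ‖u‖) := by field_simp
        _ ≤ _ := by rw [hQ]; gcongr
    linarith

/-- The orthogonal projection of `p` to the complex hyperplane with coefficient vector `q`. -/
lemma exists_projection (p : (Fin k → ℝ) →L[ℝ] ℝ) {q : Fin k → ℂ} (hq : q ≠ 0) :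
    ∃ (μ : ℂ) (X₀ : Fin k → ℂ), ∑ i, q i * X₀ i = 0 ∧ ‖X₀‖ ^ 2 ≤ p (rePart X₀) ∧
      ‖covec p - μ • q‖ = ‖X₀‖ := by
  set n : ℂ := ∑ i, q i * (starRingEnd ℂ) (q i) with hn
  have hn0 : n ≠ 0 := by
    obtain ⟨j, hj⟩ := Function.ne_iff.1 hq
    have h1 : n = ((∑ i, ‖q i‖ ^ 2 : ℝ) : ℂ) := by
      rw [hn, Complex.ofReal_sum]
      exact Finset.sum_congr rfl fun i _ => by rw [Complex.mul_conj']; simp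
    rw [h1, Complex.ofReal_ne_zero]
    have h2 : 0 < ‖q j‖ ^ 2 := pow_pos (norm_pos_iff.2 hj) 2
    have h3 := Finset.single_le_sum (f := fun i => ‖q i‖ ^ 2) (fun i _ => sq_nonneg _)
      (Finset.mem_univ j)
    exact (h2.trans_le h3).ne'
  set μ : ℂ := (∑ i, q i * covec p i) / n with hμ
  set X₀ : Fin k → ℂ := fun i => covec p i - μ * (starRingEnd ℂ) (q i) with hX₀
  have hconj : ∀ i, (starRingEnd ℂ) (X₀ i) = covec p i - (starRingEnd ℂ) μ * q i := fun i => by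
    simp only [hX₀, map_sub, map_mul, Complex.conj_conj, covec, Complex.conj_ofReal]
  have hzero : ∑ i, q i * X₀ i = 0 := by
    have : ∑ i, q i * X₀ i = ∑ i, q i * covec p i - μ * n := by
      rw [hn, Finset.mul_sum, ← Finset.sum_sub_distrib]
      exact Finset.sum_congr rfl fun i _ => by simp only [hX₀]; ring
    rw [this, hμ, div_mul_cancel₀ _ hn0, sub_self]
  refine ⟨(starRingEnd ℂ) μ, X₀, hzero, ?_, ?_⟩
  · have h1 : p (rePart X₀) = ∑ i, ‖X₀ i‖ ^ 2 := by
      have h2 : ((∑ i, ‖X₀ i‖ ^ 2 : ℝ) : ℂ) = ∑ i, covec p i * X₀ i := by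
        rw [Complex.ofReal_sum]
        have h3 : ∀ i, ((‖X₀ i‖ ^ 2 : ℝ) : ℂ) =
            covec p i * X₀ i - (starRingEnd ℂ) μ * (q i * X₀ i) := fun i => by
          rw [Complex.ofReal_pow, ← Complex.conj_mul', hconj]; ring
        rw [Finset.sum_congr rfl fun i _ => h3 i, Finset.sum_sub_distrib, ← Finset.mul_sum, hzero]
        ring
      rw [apply_eq_sum, ← Complex.ofReal_re (∑ i, ‖X₀ i‖ ^ 2), h2, Complex.re_sum]
      refine Finset.sum_congr rfl fun i _ => ?_
      rw [covec, Complex.re_ofReal_mul, rePart_apply]; ring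
    rw [h1]
    by_cases hk : Nonempty (Fin k)
    · obtain ⟨j, hj⟩ := exists_eq_ciSup_of_finite (f := fun i => ‖X₀ i‖)
      have h2 : ‖X₀‖ ≤ ‖X₀ j‖ := by
        refine (pi_norm_le_iff_of_nonneg (norm_nonneg _)).2 fun i => ?_
        rw [show ‖X₀ j‖ = _ from hj]
        exact le_ciSup (f := fun i => ‖X₀ i‖) (Finite.bddAbove_range _) i
      calc ‖X₀‖ ^ 2 ≤ ‖X₀ j‖ ^ 2 := by gcongr
        _ ≤ _ := Finset.single_le_sum (f := fun i => ‖X₀ i‖ ^ 2) (fun i _ => sq_nonneg _)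
          (Finset.mem_univ j)
    · rw [not_nonempty_iff] at hk
      have : X₀ = 0 := Subsingleton.elim _ _
      rw [this]; simp
  · have h1 : covec p - (starRingEnd ℂ) μ • q = fun i => (starRingEnd ℂ) (X₀ i) := by
      ext i
      rw [hconj]; rfl
    rw [h1]
    simp only [Pi.norm_def, RCLike.nnnorm_conj]

end

variable {k : ℕ}

/-! ### Logarithmic coordinates on the torus -/

/-- The exponential map `ℂ^k → (ℂ^*)^k`. -/
def expC (w : Fin k → ℂ) : Fin k → ℂ := fun i => Complex.exp (w i)

/-- The principal logarithm in each coordinate. -/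
def logC (z : Fin k → ℂ) : Fin k → ℂ := fun i => Complex.log (z i)

lemma expC_mem_torus (w : Fin k → ℂ) : expC w ∈ torus k := fun i => Complex.exp_ne_zero (w i)

lemma expC_logC {z : Fin k → ℂ} (hz : z ∈ torus k) : expC (logC z) = z :=
  funext fun i => Complex.exp_log (hz i)

lemma Log_expC (w : Fin k → ℂ) : Log (expC w) = rePart w := by
  ext i
  simp [Log, expC, Complex.norm_exp]

lemma rePart_logC (z : Fin k → ℂ) : rePart (logC z) = Log z := by
  ext i
  simp [Log, logC, Complex.log_re]

lemma isOpen_torus : IsOpen (torus k) := by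
  have : torus k = ⋂ i, {z : Fin k → ℂ | z i ≠ 0} := by ext; simp [torus]
  rw [this]
  exact isOpen_iInter_of_finite fun i => isOpen_ne_fun (continuous_apply i) continuous_const

lemma contDiff_expC : ContDiff ℝ ∞ (expC (k := k)) :=
  contDiff_pi.2 fun i => (contDiff_apply ℝ ℂ i).cexp

lemma fderiv_expC (w ξ : Fin k → ℂ) :
    fderiv ℝ expC w ξ = fun i => expC w i * ξ i := by
  have h : ∀ i, HasFDerivAt (fun w : Fin k → ℂ => Complex.exp (w i))
      (Complex.exp (w i) • (ContinuousLinearMap.proj i : (Fin k → ℂ) →L[ℝ] ℂ)) w := fun i =>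
    (hasFDerivAt_apply (𝕜 := ℝ) i w).cexp
  have := (hasFDerivAt_pi.2 h).fderiv
  ext i
  change fderiv ℝ (fun (w : Fin k → ℂ) i => Complex.exp (w i)) w ξ i = _
  rw [this]
  simp [expC]

lemma contDiffAt_Log {z : Fin k → ℂ} (hz : z ∈ torus k) : ContDiffAt ℝ ∞ (Log (k := k)) z :=
  contDiffAt_pi.2 fun i =>
    ((contDiffAt_norm ℝ (hz i)).comp z (contDiff_apply ℝ ℂ i).contDiffAt).log
      (norm_ne_zero_iff.2 (hz i))

/-- The derivative of a function on the torus, read in logarithmic coordinates. -/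
lemma fderiv_eq_fderiv_comp_expC {V : Type*} [NormedAddCommGroup V] [NormedSpace ℝ V]
    {f : (Fin k → ℂ) → V} {z : Fin k → ℂ} (hz : z ∈ torus k) (hf : DifferentiableAt ℝ f z)
    (X : Fin k → ℂ) :
    fderiv ℝ f z X = fderiv ℝ (fun w => f (expC w)) (logC z) (X / z) := by
  have h1 : fderiv ℝ (f ∘ expC) (logC z) = (fderiv ℝ f z).comp (fderiv ℝ expC (logC z)) := by
    rw [fderiv_comp _ (by rwa [expC_logC hz])
      (contDiff_expC.contDiffAt.differentiableAt (by simp)), expC_logC hz]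
  change _ = fderiv ℝ (f ∘ expC) (logC z) (X / z)
  rw [h1, ContinuousLinearMap.comp_apply, fderiv_expC, expC_logC hz]
  congr 1
  ext i
  rw [Pi.div_apply, mul_div_cancel₀ _ (hz i)]

lemma contDiffAt_torusPotential {ψ : (Fin k → ℝ) → ℝ} (hψ : ContDiff ℝ ∞ ψ) {z : Fin k → ℂ}
    (hz : z ∈ torus k) : ContDiffAt ℝ ∞ (torusPotential ψ) z :=
  hψ.contDiffAt.comp z (contDiffAt_Log hz)

lemma fderiv_torusPotential {ψ : (Fin k → ℝ) → ℝ} (hψ : ContDiff ℝ ∞ ψ) {z : Fin k → ℂ}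
    (hz : z ∈ torus k) (X : Fin k → ℂ) :
    fderiv ℝ (torusPotential ψ) z X = fderiv ℝ ψ (Log z) (rePart (X / z)) := by
  rw [fderiv_eq_fderiv_comp_expC hz ((contDiffAt_torusPotential hψ hz).differentiableAt (by simp))]
  simp only [torusPotential, Log_expC]
  change fderiv ℝ (ψ ∘ rePart) (logC z) (X / z) = _
  rw [fderiv_comp _ (hψ.contDiffAt.differentiableAt (by simp)) rePart.differentiableAt,
    ContinuousLinearMap.fderiv, rePart_logC]
  rfl

lemma dRho_eq (z X : Fin k → ℂ) : dRho z X = rePart (X / z) := by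
  ext i; simp [dRho]

lemma dEta_eq (z X : Fin k → ℂ) : dEta z X = imPart (X / z) := by
  ext i; simp [dEta]

lemma symplecticForm_eq (ψ : (Fin k → ℝ) → ℝ) (z X Y : Fin k → ℂ) :
    symplecticForm ψ z X Y = omForm (fderiv ℝ (fderiv ℝ ψ) (Log z)) (X / z) (Y / z) := by
  simp only [symplecticForm, dRho_eq, dEta_eq, omForm, hessian]

lemma kahlerMetric_eq (ψ : (Fin k → ℝ) → ℝ) (z X Y : Fin k → ℂ) :
    kahlerMetric ψ z X Y = gForm (fderiv ℝ (fderiv ℝ ψ) (Log z)) (X / z) (Y / z) := by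
  simp only [kahlerMetric, dRho_eq, dEta_eq, gForm, hessian]

lemma liouvilleForm_eq (ψ : (Fin k → ℝ) → ℝ) (z X : Fin k → ℂ) :
    liouvilleForm ψ z X = fderiv ℝ ψ (Log z) (imPart (X / z)) := by
  simp only [liouvilleForm, dEta_eq]

/-! ### The tailored function in logarithmic coordinates -/

/-- The complex extension of the pairing with `a`. -/
def cpairing (a : Fin k → ℤ) : (Fin k → ℂ) →L[ℝ] ℂ :=
  ∑ i, (a i : ℝ) • ContinuousLinearMap.proj i

lemma cpairing_apply (a : Fin k → ℤ) (w : Fin k → ℂ) : cpairing a w = ∑ i, (a i : ℂ) * w i := by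
  simp [cpairing, sum_apply]

lemma cpairing_re (a : Fin k → ℤ) (w : Fin k → ℂ) : (cpairing a w).re = pairing a (rePart w) := by
  rw [cpairing_apply, pairing_apply, Complex.re_sum]
  refine Finset.sum_congr rfl fun i _ => ?_
  rw [← Complex.ofReal_intCast, Complex.re_ofReal_mul, rePart_apply]

lemma cpairing_im (a : Fin k → ℤ) (w : Fin k → ℂ) : (cpairing a w).im = pairing a (imPart w) := by
  rw [cpairing_apply, pairing_apply, Complex.im_sum]
  refine Finset.sum_congr rfl fun i _ => ?_
  rw [← Complex.ofReal_intCast, Complex.im_ofReal_mul, imPart_apply]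

/-- The value of the cut-off factor `(1 - s) + s χ`. -/
def cutFactor (χ : (Fin k → ℤ) → (Fin k → ℝ) → ℝ) (s : ℝ) (a : Fin k → ℤ) (u : Fin k → ℝ) : ℝ :=
  (1 - s) + s * χ a u

/-- The term with exponent `a` of the tailored function with `t = exp L`, in logarithmic
coordinates. -/
def logTerm (ν : (Fin k → ℤ) → ℝ) (χ : (Fin k → ℤ) → (Fin k → ℝ) → ℝ) (L s : ℝ)
    (w : Fin k → ℂ) (a : Fin k → ℤ) : ℂ :=
  ((coeff a * cutFactor χ s a (L⁻¹ • rePart w) * Real.exp (-(L * ν a)) : ℝ) : ℂ) *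
    Complex.exp (cpairing a w)

/-- The part of the derivative of the tailored function that comes from the cut-off functions. -/
def cutDeriv (A : Finset (Fin k → ℤ)) (ν : (Fin k → ℤ) → ℝ)
    (χ : (Fin k → ℤ) → (Fin k → ℝ) → ℝ) (L s : ℝ) (w : Fin k → ℂ) : (Fin k → ℂ) →L[ℝ] ℂ :=
  ∑ a ∈ A, ((coeff a * s * L⁻¹ * Real.exp (-(L * ν a)) : ℝ) * Complex.exp (cpairing a w)) •
    (Complex.ofRealCLM.comp ((fderiv ℝ (χ a) (L⁻¹ • rePart w)).comp rePart))

variable {A : Finset (Fin k → ℤ)} {ν : (Fin k → ℤ) → ℝ}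
  {χ : (Fin k → ℤ) → (Fin k → ℝ) → ℝ} {L s : ℝ}

lemma prod_expC_zpow (a : Fin k → ℤ) (w : Fin k → ℂ) :
    ∏ i, expC w i ^ a i = Complex.exp (cpairing a w) := by
  rw [cpairing_apply, Complex.exp_sum]
  exact Finset.prod_congr rfl fun i _ => (Complex.exp_int_mul (w i) (a i)).symm

lemma tailoredFun_expC (w : Fin k → ℂ) :
    tailoredFun A ν χ (Real.exp L) s (expC w) = ∑ a ∈ A, logTerm ν χ L s w a := by
  refine Finset.sum_congr rfl fun a _ => ?_
  rw [logTerm, prod_expC_zpow, LogBase, Log_expC, Real.log_exp, ← Real.exp_mul, cutFactor,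
    mul_neg]

lemma hasFDerivAt_sum_logTerm (hχ : ∀ a ∈ A, ContDiff ℝ ∞ (χ a)) (w : Fin k → ℂ) :
    HasFDerivAt (fun w => ∑ a ∈ A, logTerm ν χ L s w a)
      (∑ a ∈ A, (logTerm ν χ L s w a • cpairing a) + cutDeriv A ν χ L s w) w := by
  rw [cutDeriv, ← Finset.sum_add_distrib]
  refine HasFDerivAt.fun_sum fun a ha => ?_
  have h1 : HasFDerivAt (fun w : Fin k → ℂ => χ a (L⁻¹ • rePart w))
      ((fderiv ℝ (χ a) (L⁻¹ • rePart w)).comp (L⁻¹ • rePart)) w :=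
    ((hχ a ha).contDiffAt.differentiableAt (by simp)).hasFDerivAt.comp w
      (rePart.hasFDerivAt.const_smul L⁻¹)
  have h2 := (((h1.const_mul s).const_add (1 - s)).const_mul (coeff a)).mul_const
    (Real.exp (-(L * ν a)))
  have h3 := (Complex.ofRealCLM.hasFDerivAt.comp w h2).mul (cpairing a).hasFDerivAt.cexp
  refine h3.congr_fderiv ?_
  ext ξ
  simp [logTerm, cutFactor]
  ring

lemma pertForm_momentVec (m : (Fin k → ℤ) → ℂ) (β : (Fin k → ℂ) →L[ℝ] ℂ) (ξ : Fin k → ℂ) :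
    pertForm (momentVec A m) β ξ = ∑ a ∈ A, m a * cpairing a ξ + β ξ := by
  rw [pertForm]
  congr 1
  simp only [momentVec, cpairing_apply, Finset.sum_mul, Finset.mul_sum]
  rw [Finset.sum_comm]
  exact Finset.sum_congr rfl fun _ _ => Finset.sum_congr rfl fun _ _ => by ring

lemma contDiffOn_tailoredFun (hχ : ∀ a ∈ A, ContDiff ℝ ∞ (χ a)) (t s : ℝ) :
    ContDiffOn ℝ ∞ (tailoredFun A ν χ t s) (torus k) := by
  intro z hz
  refine ContDiffAt.contDiffWithinAt ?_
  refine ContDiffAt.sum fun a ha => ContDiffAt.mul ?_ (contDiffAt_prod fun i _ => ?_)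
  · refine Complex.ofRealCLM.contDiff.contDiffAt.comp z ?_
    have h1 : ContDiffAt ℝ ∞ (fun z => χ a (LogBase t z)) z :=
      (hχ a ha).contDiffAt.comp z ((contDiffAt_Log hz).const_smul _)
    exact (contDiffAt_const.mul (contDiffAt_const.add (contDiffAt_const.mul h1))).mul
      contDiffAt_const
  · have h1 : ContDiffAt ℝ ∞ (fun z : Fin k → ℂ => z i) z := (contDiff_apply ℝ ℂ i).contDiffAt
    obtain ⟨n, hn | hn⟩ := (a i).eq_nat_or_neg
    · simp only [hn, zpow_natCast]
      exact h1.pow n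
    · simp only [hn, zpow_neg, zpow_natCast]
      exact (h1.pow n).inv (pow_ne_zero _ (hz i))

lemma differentiableAt_tailoredFun (hχ : ∀ a ∈ A, ContDiff ℝ ∞ (χ a)) {t s : ℝ}
    {z : Fin k → ℂ} (hz : z ∈ torus k) : DifferentiableAt ℝ (tailoredFun A ν χ t s) z :=
  ((contDiffOn_tailoredFun hχ t s).contDiffAt (isOpen_torus.mem_nhds hz)).differentiableAt
    (by simp)

/-- The derivative of the tailored function in logarithmic coordinates. -/
lemma fderiv_tailoredFun (hχ : ∀ a ∈ A, ContDiff ℝ ∞ (χ a)) {z : Fin k → ℂ} (hz : z ∈ torus k)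
    (X : Fin k → ℂ) :
    fderiv ℝ (tailoredFun A ν χ (Real.exp L) s) z X =
      pertForm (momentVec A (logTerm ν χ L s (logC z))) (cutDeriv A ν χ L s (logC z)) (X / z) := by
  rw [fderiv_eq_fderiv_comp_expC hz (differentiableAt_tailoredFun hχ hz)]
  simp only [tailoredFun_expC]
  rw [(hasFDerivAt_sum_logTerm hχ _).fderiv, pertForm_momentVec]
  simp [sum_apply]

lemma sum_logTerm_eq_zero {z : Fin k → ℂ}
    (hz : z ∈ zeroSet (tailoredFun A ν χ (Real.exp L) s)) :
    ∑ a ∈ A, logTerm ν χ L s (logC z) a = 0 := by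
  rw [← tailoredFun_expC, expC_logC hz.1, hz.2]

lemma abs_coeff (a : Fin k → ℤ) : |coeff a| = 1 := by
  rw [coeff]; split_ifs <;> simp

lemma norm_exp_cpairing (hL : 0 < L) (w : Fin k → ℂ) (a : Fin k → ℤ) :
    Real.exp (-(L * ν a)) * ‖Complex.exp (cpairing a w)‖ =
      Real.exp (L * height ν a (L⁻¹ • rePart w)) := by
  rw [Complex.norm_exp, cpairing_re, ← Real.exp_add, height_eq, map_smul, smul_eq_mul]
  congr 1
  field_simp
  ring

lemma norm_logTerm (hL : 0 < L) (w : Fin k → ℂ) (a : Fin k → ℤ) :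
    ‖logTerm ν χ L s w a‖ = |cutFactor χ s a (L⁻¹ • rePart w)| *
      Real.exp (L * height ν a (L⁻¹ • rePart w)) := by
  rw [logTerm, norm_mul, Complex.norm_real, Real.norm_eq_abs, abs_mul, abs_mul, abs_coeff, one_mul,
    Real.abs_exp, mul_assoc, norm_exp_cpairing hL]

/-! ### Zeros of the tailored function for large parameters -/

section

variable {k : ℕ} {A : Finset (Fin k → ℤ)} {ν : (Fin k → ℤ) → ℝ} {ψ φ : (Fin k → ℝ) → ℝ}
  {χ : (Fin k → ℤ) → (Fin k → ℝ) → ℝ} {L s : ℝ}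
  {c C R : ℝ} {X : Finset (Fin k → ℤ) → Fin k → ℝ} {S : Finset (Fin k → ℤ) → (Fin k → ℤ) → ℝ}

lemma cutFactor_mem_Icc {G : Matrix (Fin k) (Fin k) ℝ} {ε₁ ε₂ : ℝ}
    (hχ : IsCutoffFamily A ν G ε₁ ε₂ χ) (hs : s ∈ Set.Icc (0 : ℝ) 1) {a : Fin k → ℤ} (ha : a ∈ A)
    (u : Fin k → ℝ) : cutFactor χ s a u ∈ Set.Icc (0 : ℝ) 1 := by
  have h := hχ.mem_Icc a ha u
  have h1 : 0 ≤ s * χ a u := mul_nonneg hs.1 h.1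
  have h2 : s * χ a u ≤ s * 1 := mul_le_mul_of_nonneg_left h.2 hs.1
  constructor <;> unfold cutFactor <;> linarith [hs.2]

/-- At a zero of the tailored function, the terms sum to zero, and a cut-off factor that belongs
to a term of maximal order is `1`. -/
lemma balanced_logTerm {G : Matrix (Fin k) (Fin k) ℝ} {ε₁ ε₂ : ℝ} (hε : 0 < ε₁)
    (hχ : IsCutoffFamily A ν G ε₁ ε₂ χ) (hs : s ∈ Set.Icc (0 : ℝ) 1) (hL : 0 < L)
    {z : Fin k → ℂ} (hz : z ∈ zeroSet (tailoredFun A ν χ (Real.exp L) s)) :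
    Balanced A ν L (L⁻¹ • Log z) (logTerm ν χ L s (logC z)) where
  sum_eq := sum_logTerm_eq_zero hz
  le a ha := by
    have h := cutFactor_mem_Icc hχ hs ha (L⁻¹ • Log z)
    rw [norm_logTerm hL, rePart_logC, abs_of_nonneg h.1]
    exact mul_le_of_le_one_left (Real.exp_pos _).le h.2
  eq_of_max b hb hmax := by
    have h1 : metricDist G (L⁻¹ • Log z) (chamber A ν b) ≤ ε₁ := by
      refine (metricDist_le _ (mem_chamber.2 hmax)).trans ?_
      simp [metricNorm, hε.le]
    rw [norm_logTerm hL, rePart_logC, cutFactor, hχ.eq_one b hb _ h1]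
    simp

/-- Each derivative of a cut-off function contributes a factor `1 / L`, so that for large `L` the
perturbation is small compared with the largest term. -/
lemma norm_cutDeriv_le (hs : s ∈ Set.Icc (0 : ℝ) 1) (hL : 0 < L) {M B : ℝ} (hM : 0 ≤ M)
    (hχ : ∀ a ∈ A, ∀ p, ‖fderiv ℝ (χ a) p‖ ≤ M) (w : Fin k → ℂ)
    (hB : ∀ a ∈ A, Real.exp (L * height ν a (L⁻¹ • rePart w)) ≤ B) (ξ : Fin k → ℂ) :
    ‖cutDeriv A ν χ L s w ξ‖ ≤ A.card * M * L⁻¹ * B * ‖ξ‖ := by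
  have h : ∀ a ∈ A, ‖(((coeff a * s * L⁻¹ * Real.exp (-(L * ν a)) : ℝ) *
      Complex.exp (cpairing a w)) • (Complex.ofRealCLM.comp
        ((fderiv ℝ (χ a) (L⁻¹ • rePart w)).comp rePart))) ξ‖ ≤ M * L⁻¹ * B * ‖ξ‖ := by
    intro a ha
    rw [smul_apply, norm_smul, norm_mul, Complex.norm_real, Real.norm_eq_abs, abs_mul, abs_mul,
      abs_mul, abs_coeff, one_mul, Real.abs_exp, mul_assoc (|s| * |L⁻¹|), norm_exp_cpairing hL,
      abs_of_nonneg hs.1, abs_of_pos (inv_pos.2 hL)]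
    have h1 : ‖(Complex.ofRealCLM.comp
        ((fderiv ℝ (χ a) (L⁻¹ • rePart w)).comp rePart)) ξ‖ ≤ M * ‖ξ‖ := by
      simp only [ContinuousLinearMap.comp_apply, Complex.ofRealCLM_apply, Complex.norm_real]
      refine (ContinuousLinearMap.le_opNorm _ _).trans ?_
      exact mul_le_mul (hχ a ha _) (norm_rePart_le ξ) (norm_nonneg _) hM
    calc s * L⁻¹ * Real.exp (L * height ν a (L⁻¹ • rePart w)) * _
        ≤ 1 * L⁻¹ * B * (M * ‖ξ‖) := by
          have := hs.2
          have h3 := hB a ha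
          have h4 : 0 ≤ B := (Real.exp_pos _).le.trans h3
          gcongr
      _ = _ := by ring
  rw [cutDeriv, sum_apply]
  calc _ ≤ _ := norm_sum_le _ _
    _ ≤ ∑ a ∈ A, M * L⁻¹ * B * ‖ξ‖ := Finset.sum_le_sum h
    _ = _ := by rw [Finset.sum_const, nsmul_eq_mul]; ring

/-- The properties of the zeros of the tailored function that hold for large parameters. The
second field says that the derivatives of the cut-off functions are a small perturbation of
the derivative of an exponential sum, the fourth one that this perturbation vanishes wherever
`dψ` is nearly conormal to the kernel of the unperturbed derivative. -/
structure IsGoodZero (A : Finset (Fin k → ℤ)) (ν : (Fin k → ℤ) → ℝ)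
    (χ : (Fin k → ℤ) → (Fin k → ℝ) → ℝ) (ψ : (Fin k → ℝ) → ℝ)
    (S : Finset (Fin k → ℤ) → (Fin k → ℤ) → ℝ) (κ e ϱ L s : ℝ) (z : Fin k → ℂ) : Prop where
  momentVec_ne_zero : momentVec A (logTerm ν χ L s (logC z)) ≠ 0
  norm_cutDeriv_le : ∀ ξ, ‖cutDeriv A ν χ L s (logC z) ξ‖ ≤
    κ * ‖momentVec A (logTerm ν χ L s (logC z))‖ * ‖ξ‖
  fderiv_ne_zero : fderiv ℝ ψ (Log z) ≠ 0
  near : ∀ μ : ℂ, ‖covec (fderiv ℝ ψ (Log z)) - μ • momentVec A (logTerm ν χ L s (logC z))‖ ≤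
      e * ‖fderiv ℝ ψ (Log z)‖ →
    ∃ σ, IsCentral A ν σ ∧
      (∀ a ∈ σ, |(μ * logTerm ν χ L s (logC z) a).re - L * S σ a| ≤ ϱ * L) ∧
      ∀ᶠ u in 𝓝 (L⁻¹ • Log z), (∀ a ∈ σ, χ a u = 1) ∧ ∀ b ∈ A, b ∉ σ → χ b u = 0

lemma PotentialBounds.fderiv_ne_zero (hB : PotentialBounds ψ φ c C R) {x : Fin k → ℝ}
    (hx : R < ‖x‖) : fderiv ℝ ψ x ≠ 0 := by
  intro h
  have h1 := hB.fderiv_eq x 1 one_pos (by rwa [one_smul])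
  rw [one_smul, one_smul, h] at h1
  have hx0 : 0 < ‖x‖ := hB.R_pos.trans hx
  have h2 := hB.le_fderiv_model_self (norm_pos_iff.1 hx0)
  rw [← h1, zero_apply] at h2
  have h3 : 0 < c * ‖x‖ ^ 2 := mul_pos hB.c_pos (pow_pos hx0 2)
  linarith

/-- For large `L`, uniformly in `s`, the perturbation of the differential is small at every zero, and
every zero is either far from critical or in a region where the cut-off functions are constant. -/
lemma eventually_isGoodZero (hA : IsCentralTriangulation A ν) (hB : PotentialBounds ψ φ c C R)
    {G : Matrix (Fin k) (Fin k) ℝ} {ε₁ ε₂ : ℝ} (hε : 0 < ε₁)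
    (hχ : IsCutoffFamily A ν G ε₁ ε₂ χ) {M : ℝ}
    (hM : ∀ a ∈ A, ∀ p, ‖fderiv ℝ (χ a) p‖ ≤ M) {κ e ϱ ι : ℝ} (hκ : 0 < κ)
    (hι : ∀ σ, IsCentral A ν σ → ∀ u, ‖u - X σ‖ < ϱ → (∀ a ∈ σ, NearMax A ν ι u a) →
      ∀ᶠ u' in 𝓝 u, (∀ a ∈ σ, χ a u' = 1) ∧ ∀ b ∈ A, b ∉ σ → χ b u' = 0)
    (he : ∀ᶠ L in Filter.atTop, ∀ u m, Balanced A ν L u m → ∀ μ : ℂ,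
      ‖covec (fderiv ℝ ψ (L • u)) - μ • momentVec A m‖ ≤ e * ‖fderiv ℝ ψ (L • u)‖ →
      ∃ σ, IsCentral A ν σ ∧ ‖u - X σ‖ < ϱ ∧
        (∀ a ∈ σ, |(μ * m a).re - L * S σ a| ≤ ϱ * L) ∧ ∀ a ∈ σ, NearMax A ν ι u a) :
    ∀ᶠ L in Filter.atTop, ∀ s ∈ Set.Icc (0 : ℝ) 1,
      ∀ z ∈ zeroSet (tailoredFun A ν χ (Real.exp L) s), IsGoodZero A ν χ ψ S κ e ϱ L s z := by
  obtain ⟨K, hK, hKev⟩ := exists_le_norm_momentVec hA R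
  have hM0 : 0 ≤ M := (norm_nonneg _).trans (hM 0 hA.zero_mem 0)
  have hlarge : ∀ᶠ L : ℝ in Filter.atTop, A.card * M * K / κ ≤ L := Filter.eventually_ge_atTop _
  filter_upwards [hKev, he, hlarge, Filter.eventually_gt_atTop 0] with L hLK hLe hLl hL s hs z hz
  have hbal := balanced_logTerm hε hχ hs hL hz
  have hsm : L • L⁻¹ • Log z = Log z := by rw [smul_smul, mul_inv_cancel₀ hL.ne', one_smul]
  obtain ⟨h1, h2⟩ := hLK _ _ hbal
  rw [hsm] at h2
  set q := momentVec A (logTerm ν χ L s (logC z)) with hq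
  refine ⟨fun h0 => ?_, fun ξ => ?_, hB.fderiv_ne_zero h2, fun μ hμ => ?_⟩
  · have h3 := h1 0 hA.zero_mem
    rw [hq, h0, norm_zero, mul_zero] at h3
    exact absurd h3 (not_le.2 (Real.exp_pos _))
  · refine (Tailored.norm_cutDeriv_le hs hL hM0 hM (logC z) (B := K * ‖q‖)
      (by rw [rePart_logC]; exact h1) ξ).trans ?_
    have h3 : A.card * M * K ≤ κ * L := by rw [div_le_iff₀ hκ] at hLl; linarith
    calc A.card * M * L⁻¹ * (K * ‖q‖) * ‖ξ‖ = A.card * M * K * (L⁻¹ * ‖q‖ * ‖ξ‖) := by ring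
      _ ≤ κ * L * (L⁻¹ * ‖q‖ * ‖ξ‖) := by gcongr
      _ = κ * ‖q‖ * ‖ξ‖ := by field_simp
  · obtain ⟨σ, hσ, hd, hco, hnear⟩ := hLe _ _ hbal μ (by rwa [hsm])
    exact ⟨σ, hσ, hco, hι σ hσ _ hd hnear⟩

lemma cutDeriv_eq_zero {z : Fin k → ℂ} {σ : Finset (Fin k → ℤ)}
    (h : ∀ᶠ u in 𝓝 (L⁻¹ • Log z), (∀ a ∈ σ, χ a u = 1) ∧ ∀ b ∈ A, b ∉ σ → χ b u = 0) :
    cutDeriv A ν χ L s (logC z) = 0 := by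
  refine Finset.sum_eq_zero fun a ha => ?_
  have h1 : fderiv ℝ (χ a) (L⁻¹ • rePart (logC z)) = 0 := by
    rw [rePart_logC]
    by_cases haσ : a ∈ σ
    · have : χ a =ᶠ[𝓝 (L⁻¹ • Log z)] fun _ => (1 : ℝ) := by
        filter_upwards [h] with u hu using hu.1 a haσ
      rw [this.fderiv_eq, fderiv_fun_const, Pi.zero_apply]
    · have : χ a =ᶠ[𝓝 (L⁻¹ • Log z)] fun _ => (0 : ℝ) := by
        filter_upwards [h] with u hu using hu.2 a ha haσ
      rw [this.fderiv_eq, fderiv_fun_const, Pi.zero_apply]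
  rw [h1, ContinuousLinearMap.zero_comp, ContinuousLinearMap.comp_zero]
  ext ξ
  rw [smul_apply, zero_apply, smul_zero]

lemma mem_tangent_iff (hχ : ∀ a ∈ A, ContDiff ℝ ∞ (χ a)) {z : Fin k → ℂ} (hz : z ∈ torus k)
    (Y : Fin k → ℂ) :
    Y ∈ tangent (tailoredFun A ν χ (Real.exp L) s) z ↔
      pertForm (momentVec A (logTerm ν χ L s (logC z))) (cutDeriv A ν χ L s (logC z)) (Y / z) =
        0 := by
  rw [← fderiv_tailoredFun hχ hz]
  rfl

lemma div_mul_cancel_torus {z : Fin k → ℂ} (hz : z ∈ torus k) (ξ : Fin k → ℂ) : ξ * z / z = ξ := by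
  ext i
  simp [mul_div_cancel_right₀ _ (hz i)]

lemma isSymplecticHypersurface_tailoredFun (hχ : ∀ a ∈ A, ContDiff ℝ ∞ (χ a))
    (hB : PotentialBounds ψ φ c C R) {κ e ϱ : ℝ} (hκ : κ ≤ 1 / 2) (hκ' : 32 * C * κ ≤ c)
    (hgood : ∀ z ∈ zeroSet (tailoredFun A ν χ (Real.exp L) s),
      IsGoodZero A ν χ ψ S κ e ϱ L s z) :
    IsSymplecticHypersurface ψ (tailoredFun A ν χ (Real.exp L) s) where
  smooth := contDiffOn_tailoredFun hχ _ _
  regular z hz y := by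
    have h := hgood z hz
    obtain ⟨D, hD, -⟩ := exists_pertForm_eq h.momentVec_ne_zero hκ h.norm_cutDeriv_le y
    exact ⟨D * z, by rw [fderiv_tailoredFun hχ hz.1, div_mul_cancel_torus hz.1, hD]⟩
  nondegenerate z hz Y hY hYY := by
    have h := hgood z hz
    rw [mem_tangent_iff hχ hz.1] at hY
    have h0 := omForm_nondegenerate hB.c_pos hB.C_pos (hB.pinched (Log z)) h.momentVec_ne_zero hκ
      hκ' h.norm_cutDeriv_le hY fun ζ hζ => by
        have h1 := hYY (ζ * z) (by rwa [mem_tangent_iff hχ hz.1, div_mul_cancel_torus hz.1])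
        rwa [symplecticForm_eq, div_mul_cancel_torus hz.1] at h1
    ext i
    have h2 := congrFun h0 i
    rw [Pi.div_apply, Pi.zero_apply, div_eq_zero_iff] at h2
    exact h2.resolve_right (hz.1 i)

/-- Either the orthogonal projection of `dψ` to the kernel of the derivative is a tangent vector
along which `ψ` increases fast, or the zero is nearly critical, and then the tailored function is
holomorphic near it. -/
lemma IsGoodZero.dichotomy {κ e ϱ : ℝ} {z : Fin k → ℂ} (he : 0 < e)
    (h : IsGoodZero A ν χ ψ S κ e ϱ L s z) :
    cutDeriv A ν χ L s (logC z) = 0 ∨ ∃ X₀, X₀ ≠ 0 ∧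
      ∑ i, momentVec A (logTerm ν χ L s (logC z)) i * X₀ i = 0 ∧
      e * ‖fderiv ℝ ψ (Log z)‖ * ‖X₀‖ ≤ fderiv ℝ ψ (Log z) (rePart X₀) := by
  obtain ⟨μ, X₀, h1, h2, h3⟩ := exists_projection (fderiv ℝ ψ (Log z)) h.momentVec_ne_zero
  by_cases hsm : ‖X₀‖ ≤ e * ‖fderiv ℝ ψ (Log z)‖
  · obtain ⟨σ, -, -, hσ⟩ := h.near μ (by rwa [h3])
    exact Or.inl (cutDeriv_eq_zero hσ)
  · push Not at hsm
    have hp : 0 < e * ‖fderiv ℝ ψ (Log z)‖ := mul_pos he (norm_pos_iff.2 h.fderiv_ne_zero)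
    refine Or.inr ⟨X₀, norm_pos_iff.1 (hp.trans hsm), h1, le_trans ?_ h2⟩
    rw [sq]
    exact mul_le_mul_of_nonneg_right hsm.le (norm_nonneg _)

/-- The uniform inequality of `exists_gradientLike_const` applies at every zero: either the
perturbation vanishes there, or the projection of `dψ` to the kernel of the complex linear part
is not small. -/
lemma isGradientLike_tailoredFun (hχ : ∀ a ∈ A, ContDiff ℝ ∞ (χ a))
    (hB : PotentialBounds ψ φ c C R) {κ e ϱ δ : ℝ} (he : 0 < e) (hδ : 0 < δ)
    (hconst : ∀ {B : (Fin k → ℝ) →L[ℝ] (Fin k → ℝ) →L[ℝ] ℝ}, Pinched c C B →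
      ∀ (p : (Fin k → ℝ) →L[ℝ] ℝ) {q : Fin k → ℂ}, q ≠ 0 → ∀ β : (Fin k → ℂ) →L[ℝ] ℂ,
      (∀ ξ, ‖β ξ‖ ≤ κ * ‖q‖ * ‖ξ‖) →
      (β = 0 ∨ ∃ X₀, X₀ ≠ 0 ∧ ∑ i, q i * X₀ i = 0 ∧ e * ‖p‖ * ‖X₀‖ ≤ p (rePart X₀)) →
      ∀ Z, pertForm q β Z = 0 → (∀ X, pertForm q β X = 0 → omForm B Z X = p (imPart X)) →
      ∀ X, pertForm q β X = 0 → gForm B X X ≤ 1 →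
        δ * (p (rePart X) ^ 2 + gForm B Z Z) ≤ p (rePart Z))
    (hgood : ∀ z ∈ zeroSet (tailoredFun A ν χ (Real.exp L) s),
      IsGoodZero A ν χ ψ S κ e ϱ L s z) :
    IsGradientLike ψ (tailoredFun A ν χ (Real.exp L) s) := by
  refine ⟨δ, hδ, fun z hz Z ⟨hZ, hZX⟩ => ?_⟩
  have h := hgood z hz
  rw [mem_tangent_iff hχ hz.1] at hZ
  have key := hconst (hB.pinched (Log z)) (fderiv ℝ ψ (Log z)) h.momentVec_ne_zero _
    h.norm_cutDeriv_le (h.dichotomy he) (Z / z) hZ fun ζ hζ => by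
      have h1 := hZX (ζ * z) (by rwa [mem_tangent_iff hχ hz.1, div_mul_cancel_torus hz.1])
      rwa [symplecticForm_eq, liouvilleForm_eq, div_mul_cancel_torus hz.1] at h1
  rw [fderiv_torusPotential hB.smooth hz.1, kahlerMetric_eq]
  have h2 : restrictedCovectorNormSq ψ (tailoredFun A ν χ (Real.exp L) s) z ≤
      fderiv ℝ ψ (Log z) (rePart (Z / z)) / δ -
        gForm (fderiv ℝ (fderiv ℝ ψ) (Log z)) (Z / z) (Z / z) := by
    refine csSup_le ⟨_, 0, Submodule.zero_mem _, ?_, rfl⟩ ?_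
    · rw [kahlerMetric_eq, show (0 : Fin k → ℂ) / z = 0 from funext fun i => zero_div _]; simp [gForm]
    · rintro _ ⟨Y, hY, hY1, rfl⟩
      rw [mem_tangent_iff hχ hz.1] at hY
      rw [kahlerMetric_eq] at hY1
      have h3 := key (Y / z) hY hY1
      rw [fderiv_torusPotential hB.smooth hz.1, le_sub_iff_add_le, le_div_iff₀ hδ]
      linarith
  rw [le_sub_iff_add_le, le_div_iff₀ hδ] at h2
  linarith

end

/-! ### Critical points -/

section

variable {k : ℕ}

/-- The term with exponent `a` of the tailored function with `t = exp L`, without its cut-off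
factor. -/
def monoTerm (ν : (Fin k → ℤ) → ℝ) (L : ℝ) (z : Fin k → ℂ) (a : Fin k → ℤ) : ℂ :=
  ((coeff a * Real.exp (-(L * ν a)) : ℝ) : ℂ) * ∏ i, z i ^ a i

/-- `z` is a critical point at which exactly the terms that belong to the face `σ` are present.
The numbers `r a` are the products of these terms with the Lagrange multiplier `-r 0`. -/
structure CriticalData (A : Finset (Fin k → ℤ)) (ν : (Fin k → ℤ) → ℝ)
    (χ : (Fin k → ℤ) → (Fin k → ℝ) → ℝ) (ψ : (Fin k → ℝ) → ℝ) (s₀ L : ℝ)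
    (σ : Finset (Fin k → ℤ)) (r : (Fin k → ℤ) → ℝ) (z : Fin k → ℂ) : Prop where
  mem_torus : z ∈ torus k
  central : IsCentral A ν σ
  cut : ∀ᶠ u in 𝓝 (L⁻¹ • Log z), (∀ a ∈ σ, χ a u = 1) ∧ ∀ b ∈ A, b ∉ σ → χ b u = 0
  fderiv_eq : fderiv ℝ ψ (Log z) = ∑ a ∈ σ, r a • pairing a
  sum_eq : ∑ a ∈ σ, r a = 0
  le : ∀ a ∈ σ, a ≠ 0 → s₀ * L ≤ r a
  le_zero : s₀ * L ≤ -r 0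
  term : ∀ a ∈ σ, (r a : ℂ) = ((-r 0 : ℝ) : ℂ) * monoTerm ν L z a

variable {A : Finset (Fin k → ℤ)} {ν : (Fin k → ℤ) → ℝ} {ψ φ : (Fin k → ℝ) → ℝ}
  {χ : (Fin k → ℤ) → (Fin k → ℝ) → ℝ} {L : ℝ} {σ : Finset (Fin k → ℤ)} {z : Fin k → ℂ}
  {c C R : ℝ} {X : Finset (Fin k → ℤ) → Fin k → ℝ} {S : Finset (Fin k → ℤ) → (Fin k → ℤ) → ℝ}

lemma prod_zpow_eq_exp (hz : z ∈ torus k) (a : Fin k → ℤ) :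
    ∏ i, z i ^ a i = Complex.exp (cpairing a (logC z)) := by
  rw [← prod_expC_zpow, expC_logC hz]

lemma prod_zpow_ne_zero (hz : z ∈ torus k) (a : Fin k → ℤ) : ∏ i, z i ^ a i ≠ 0 := by
  rw [prod_zpow_eq_exp hz]; exact Complex.exp_ne_zero _

lemma norm_prod_zpow (hz : z ∈ torus k) (a : Fin k → ℤ) :
    ‖∏ i, z i ^ a i‖ = Real.exp (pairing a (Log z)) := by
  rw [prod_zpow_eq_exp hz, Complex.norm_exp, cpairing_re, rePart_logC]

lemma monoTerm_zero (h : ν 0 = 0) : monoTerm ν L z 0 = -1 := by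
  simp [monoTerm, coeff, h]

lemma sum_logTerm_mul (hz : z ∈ torus k) (hσ : σ ⊆ A)
    (hcut : (∀ a ∈ σ, χ a (L⁻¹ • Log z) = 1) ∧ ∀ b ∈ A, b ∉ σ → χ b (L⁻¹ • Log z) = 0)
    (g : (Fin k → ℤ) → ℂ) :
    ∑ a ∈ A, logTerm ν χ L 1 (logC z) a * g a = ∑ a ∈ σ, monoTerm ν L z a * g a := by
  refine (Finset.sum_subset_zero_on_sdiff hσ (fun b hb => ?_) fun a ha => ?_).symm
  · rw [Finset.mem_sdiff] at hb
    simp [logTerm, cutFactor, rePart_logC, hcut.2 b hb.1 hb.2]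
  · simp [logTerm, cutFactor, rePart_logC, hcut.1 a ha, monoTerm, prod_zpow_eq_exp hz]

lemma sum_logTerm (hz : z ∈ torus k) (hσ : σ ⊆ A)
    (hcut : (∀ a ∈ σ, χ a (L⁻¹ • Log z) = 1) ∧ ∀ b ∈ A, b ∉ σ → χ b (L⁻¹ • Log z) = 0) :
    ∑ a ∈ A, logTerm ν χ L 1 (logC z) a = ∑ a ∈ σ, monoTerm ν L z a := by
  simpa using sum_logTerm_mul (ν := ν) hz hσ hcut fun _ => 1

lemma sum_mul_latticePt (r : (Fin k → ℤ) → ℝ) (i : Fin k) :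
    (∑ a ∈ σ, r a • latticePt a) i = ∑ a ∈ σ, r a * (a i : ℝ) := by
  simp [latticePt, Finset.sum_apply]

/-- Near a critical point the tailored function is an exponential sum over a face, and `dψ` is
a positive multiple of the real part of its derivative. -/
lemma exists_criticalData (hA : IsCentralTriangulation A ν) (hχ : ∀ a ∈ A, ContDiff ℝ ∞ (χ a))
    (hB : PotentialBounds ψ φ c C R) (hX : FaceMinima A ν φ X S) {κ e ϱ s₀ : ℝ}
    (hκ : κ ≤ 1 / 2) (hκe : 2 * κ ≤ e) (hL : 0 < L)
    (hs : ∀ σ, IsCentral A ν σ → ∀ a ∈ σ, 2 * s₀ ≤ |S σ a|) (hϱ : ϱ ≤ s₀)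
    (hz : z ∈ criticalSet ψ (tailoredFun A ν χ (Real.exp L) 1))
    (h : IsGoodZero A ν χ ψ S κ e ϱ L 1 z) :
    ∃ σ r, CriticalData A ν χ ψ s₀ L σ r z := by
  have hzt : z ∈ torus k := hz.1.1
  set p := fderiv ℝ ψ (Log z) with hp
  set m := logTerm ν χ L 1 (logC z) with hm
  set q := momentVec A m with hq
  set β := cutDeriv A ν χ L 1 (logC z) with hβ
  have hcrit : ∀ ξ, pertForm q β ξ = 0 → p (rePart ξ) = 0 := fun ξ hξ => by
    have h1 := hz.2 (ξ * z) (by rwa [mem_tangent_iff hχ hzt, div_mul_cancel_torus hzt])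
    rwa [fderiv_torusPotential hB.smooth hzt, div_mul_cancel_torus hzt] at h1
  obtain ⟨μ, X₀, h1, h2, h3⟩ := exists_projection p h.momentVec_ne_zero
  have hq0 : 0 < ‖q‖ := norm_pos_iff.2 h.momentVec_ne_zero
  -- `X₀` is close to a tangent vector, on which `dψ` vanishes
  have hX₀ : ‖X₀‖ ≤ e * ‖p‖ := by
    obtain ⟨Y, hY, hYX⟩ := exists_mem_ker_pertForm h.momentVec_ne_zero hκ h.norm_cutDeriv_le X₀
    have h4 : pertForm q β X₀ = β X₀ := by rw [pertForm, h1, zero_add]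
    have h5 : ‖Y - X₀‖ ≤ 2 * κ * ‖X₀‖ := by
      refine hYX.trans ?_
      rw [h4]
      calc 2 / ‖q‖ * ‖β X₀‖ ≤ 2 / ‖q‖ * (κ * ‖q‖ * ‖X₀‖) := by
            gcongr; exact h.norm_cutDeriv_le X₀
        _ = _ := by field_simp
    have h6 : p (rePart X₀) ≤ ‖p‖ * (2 * κ * ‖X₀‖) := by
      have h7 : p (rePart X₀) = -p (rePart (Y - X₀)) := by
        rw [map_sub, map_sub, hcrit Y hY]; ring
      rw [h7]
      refine (neg_le_abs _).trans ((p.le_opNorm _).trans ?_)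
      gcongr
      exact (norm_rePart_le _).trans h5
    rcases (norm_nonneg X₀).eq_or_lt with h0 | h0
    · rw [← h0]
      have := norm_nonneg p
      have hκ0 : 0 ≤ κ := by
        by_contra hneg
        have h8 := (norm_nonneg _).trans (h.norm_cutDeriv_le q)
        have h9 : κ * ‖q‖ * ‖q‖ < 0 :=
          mul_neg_of_neg_of_pos (mul_neg_of_neg_of_pos (not_le.1 hneg) hq0) hq0
        linarith
      have : 0 ≤ e := by linarith
      positivity
    · have h8 : ‖X₀‖ * ‖X₀‖ ≤ (2 * κ * ‖p‖) * ‖X₀‖ := by linarith [sq ‖X₀‖]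
      exact (le_of_mul_le_mul_right h8 h0).trans
        (mul_le_mul_of_nonneg_right hκe (norm_nonneg _))
  obtain ⟨σ, hσ, hco, hcut⟩ := h.near μ (by rw [h3]; exact hX₀)
  have hβ0 : β = 0 := cutDeriv_eq_zero hcut
  have hX₀0 : ‖X₀‖ ^ 2 ≤ 0 := by
    refine h2.trans (hcrit X₀ ?_).le
    rw [pertForm, h1, hβ0, zero_apply, zero_add]
  have hcov : covec p = μ • q := by
    rw [← sub_eq_zero, ← norm_eq_zero, h3]
    exact pow_eq_zero_iff two_ne_zero |>.1 (le_antisymm hX₀0 (sq_nonneg _))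
  have hcut0 := hcut.self_of_nhds
  have hcoord : ∀ i, (p (Pi.single i 1) : ℂ) = ∑ a ∈ σ, μ * monoTerm ν L z a * ((a i : ℝ) : ℂ) := by
    intro i
    have h4 := congrFun hcov i
    rw [covec, Pi.smul_apply, smul_eq_mul, hq, momentVec, hm,
      sum_logTerm_mul hzt hσ.1.2.1 hcut0, Finset.mul_sum] at h4
    rw [h4]
    exact Finset.sum_congr rfl fun a _ => by rw [Complex.ofReal_intCast, mul_assoc]
  have hsum : ∑ a ∈ σ, μ * monoTerm ν L z a = 0 := by
    rw [← Finset.mul_sum, ← sum_logTerm hzt hσ.1.2.1 hcut0, sum_logTerm_eq_zero hz.1, mul_zero]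
  set r : (Fin k → ℤ) → ℝ := fun a => (μ * monoTerm ν L z a).re with hr
  -- the imaginary parts form a linear relation between the vertices of a simplex
  have him : ∀ a ∈ σ, (μ * monoTerm ν L z a).im = 0 := by
    refine hA.indep σ hσ.1 _ ?_ ?_
    · ext i
      rw [sum_mul_latticePt]
      have h4 := congrArg Complex.im (hcoord i)
      rw [Complex.ofReal_im, Complex.im_sum] at h4
      rw [Pi.zero_apply, h4]
      exact Finset.sum_congr rfl fun a _ => (Complex.im_mul_ofReal _ _).symm
    · rw [← Complex.im_sum, hsum, Complex.zero_im]
  have hreal : ∀ a ∈ σ, (r a : ℂ) = μ * monoTerm ν L z a := fun a ha =>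
    Complex.ext (by simp [hr]) (by rw [him a ha, Complex.ofReal_im])
  -- the term of exponent zero is `-1`
  have hμ : μ = ((-r 0 : ℝ) : ℂ) := by
    rw [Complex.ofReal_neg, hreal 0 hσ.2.1, monoTerm_zero hA.nu_zero]; ring
  have hrm : ∀ a ∈ σ, |r a - L * S σ a| ≤ ϱ * L := fun a ha => by
    have h4 := hco a ha
    have h5 : logTerm ν χ L 1 (logC z) a = monoTerm ν L z a := by
      simp [logTerm, cutFactor, rePart_logC, hcut0.1 a ha, monoTerm, prod_zpow_eq_exp hzt]
    rwa [h5] at h4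
  have hmin := hX.isFaceMin σ hσ
  have hϱL : ϱ * L ≤ s₀ * L := mul_le_mul_of_nonneg_right hϱ hL.le
  refine ⟨σ, r, hzt, hσ, hcut, ?_, ?_, fun a ha ha0 => ?_, ?_, fun a ha => by
    rw [← hμ]; exact hreal a ha⟩
  · ext v
    rw [apply_eq_sum, apply_eq_sum (∑ a ∈ σ, r a • pairing a)]
    refine Finset.sum_congr rfl fun i _ => ?_
    have h4 := congrArg Complex.re (hcoord i)
    rw [Complex.ofReal_re, Complex.re_sum] at h4
    rw [sum_apply, ← hp, h4]
    congr 1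
    refine Finset.sum_congr rfl fun a _ => ?_
    rw [smul_apply, pairing_single, smul_eq_mul, Complex.re_mul_ofReal]
  · rw [hr, ← Complex.re_sum, hsum, Complex.zero_re]
  · have h4 := hs σ hσ a ha
    rw [abs_of_pos (hmin.pos a ha ha0)] at h4
    have h5 := (abs_le.1 (hrm a ha)).1
    have h6 : L * (2 * s₀) ≤ L * S σ a := mul_le_mul_of_nonneg_left h4 hL.le
    linarith
  · have h4 := hs σ hσ 0 hσ.2.1
    rw [abs_of_neg hmin.neg] at h4
    have h5 := (abs_le.1 (hrm 0 hσ.2.1)).2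
    have h6 : L * (2 * s₀) ≤ L * (-S σ 0) := mul_le_mul_of_nonneg_left h4 hL.le
    linarith

variable {s₀ : ℝ} {r r' : (Fin k → ℤ) → ℝ} {z' : Fin k → ℂ}

lemma CriticalData.neg_pos (h : CriticalData A ν χ ψ s₀ L σ r z) (hs : 0 < s₀) (hL : 0 < L) :
    0 < -r 0 :=
  (mul_pos hs hL).trans_le h.le_zero

lemma CriticalData.sum_monoTerm (h : CriticalData A ν χ ψ s₀ L σ r z) (hs : 0 < s₀) (hL : 0 < L) :
    ∑ a ∈ σ, monoTerm ν L z a = 0 := by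
  have h1 : ((-r 0 : ℝ) : ℂ) ≠ 0 := Complex.ofReal_ne_zero.2 (h.neg_pos hs hL).ne'
  refine (mul_eq_zero.1 ?_).resolve_left h1
  rw [Finset.mul_sum, ← Finset.sum_congr rfl h.term, ← Complex.ofReal_sum, h.sum_eq,
    Complex.ofReal_zero]

lemma CriticalData.mem_tangent_iff (h : CriticalData A ν χ ψ s₀ L σ r z) (hs : 0 < s₀)
    (hL : 0 < L) (hχ : ∀ a ∈ A, ContDiff ℝ ∞ (χ a)) (Y : Fin k → ℂ) :
    Y ∈ tangent (tailoredFun A ν χ (Real.exp L) 1) z ↔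
      ∑ a ∈ σ, (r a : ℂ) * cpairing a (Y / z) = 0 := by
  have h1 : ((-r 0 : ℝ) : ℂ) ≠ 0 := Complex.ofReal_ne_zero.2 (h.neg_pos hs hL).ne'
  have h2 : ∑ a ∈ σ, (r a : ℂ) * cpairing a (Y / z) =
      ((-r 0 : ℝ) : ℂ) * ∑ a ∈ σ, monoTerm ν L z a * cpairing a (Y / z) := by
    rw [Finset.mul_sum]
    exact Finset.sum_congr rfl fun a ha => by rw [h.term a ha, mul_assoc]
  rw [Tailored.mem_tangent_iff hχ h.mem_torus, pertForm_momentVec, cutDeriv_eq_zero h.cut,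
    zero_apply, add_zero, sum_logTerm_mul h.mem_torus h.central.1.2.1 h.cut.self_of_nhds, h2,
    mul_eq_zero]
  simp only [h1, false_or]

lemma re_sum_mul_cpairing (r : (Fin k → ℤ) → ℝ) (ξ : Fin k → ℂ) :
    (∑ a ∈ σ, (r a : ℂ) * cpairing a ξ).re = (∑ a ∈ σ, r a • pairing a) (rePart ξ) := by
  rw [Complex.re_sum, sum_apply]
  exact Finset.sum_congr rfl fun a _ => by
    rw [Complex.re_ofReal_mul, cpairing_re, smul_apply, smul_eq_mul]

lemma im_sum_mul_cpairing (r : (Fin k → ℤ) → ℝ) (ξ : Fin k → ℂ) :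
    (∑ a ∈ σ, (r a : ℂ) * cpairing a ξ).im = (∑ a ∈ σ, r a • pairing a) (imPart ξ) := by
  rw [Complex.im_sum, sum_apply]
  exact Finset.sum_congr rfl fun a _ => by
    rw [Complex.im_ofReal_mul, cpairing_im, smul_apply, smul_eq_mul]

lemma CriticalData.mem_criticalSet (h : CriticalData A ν χ ψ s₀ L σ r z) (hs : 0 < s₀)
    (hL : 0 < L) (hχ : ∀ a ∈ A, ContDiff ℝ ∞ (χ a)) (hψ : ContDiff ℝ ∞ ψ) :
    z ∈ criticalSet ψ (tailoredFun A ν χ (Real.exp L) 1) := by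
  refine ⟨⟨h.mem_torus, ?_⟩, fun Y hY => ?_⟩
  · rw [← expC_logC h.mem_torus, tailoredFun_expC,
      sum_logTerm h.mem_torus h.central.1.2.1 h.cut.self_of_nhds, h.sum_monoTerm hs hL]
  · rw [h.mem_tangent_iff hs hL hχ] at hY
    rw [fderiv_torusPotential hψ h.mem_torus, h.fderiv_eq, ← re_sum_mul_cpairing, hY,
      Complex.zero_re]

lemma CriticalData.log_eq (h : CriticalData A ν χ ψ s₀ L σ r z) (hs : 0 < s₀) (hL : 0 < L)
    {a : Fin k → ℤ} (ha : a ∈ σ) (ha0 : a ≠ 0) :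
    Real.log (r a) = Real.log (-r 0) - L * ν a + pairing a (Log z) := by
  have h1 : 0 < r a := (mul_pos hs hL).trans_le (h.le a ha ha0)
  have h2 := congrArg norm (h.term a ha)
  rw [monoTerm, norm_mul, norm_mul, norm_prod_zpow h.mem_torus, Complex.norm_real,
    Complex.norm_real, Complex.norm_real, Real.norm_of_nonneg h1.le,
    Real.norm_of_nonneg (h.neg_pos hs hL).le, norm_mul, Real.norm_eq_abs (coeff a), abs_coeff,
    one_mul, Real.norm_of_nonneg (Real.exp_pos _).le, ← Real.exp_add] at h2
  rw [h2, Real.log_mul (h.neg_pos hs hL).ne' (Real.exp_pos _).ne', Real.log_exp]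
  ring

lemma abs_log_sub_log_le {x y b : ℝ} (hb : 0 < b) (hx : b ≤ x) (hy : b ≤ y) :
    |Real.log x - Real.log y| ≤ |x - y| / b := by
  have key : ∀ x y : ℝ, b ≤ x → b ≤ y → Real.log x - Real.log y ≤ |x - y| / b := by
    intro x y hx hy
    have hx0 := hb.trans_le hx
    have hy0 := hb.trans_le hy
    rw [← Real.log_div hx0.ne' hy0.ne']
    calc Real.log (x / y) ≤ x / y - 1 := Real.log_le_sub_one_of_pos (div_pos hx0 hy0)
      _ = (x - y) / y := by field_simp
      _ ≤ |x - y| / y := by gcongr; exact le_abs_self _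
      _ ≤ |x - y| / b := by gcongr
  rw [abs_le]
  have h1 := key x y hx hy
  have h2 := key y x hy hx
  rw [abs_sub_comm y x] at h2
  constructor <;> linarith

/-- For large parameters, all critical points that belong to the same face have the same
absolute values: the multipliers depend on `dψ`, hence on `Log z`, in a Lipschitz way, and their
logarithms, which determine the pairings with `Log z`, vary less by a factor of order `L`. -/
lemma exists_Log_eq (hA : IsCentralTriangulation A ν) (hB : PotentialBounds ψ φ c C R)
    (hs : 0 < s₀) :
    ∃ L₀, ∀ L, L₀ < L → 0 < L → ∀ χ σ r r' z z', CriticalData A ν χ ψ s₀ L σ r z →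
      CriticalData A ν χ ψ s₀ L σ r' z' → Log z = Log z' := by
  obtain ⟨K, hK, hKb⟩ := exists_coeff_bound hA
  have hc := hB.c_pos
  have hC := hB.C_pos
  refine ⟨2 * (A.card * (K * C) ^ 2) / (c * s₀), fun L hL₀ hL χ σ r r' z z' h h' => ?_⟩
  set d := Log z - Log z' with hd
  have hsL : 0 < s₀ * L := mul_pos hs hL
  -- the multipliers are Lipschitz functions of `Log z`
  have hr : ∀ a ∈ σ, |r a - r' a| ≤ K * C * ‖d‖ := fun a ha => by
    have h1 := hKb σ h.central.1 (fun a => r a - r' a) a ha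
    have h2 : ∑ a ∈ σ, (r a - r' a) • pairing a = fderiv ℝ ψ (Log z) - fderiv ℝ ψ (Log z') := by
      rw [h.fderiv_eq, h'.fderiv_eq, ← Finset.sum_sub_distrib]
      exact Finset.sum_congr rfl fun a _ => sub_smul (r a) (r' a) (pairing a)
    rw [Finset.sum_sub_distrib, h.sum_eq, h'.sum_eq, sub_zero, abs_zero, add_zero, h2] at h1
    calc _ ≤ _ := h1
      _ ≤ K * (C * ‖d‖) := by gcongr; exact hB.lipschitz _ _
      _ = _ := by ring
  -- the pairings with `Log z` are differences of logarithms of multipliers of order `L`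
  have hlog : ∀ a ∈ σ, a ≠ 0 → |pairing a d| ≤ 2 * (K * C * ‖d‖) / (s₀ * L) := by
    intro a ha ha0
    have h1 := abs_log_sub_log_le hsL (h.le a ha ha0) (h'.le a ha ha0)
    have h2 := abs_log_sub_log_le hsL h.le_zero h'.le_zero
    have h3 : pairing a d = (Real.log (r a) - Real.log (r' a)) -
        (Real.log (-r 0) - Real.log (-r' 0)) := by
      rw [hd, map_sub, h.log_eq hs hL ha ha0, h'.log_eq hs hL ha ha0]; ring
    have h4 : |-r 0 - -r' 0| = |r 0 - r' 0| := by rw [← abs_neg]; congr 1; ring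
    rw [h4] at h2
    rw [h3]
    calc _ ≤ _ := abs_sub _ _
      _ ≤ |r a - r' a| / (s₀ * L) + |r 0 - r' 0| / (s₀ * L) := add_le_add h1 h2
      _ ≤ K * C * ‖d‖ / (s₀ * L) + K * C * ‖d‖ / (s₀ * L) := by
        gcongr
        · exact hr a ha
        · exact hr 0 h.central.2.1
      _ = _ := by ring
  -- strong monotonicity of `dψ` bounds `‖d‖ ^ 2` by itself times a constant of order `1 / L`
  have h1 : c * ‖d‖ ^ 2 ≤ A.card * (2 * (K * C) ^ 2 / (s₀ * L) * ‖d‖ ^ 2) := by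
    have h2 : (fderiv ℝ ψ (Log z) - fderiv ℝ ψ (Log z')) d =
        ∑ a ∈ σ, (r a - r' a) * pairing a d := by
      rw [h.fderiv_eq, h'.fderiv_eq, sub_apply, sum_apply, sum_apply, ← Finset.sum_sub_distrib]
      exact Finset.sum_congr rfl fun a _ => by rw [smul_apply, smul_apply, smul_eq_mul,
        smul_eq_mul, sub_mul]
    have h3 : ∀ a ∈ σ, (r a - r' a) * pairing a d ≤ 2 * (K * C) ^ 2 / (s₀ * L) * ‖d‖ ^ 2 := by
      intro a ha
      by_cases ha0 : a = 0
      · rw [ha0, pairing_zero, zero_apply, mul_zero]; positivity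
      · refine (le_abs_self _).trans ?_
        rw [abs_mul]
        calc _ ≤ K * C * ‖d‖ * (2 * (K * C * ‖d‖) / (s₀ * L)) :=
              mul_le_mul (hr a ha) (hlog a ha ha0) (abs_nonneg _) (by positivity)
          _ = _ := by ring
    refine (hB.mono (Log z) (Log z')).trans ?_
    rw [← hd, h2]
    refine (Finset.sum_le_sum h3).trans ?_
    rw [Finset.sum_const, nsmul_eq_mul]
    have h4 : σ.card ≤ A.card := Finset.card_le_card h.central.1.2.1
    gcongr
  have h2 : A.card * (2 * (K * C) ^ 2 / (s₀ * L)) < c := by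
    rw [div_lt_iff₀ (by positivity)] at hL₀
    rw [mul_div_assoc', div_lt_iff₀ hsL]
    linarith
  rw [← sub_eq_zero, ← hd, ← norm_eq_zero]
  by_contra hne
  have h3 : 0 < ‖d‖ ^ 2 := by positivity
  have h4 : A.card * (2 * (K * C) ^ 2 / (s₀ * L)) * ‖d‖ ^ 2 < c * ‖d‖ ^ 2 :=
    mul_lt_mul_of_pos_right h2 h3
  linarith

/-- The critical points that belong to a given face form a coset of a closed subgroup of a
compact torus. -/
lemma CriticalData.exists_iff (hA : IsCentralTriangulation A ν)
    (h : CriticalData A ν χ ψ s₀ L σ r z) (hs : 0 < s₀) (hL : 0 < L)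
    (huniq : ∀ r' z', CriticalData A ν χ ψ s₀ L σ r' z' → Log z' = Log z) :
    (∃ r', CriticalData A ν χ ψ s₀ L σ r' z') ↔
      z' ∈ torus k ∧ Log z' = Log z ∧ ∀ a ∈ σ, ∏ i, z' i ^ a i = ∏ i, z i ^ a i := by
  constructor
  · rintro ⟨r', h'⟩
    have hLog := huniq r' z' h'
    obtain ⟨K, -, hKb⟩ := exists_coeff_bound hA
    have hr : ∀ a ∈ σ, r' a = r a := fun a ha => by
      have h1 := hKb σ h.central.1 (fun a => r' a - r a) a ha
      have h2 : ∑ a ∈ σ, (r' a - r a) • pairing a = 0 := by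
        have h3 : ∑ a ∈ σ, (r' a - r a) • pairing a =
            ∑ a ∈ σ, r' a • pairing a - ∑ a ∈ σ, r a • pairing a := by
          rw [← Finset.sum_sub_distrib]
          exact Finset.sum_congr rfl fun a _ => sub_smul (r' a) (r a) (pairing a)
        rw [h3, ← h.fderiv_eq, ← h'.fderiv_eq, hLog, sub_self]
      rw [Finset.sum_sub_distrib, h.sum_eq, h'.sum_eq, h2] at h1
      simp only [norm_zero, sub_zero, abs_zero, add_zero, mul_zero] at h1
      exact sub_eq_zero.1 (abs_eq_zero.1 (le_antisymm h1 (abs_nonneg _)))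
    refine ⟨h'.mem_torus, hLog, fun a ha => ?_⟩
    have h1 : ((-r 0 : ℝ) : ℂ) ≠ 0 := Complex.ofReal_ne_zero.2 (h.neg_pos hs hL).ne'
    have h2 : ((coeff a * Real.exp (-(L * ν a)) : ℝ) : ℂ) ≠ 0 := by
      refine Complex.ofReal_ne_zero.2 (mul_ne_zero ?_ (Real.exp_pos _).ne')
      rw [← abs_pos, abs_coeff]; exact one_pos
    have h3 := h'.term a ha
    rw [hr a ha, hr 0 h.central.2.1, h.term a ha] at h3
    exact (mul_left_cancel₀ h2 (mul_left_cancel₀ h1 h3)).symm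
  · rintro ⟨h1, h2, h3⟩
    exact ⟨r, h1, h.central, by rw [h2]; exact h.cut, by rw [h2]; exact h.fderiv_eq, h.sum_eq,
      h.le, h.le_zero, fun a ha => by rw [monoTerm, h3 a ha]; exact h.term a ha⟩

end

/-! ### The critical set as a submanifold -/

section

variable {k : ℕ} {A : Finset (Fin k → ℤ)} {ν : (Fin k → ℤ) → ℝ} {ψ φ : (Fin k → ℝ) → ℝ}
  {χ : (Fin k → ℤ) → (Fin k → ℝ) → ℝ} {L : ℝ} {σ : Finset (Fin k → ℤ)} {z x : Fin k → ℂ}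
  {c C R s₀ : ℝ} {r : (Fin k → ℤ) → ℝ}

lemma contDiffAt_logRatio (h : ∀ i, x i / z i ∈ Complex.slitPlane) :
    ContDiffAt ℝ ∞ (fun x : Fin k → ℂ => logC (x / z)) x :=
  contDiffAt_pi.2 fun i => ((Complex.contDiffAt_log (h i)).restrict_scalars ℝ).comp x
    ((contDiff_apply ℝ ℂ i).contDiffAt.div_const (z i))

lemma fderiv_logRatio (hz : z ∈ torus k) (h : ∀ i, x i / z i ∈ Complex.slitPlane)
    (Y : Fin k → ℂ) : fderiv ℝ (fun x : Fin k → ℂ => logC (x / z)) x Y = Y / x := by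
  have h1 : ∀ i, HasFDerivAt (fun x : Fin k → ℂ => Complex.log (x i / z i))
      ((x i / z i)⁻¹ • ((z i)⁻¹ • (ContinuousLinearMap.proj i : (Fin k → ℂ) →L[ℝ] ℂ))) x := by
    intro i
    have h2 := ((Complex.hasStrictDerivAt_log (h i)).hasDerivAt.hasFDerivAt.restrictScalars
      ℝ).comp x (((hasFDerivAt_apply (𝕜 := ℝ) i x).mul_const' (z i)⁻¹))
    refine (h2.congr_fderiv ?_)
    ext ξ
    simp [div_eq_mul_inv]
    ring
  have h3 := (hasFDerivAt_pi.2 h1).fderiv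
  ext i
  change fderiv ℝ (fun (x : Fin k → ℂ) i => Complex.log (x i / z i)) x Y i = _
  rw [h3]
  have h4 : x i ≠ 0 := fun h0 => by
    have h5 := h i
    rw [h0, zero_div] at h5
    exact Complex.zero_notMem_slitPlane h5
  have := hz i
  simp
  field_simp

lemma div_mem_torus (hx : x ∈ torus k) (hz : z ∈ torus k) : x / z ∈ torus k :=
  fun i => div_ne_zero (hx i) (hz i)

lemma rePart_logRatio (hx : x ∈ torus k) (hz : z ∈ torus k) :
    rePart (logC (x / z)) = Log x - Log z := by
  rw [rePart_logC]
  ext i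
  simp only [Log, Pi.div_apply, norm_div, Pi.sub_apply]
  exact Real.log_div (norm_ne_zero_iff.2 (hx i)) (norm_ne_zero_iff.2 (hz i))

lemma prod_zpow_eq_mul_exp (hx : x ∈ torus k) (hz : z ∈ torus k) (a : Fin k → ℤ) :
    ∏ i, x i ^ a i = (∏ i, z i ^ a i) * Complex.exp (cpairing a (logC (x / z))) := by
  rw [← prod_zpow_eq_exp (div_mem_torus hx hz)]
  simp only [Pi.div_apply, div_zpow, Finset.prod_div_distrib]
  rw [mul_div_cancel₀ _ (prod_zpow_ne_zero hz a)]

/-- In logarithmic coordinates, the directions that keep the absolute values and the monomials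
with exponents in `σ`. -/
def phaseSpace (σ : Finset (Fin k → ℤ)) : Submodule ℝ (Fin k → ℂ) where
  carrier := {ξ | rePart ξ = 0 ∧ ∀ a ∈ σ, pairing a (imPart ξ) = 0}
  zero_mem' := by simp
  add_mem' := fun {x y} hx hy => ⟨by rw [map_add, hx.1, hy.1, add_zero], fun a ha => by
    rw [map_add, map_add, hx.2 a ha, hy.2 a ha, add_zero]⟩
  smul_mem' := fun t x hx => ⟨by rw [map_smul, hx.1, smul_zero], fun a ha => by
    rw [map_smul, map_smul, hx.2 a ha, smul_zero]⟩

lemma cpairing_eq_zero {ξ : Fin k → ℂ} (h : ξ ∈ phaseSpace σ) {a : Fin k → ℤ} (ha : a ∈ σ) :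
    cpairing a ξ = 0 :=
  Complex.ext (by rw [cpairing_re, h.1, map_zero, Complex.zero_re])
    (by rw [cpairing_im, h.2 a ha, Complex.zero_im])

/-- Every subspace is the kernel of a surjective map to a coordinate space. -/
lemma exists_surjective_ker_eq (W : Submodule ℝ (Fin k → ℂ)) :
    ∃ (m : ℕ) (P : (Fin k → ℂ) →L[ℝ] (Fin m → ℝ)), Function.Surjective P ∧
      ∀ ξ, P ξ = 0 ↔ ξ ∈ W := by
  let e : ((Fin k → ℂ) ⧸ W) ≃ₗ[ℝ] (Fin (Module.finrank ℝ ((Fin k → ℂ) ⧸ W)) → ℝ) :=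
    LinearEquiv.ofFinrankEq _ _ (by simp)
  refine ⟨_, LinearMap.toContinuousLinearMap (e.toLinearMap.comp W.mkQ), ?_, fun ξ => ?_⟩
  · exact e.surjective.comp (Submodule.mkQ_surjective W)
  · change e (W.mkQ ξ) = 0 ↔ _
    rw [LinearEquiv.map_eq_zero_iff, Submodule.mkQ_apply, Submodule.Quotient.mk_eq_zero]

lemma eventually_cut (hz : z ∈ torus k)
    (h : ∀ᶠ u in 𝓝 (L⁻¹ • Log z), (∀ a ∈ σ, χ a u = 1) ∧ ∀ b ∈ A, b ∉ σ → χ b u = 0) :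
    ∀ᶠ x in 𝓝 z, (∀ a ∈ σ, χ a (L⁻¹ • Log x) = 1) ∧
      ∀ b ∈ A, b ∉ σ → χ b (L⁻¹ • Log x) = 0 :=
  ((contDiffAt_Log hz).continuousAt.const_smul L⁻¹).eventually h

lemma eventually_div_mem_slitPlane (hz : z ∈ torus k) :
    ∀ᶠ x in 𝓝 z, ∀ i, x i / z i ∈ Complex.slitPlane := by
  rw [Filter.eventually_all]
  intro i
  have h1 : ContinuousAt (fun x : Fin k → ℂ => x i / z i) z :=
    (continuous_apply i).continuousAt.div_const _
  refine h1.eventually (Complex.isOpen_slitPlane.mem_nhds ?_)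
  change z i / z i ∈ Complex.slitPlane
  rw [div_self (hz i)]
  exact Complex.one_mem_slitPlane

lemma logC_div_self (hz : z ∈ torus k) : logC (z / z) = 0 := by
  ext i
  simp [logC, div_self (hz i)]

lemma div_self_mem_slitPlane (hz : z ∈ torus k) (i : Fin k) : z i / z i ∈ Complex.slitPlane := by
  rw [div_self (hz i)]
  exact Complex.one_mem_slitPlane

/-- The face of a critical point is the set of exponents whose cut-off functions are one there. -/
lemma CriticalData.face_eq {σ' : Finset (Fin k → ℤ)} {r' : (Fin k → ℤ) → ℝ}
    (h : CriticalData A ν χ ψ s₀ L σ' r' x) (hσ : σ ⊆ A)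
    (hcut : (∀ a ∈ σ, χ a (L⁻¹ • Log x) = 1) ∧ ∀ b ∈ A, b ∉ σ → χ b (L⁻¹ • Log x) = 0) :
    σ' = σ := by
  have h1 := h.cut.self_of_nhds
  ext a
  constructor
  · intro ha
    by_contra hn
    exact one_ne_zero ((h1.1 a ha).symm.trans (hcut.2 a (h.central.1.2.1 ha) hn))
  · intro ha
    by_contra hn
    exact one_ne_zero ((hcut.1 a ha).symm.trans (h1.2 a (hσ ha) hn))

/-- The critical set is a submanifold. -/
lemma CriticalData.isSubmanifoldAt (hA : IsCentralTriangulation A ν)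
    (hχ : ∀ a ∈ A, ContDiff ℝ ∞ (χ a)) (hψ : ContDiff ℝ ∞ ψ)
    (h : CriticalData A ν χ ψ s₀ L σ r z) (hs : 0 < s₀) (hL : 0 < L)
    (hdata : ∀ x ∈ criticalSet ψ (tailoredFun A ν χ (Real.exp L) 1),
      ∃ σ r, CriticalData A ν χ ψ s₀ L σ r x)
    (huniq : ∀ r' z', CriticalData A ν χ ψ s₀ L σ r' z' → Log z' = Log z) :
    ∃ W, IsSubmanifoldAt (criticalSet ψ (tailoredFun A ν χ (Real.exp L) 1)) z W ∧
      ∀ Y, Y ∈ W ↔ Y / z ∈ phaseSpace σ := by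
  have hz := h.mem_torus
  obtain ⟨m, P, hP, hPker⟩ := exists_surjective_ker_eq (phaseSpace σ)
  have hcont : ContinuousAt (fun x : Fin k → ℂ => logC (x / z)) z :=
    (contDiffAt_logRatio (div_self_mem_slitPlane hz)).continuousAt
  have hsmall : ∀ᶠ x in 𝓝 z, ∀ a ∈ σ, |pairing a (imPart (logC (x / z)))| < 2 * Real.pi := by
    rw [Filter.eventually_all_finset]
    intro a _
    have h1 : ContinuousAt (fun x : Fin k → ℂ => |pairing a (imPart (logC (x / z)))|) z :=
      ((pairing a).continuous.comp imPart.continuous).continuousAt.comp hcont |>.abs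
    refine h1.eventually (gt_mem_nhds ?_)
    beta_reduce
    rw [logC_div_self hz, map_zero, map_zero, abs_zero]
    exact Real.two_pi_pos
  obtain ⟨U, hU, hUo, hzU⟩ := eventually_nhds_iff.1
    ((isOpen_torus.eventually_mem hz).and ((eventually_cut hz h.cut).and
      ((eventually_div_mem_slitPlane hz).and hsmall)))
  have hfd : ∀ x ∈ U, ∀ Y, fderiv ℝ (fun x : Fin k → ℂ => P (logC (x / z))) x Y = P (Y / x) := by
    intro x hx Y
    have h1 : DifferentiableAt ℝ (fun x : Fin k → ℂ => logC (x / z)) x :=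
      (contDiffAt_logRatio (hU x hx).2.2.1).differentiableAt (by simp)
    have h2 : fderiv ℝ (fun x : Fin k → ℂ => P (logC (x / z))) x =
        P.comp (fderiv ℝ (fun x : Fin k → ℂ => logC (x / z)) x) :=
      (P.hasFDerivAt.comp x h1.hasFDerivAt).fderiv
    rw [h2, ContinuousLinearMap.comp_apply, fderiv_logRatio hz (hU x hx).2.2.1]
  refine ⟨_, ⟨m, fun x => P (logC (x / z)), U, hUo, hzU, fun x hx => ?_, fun x hx y => ?_, ?_,
    h.mem_criticalSet hs hL hχ hψ, rfl⟩, fun Y => ?_⟩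
  · exact (P.contDiff.contDiffAt.comp x
      (contDiffAt_logRatio (hU x hx).2.2.1)).contDiffWithinAt
  · obtain ⟨ξ, rfl⟩ := hP y
    exact ⟨ξ * x, by rw [hfd x hx, div_mul_cancel_torus (hU x hx).1]⟩
  · ext x
    constructor
    · rintro ⟨hx, hxU⟩
      obtain ⟨hxt, hcut, hslit, hsm⟩ := hU x hxU
      obtain ⟨σ', r', h'⟩ := hdata x hx
      obtain rfl := h'.face_eq h.central.1.2.1 hcut
      obtain ⟨-, h1, h2⟩ := (h.exists_iff hA hs hL huniq).1 ⟨r', h'⟩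
      refine ⟨hxU, (hPker _).2 ⟨by rw [rePart_logRatio hxt hz, h1, sub_self], fun a ha => ?_⟩⟩
      have h3 := h2 a ha
      rw [prod_zpow_eq_mul_exp hxt hz, mul_eq_left₀ (prod_zpow_ne_zero hz a)] at h3
      obtain ⟨n, hn⟩ := Complex.exp_eq_one_iff.1 h3
      have h4 := congrArg Complex.im hn
      rw [cpairing_im] at h4
      have h5 : ((n : ℂ) * (2 * Real.pi * Complex.I)).im = n * (2 * Real.pi) := by
        simp
      have h6 := hsm a ha
      rw [h4, h5, abs_mul, abs_of_pos Real.two_pi_pos] at h6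
      have h7 : |(n : ℝ)| < 1 := by
        by_contra hge
        have := mul_le_mul_of_nonneg_right (not_lt.1 hge) Real.two_pi_pos.le
        linarith
      have h8 : n = 0 := by
        rw [← Int.abs_lt_one_iff]
        exact_mod_cast h7
      rw [h4, h5, h8, Int.cast_zero, zero_mul]
    · rintro ⟨hxU, hx0⟩
      obtain ⟨hxt, -⟩ := hU x hxU
      have h1 := (hPker _).1 hx0
      obtain ⟨r', h'⟩ := (h.exists_iff (z' := x) hA hs hL huniq).2 ⟨hxt, by
        have := h1.1
        rwa [rePart_logRatio hxt hz, sub_eq_zero] at this, fun a ha => by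
        rw [prod_zpow_eq_mul_exp hxt hz, cpairing_eq_zero h1 ha, Complex.exp_zero, mul_one]⟩
      exact ⟨h'.mem_criticalSet hs hL hχ hψ, hxU⟩
  · rw [← hPker, ← hfd z hzU]
    rfl

/-- Each of the finitely many faces contributes the empty set or a coset of a closed subgroup of a
compact torus. -/
lemma isCompact_criticalSet (hA : IsCentralTriangulation A ν)
    (hχ : ∀ a ∈ A, ContDiff ℝ ∞ (χ a)) (hψ : ContDiff ℝ ∞ ψ) (hs : 0 < s₀) (hL : 0 < L)
    (hdata : ∀ x ∈ criticalSet ψ (tailoredFun A ν χ (Real.exp L) 1),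
      ∃ σ r, CriticalData A ν χ ψ s₀ L σ r x)
    (huniq : ∀ σ r r' z z', CriticalData A ν χ ψ s₀ L σ r z →
      CriticalData A ν χ ψ s₀ L σ r' z' → Log z = Log z') :
    IsCompact (criticalSet ψ (tailoredFun A ν χ (Real.exp L) 1)) := by
  have h1 : criticalSet ψ (tailoredFun A ν χ (Real.exp L) 1) =
      ⋃ σ ∈ A.powerset, {z | ∃ r, CriticalData A ν χ ψ s₀ L σ r z} := by
    ext z
    simp only [Set.mem_iUnion, exists_prop]
    constructor
    · intro hz
      obtain ⟨σ, r, h⟩ := hdata z hz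
      exact ⟨σ, Finset.mem_powerset.2 h.central.1.2.1, r, h⟩
    · rintro ⟨σ, -, r, h⟩
      exact h.mem_criticalSet hs hL hχ hψ
  rw [h1]
  refine A.powerset.isCompact_biUnion fun σ _ => ?_
  rcases Set.eq_empty_or_nonempty {z | ∃ r, CriticalData A ν χ ψ s₀ L σ r z} with h0 | ⟨z, r, h⟩
  · rw [h0]; exact isCompact_empty
  set K : Set (Fin k → ℂ) := Set.pi Set.univ fun i => Metric.sphere (0 : ℂ) ‖z i‖ with hK
  have hKc : IsCompact K := isCompact_univ_pi fun i => isCompact_sphere _ _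
  have hKt : K ⊆ torus k := fun x hx i => by
    have h2 := hx i (Set.mem_univ i)
    rw [mem_sphere_zero_iff_norm] at h2
    rw [← norm_ne_zero_iff, h2]
    exact norm_ne_zero_iff.2 (h.mem_torus i)
  set F : (Fin k → ℂ) → (σ → ℂ) := fun x a => ∏ i, x i ^ (a : Fin k → ℤ) i with hF
  have hFc : ContinuousOn F K := by
    refine continuousOn_pi.2 fun a => continuousOn_finsetProd _ fun i _ x hx => ?_
    exact ((continuous_apply i).continuousWithinAt).zpow₀ _ (Or.inl (hKt hx i))
  have h3 : {z | ∃ r, CriticalData A ν χ ψ s₀ L σ r z} = K ∩ F ⁻¹' {F z} := by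
    ext x
    change (∃ r, _) ↔ _
    rw [h.exists_iff hA hs hL fun r' z' h' => huniq σ r' r z' z h' h]
    simp only [Set.mem_inter_iff, Set.mem_preimage, Set.mem_singleton_iff]
    constructor
    · rintro ⟨hx, hLog, hprod⟩
      refine ⟨fun i _ => ?_, funext fun a => hprod a a.2⟩
      rw [mem_sphere_zero_iff_norm]
      exact Real.log_injOn_pos (norm_pos_iff.2 (hx i)) (norm_pos_iff.2 (h.mem_torus i))
        (congrFun hLog i)
    · rintro ⟨hx, hprod⟩
      refine ⟨hKt hx, funext fun i => ?_, fun a ha => congrFun hprod ⟨a, ha⟩⟩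
      have h2 := hx i (Set.mem_univ i)
      rw [mem_sphere_zero_iff_norm] at h2
      simp only [Log, h2]
  rw [h3]
  exact hKc.of_isClosed_subset (hFc.preimage_isClosed_of_isClosed hKc.isClosed isClosed_singleton)
    Set.inter_subset_left

end

/-! ### The Hessian at a critical point -/

section

variable {k : ℕ} {A : Finset (Fin k → ℤ)} {ν : (Fin k → ℤ) → ℝ} {ψ φ : (Fin k → ℝ) → ℝ}
  {χ : (Fin k → ℤ) → (Fin k → ℝ) → ℝ} {L : ℝ} {σ : Finset (Fin k → ℤ)} {z x : Fin k → ℂ}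
  {c C R s₀ : ℝ} {r : (Fin k → ℤ) → ℝ}

/-- At a critical point the Hessian transforms like a bilinear form. -/
lemma hessian_comp {E F : Type*} [NormedAddCommGroup E] [NormedSpace ℝ E] [NormedAddCommGroup F]
    [NormedSpace ℝ F] {Φ : F → ℝ} {η : E → F} {x : E} (hΦ : ContDiffAt ℝ ∞ Φ (η x))
    (hη : ContDiffAt ℝ ∞ η x) (h0 : fderiv ℝ Φ (η x) = 0) (u v : E) :
    hessian (fun w => Φ (η w)) x u v =
      hessian Φ (η x) (fderiv ℝ η x u) (fderiv ℝ η x v) := by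
  have h1 : fderiv ℝ (fun w => Φ (η w)) =ᶠ[𝓝 x]
      fun w => (fderiv ℝ Φ (η w)).comp (fderiv ℝ η w) := by
    have h2 : ∀ᶠ w in 𝓝 x, DifferentiableAt ℝ η w :=
      ((hη.of_le (m := 1) (by simp)).eventually (by simp)).mono
        fun w hw => hw.differentiableAt (by simp)
    have h3 : ∀ᶠ y in 𝓝 (η x), DifferentiableAt ℝ Φ y :=
      ((hΦ.of_le (m := 1) (by simp)).eventually (by simp)).mono
        fun w hw => hw.differentiableAt (by simp)
    filter_upwards [h2, hη.continuousAt.eventually h3] with w hw1 hw2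
    exact fderiv_comp w hw2 hw1
  have h4 : DifferentiableAt ℝ (fderiv ℝ Φ) (η x) :=
    (hΦ.fderiv_right (m := 1) (by norm_cast)).differentiableAt (by simp)
  have h5 : DifferentiableAt ℝ (fderiv ℝ η) x :=
    (hη.fderiv_right (m := 1) (by norm_cast)).differentiableAt (by simp)
  have h6 : DifferentiableAt ℝ η x := hη.differentiableAt (by simp)
  have h7 := (h4.hasFDerivAt.comp x h6.hasFDerivAt).clm_comp h5.hasFDerivAt
  rw [hessian, h1.fderiv_eq]
  have h8 : fderiv ℝ (fun w => (fderiv ℝ Φ (η w)).comp (fderiv ℝ η w)) x = _ := h7.fderiv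
  rw [h8]
  simp [h0, hessian]

/-- The potential minus a multiple of an exponential sum, in logarithmic coordinates centred at
a critical point: the Lagrange function. -/
def lagrangian (ψ : (Fin k → ℝ) → ℝ) (σ : Finset (Fin k → ℤ)) (r : (Fin k → ℤ) → ℝ)
    (ρ : Fin k → ℝ) (ξ : Fin k → ℂ) : ℝ :=
  ψ (ρ + rePart ξ) - (∑ a ∈ σ, (r a : ℂ) * Complex.exp (cpairing a ξ)).re

lemma contDiff_lagrangian (hψ : ContDiff ℝ ∞ ψ) (r : (Fin k → ℤ) → ℝ) (ρ : Fin k → ℝ) :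
    ContDiff ℝ ∞ (lagrangian ψ σ r ρ) := by
  refine (hψ.comp (contDiff_const.add rePart.contDiff)).sub
    (Complex.reCLM.contDiff.comp (ContDiff.sum fun a _ => contDiff_const.mul ?_))
  exact (cpairing a).contDiff.cexp

lemma fderiv_lagrangian (hψ : ContDiff ℝ ∞ ψ) (r : (Fin k → ℤ) → ℝ) (ρ : Fin k → ℝ)
    (ξ ζ : Fin k → ℂ) : fderiv ℝ (lagrangian ψ σ r ρ) ξ ζ = fderiv ℝ ψ (ρ + rePart ξ) (rePart ζ) -
      (∑ a ∈ σ, (r a : ℂ) * Complex.exp (cpairing a ξ) * cpairing a ζ).re := by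
  have h1 : HasFDerivAt (fun ξ => ψ (ρ + rePart ξ))
      ((fderiv ℝ ψ (ρ + rePart ξ)).comp rePart) ξ :=
    (hψ.contDiffAt.differentiableAt (by simp)).hasFDerivAt.comp ξ
      (rePart.hasFDerivAt.const_add ρ)
  have h2 : HasFDerivAt (fun ξ => ∑ a ∈ σ, (r a : ℂ) * Complex.exp (cpairing a ξ))
      (∑ a ∈ σ, (r a : ℂ) • (Complex.exp (cpairing a ξ) • cpairing a)) ξ :=
    HasFDerivAt.fun_sum fun a _ => (cpairing a).hasFDerivAt.cexp.const_mul (r a : ℂ)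
  have h3 := h1.sub (Complex.reCLM.hasFDerivAt.comp ξ h2)
  have h4 : fderiv ℝ (lagrangian ψ σ r ρ) ξ = _ := h3.fderiv
  rw [h4]
  simp [sum_apply, mul_assoc]

/-- In logarithmic coordinates the sum over the face is harmonic: its quadratic part has opposite
signs on real and imaginary parts, while `ψ` only contributes to the real ones. -/
lemma hessian_lagrangian (hψ : ContDiff ℝ ∞ ψ) (r : (Fin k → ℤ) → ℝ) (ρ : Fin k → ℝ)
    (ξ ζ : Fin k → ℂ) : hessian (lagrangian ψ σ r ρ) 0 ξ ζ =
      fderiv ℝ (fderiv ℝ ψ) ρ (rePart ξ) (rePart ζ) -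
        ∑ a ∈ σ, r a * (pairing a (rePart ξ) * pairing a (rePart ζ) -
          pairing a (imPart ξ) * pairing a (imPart ζ)) := by
  have h0 : DifferentiableAt ℝ (fderiv ℝ (lagrangian ψ σ r ρ)) 0 :=
    ((contDiff_lagrangian hψ r ρ).contDiffAt.fderiv_right (m := 1)
      (by norm_cast)).differentiableAt (by simp)
  have h1 : hessian (lagrangian ψ σ r ρ) 0 ξ ζ =
      fderiv ℝ (fun x => fderiv ℝ (lagrangian ψ σ r ρ) x ζ) 0 ξ := by
    have h2 := (h0.hasFDerivAt.clm_apply (hasFDerivAt_const ζ (0 : Fin k → ℂ))).fderiv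
    rw [h2]
    simp [hessian]
  rw [h1]
  simp only [fderiv_lagrangian hψ]
  have h3 : HasFDerivAt (fun ξ => fderiv ℝ ψ (ρ + rePart ξ))
      ((fderiv ℝ (fderiv ℝ ψ) (ρ + rePart 0)).comp rePart) (0 : Fin k → ℂ) :=
    ((hψ.contDiffAt.fderiv_right (m := 1) (by norm_cast)).differentiableAt
      (by simp)).hasFDerivAt.comp 0 (rePart.hasFDerivAt.const_add ρ)
  have h4 := h3.clm_apply (hasFDerivAt_const (rePart ζ) (0 : Fin k → ℂ))
  have h5 : HasFDerivAt (fun ξ => ∑ a ∈ σ, (r a : ℂ) * Complex.exp (cpairing a ξ) * cpairing a ζ)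
      (∑ a ∈ σ, cpairing a ζ • ((r a : ℂ) • (Complex.exp (cpairing a 0) • cpairing a)))
      (0 : Fin k → ℂ) :=
    HasFDerivAt.fun_sum fun a _ =>
      ((cpairing a).hasFDerivAt.cexp.const_mul (r a : ℂ)).mul_const (cpairing a ζ)
  have h6 := (h4.sub (Complex.reCLM.hasFDerivAt.comp 0 h5)).fderiv
  have h7 : fderiv ℝ (fun x => fderiv ℝ ψ (ρ + rePart x) (rePart ζ) -
      (∑ a ∈ σ, (r a : ℂ) * Complex.exp (cpairing a x) * cpairing a ζ).re) 0 = _ := h6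
  rw [h7]
  simp only [sub_apply, ContinuousLinearMap.comp_apply, Complex.reCLM_apply, sum_apply,
    smul_apply, map_zero, Complex.exp_zero, one_smul, add_apply, zero_apply, zero_add,
    ContinuousLinearMap.flip_apply, add_zero, Complex.re_sum, smul_eq_mul]
  congr 1
  refine Finset.sum_congr rfl fun a _ => ?_
  rw [← cpairing_re, ← cpairing_re, ← cpairing_im, ← cpairing_im]
  simp [Complex.mul_re, Complex.mul_im]
  ring

/-- The real linear algebra behind the computation of the kernel of the Hessian. On the real
subspace where `∑ r a • pairing a` vanishes, the first part of the Hessian dominates in the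
directions that keep the pairings with `σ`, the second one, for large multipliers, in the others. -/
lemma exists_eq_zero_of_forall (hA : IsCentralTriangulation A ν) (hc : 0 < c) (hC : 0 < C)
    (hs : 0 < s₀) :
    ∃ L₀, ∀ L, L₀ < L → 0 < L → ∀ σ, IsCentral A ν σ → ∀ r : (Fin k → ℤ) → ℝ,
      (∀ a ∈ σ, a ≠ 0 → s₀ * L ≤ r a) →
      ∀ B : (Fin k → ℝ) →L[ℝ] (Fin k → ℝ) →L[ℝ] ℝ, Pinched c C B →
      ∀ v w, (∑ a ∈ σ, r a • pairing a) v = 0 → (∑ a ∈ σ, r a • pairing a) w = 0 →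
      (∀ v', (∑ a ∈ σ, r a • pairing a) v' = 0 →
        B v v' - ∑ a ∈ σ, r a * (pairing a v * pairing a v') = 0) →
      (∑ a ∈ σ, r a * (pairing a w * pairing a w) = 0) →
      v = 0 ∧ ∀ a ∈ σ, pairing a w = 0 := by
  obtain ⟨K, hK, hKs⟩ := exists_solution_bound hA
  refine ⟨C ^ 2 * K ^ 2 / (c * s₀), fun L hL₀ hL σ hσ r hr B hB v w hv hw hvv hww => ?_⟩
  have hsL : 0 < s₀ * L := mul_pos hs hL
  have hpos : ∀ (y : Fin k → ℝ), ∀ a ∈ σ, 0 ≤ r a * (pairing a y * pairing a y) := by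
    intro y a ha
    by_cases ha0 : a = 0
    · rw [ha0, pairing_zero, zero_apply, mul_zero, mul_zero]
    · exact mul_nonneg (hsL.le.trans (hr a ha ha0)) (mul_self_nonneg _)
  refine ⟨?_, fun a ha => ?_⟩
  swap
  · by_cases ha0 : a = 0
    · rw [ha0, pairing_zero, zero_apply]
    · have h1 := (Finset.sum_eq_zero_iff_of_nonneg (hpos w)).1 hww a ha
      exact mul_self_eq_zero.1 ((mul_eq_zero.1 h1).resolve_left (hsL.trans_le (hr a ha ha0)).ne')
  obtain ⟨a₀, ha₀, hmax⟩ := σ.exists_max_image (fun a => |pairing a v|) ⟨0, hσ.2.1⟩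
  set b := |pairing a₀ v| with hb
  have hb0 : 0 ≤ b := abs_nonneg _
  -- `y` has the same pairings as `v` and a norm of the order of these pairings; testing with
  -- `v - y` bounds `v` by them, and testing with `v` then shows that they vanish
  obtain ⟨y, hy, hya⟩ := hKs σ hσ.1 hσ.2.1 (fun a => pairing a v) b hb0 hmax
  have hya' : ∀ a ∈ σ, pairing a y = pairing a v := fun a ha => by
    by_cases ha0 : a = 0
    · rw [ha0, pairing_zero, zero_apply, zero_apply]
    · exact hya a ha ha0
  have happ : ∀ y, (∑ a ∈ σ, r a • pairing a) y = ∑ a ∈ σ, r a * pairing a y := fun y => by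
    rw [sum_apply]; rfl
  have hyp : (∑ a ∈ σ, r a • pairing a) y = 0 := by
    rw [← hv, happ, happ]
    exact Finset.sum_congr rfl fun a ha => by rw [hya' a ha]
  have h1 := hvv v hv
  have h2 := hvv y hyp
  have h3 : ∑ a ∈ σ, r a * (pairing a v * pairing a y) =
      ∑ a ∈ σ, r a * (pairing a v * pairing a v) :=
    Finset.sum_congr rfl fun a ha => by rw [hya' a ha]
  rw [h3] at h2
  have h4 : B v v = B v y := by linarith
  have h5 : B v y ≤ C * ‖v‖ * (K * b) := by
    refine (le_abs_self _).trans ((hB.upper v y).trans ?_)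
    gcongr
  have h6 := hB.lower v
  have h7 : ‖v‖ ≤ C * K * b / c := by
    rw [le_div_iff₀ hc]
    rcases (norm_nonneg v).eq_or_lt with h0 | h0
    · rw [← h0, zero_mul]; positivity
    · refine le_of_mul_le_mul_right ?_ h0
      calc ‖v‖ * c * ‖v‖ = c * ‖v‖ ^ 2 := by ring
        _ ≤ C * ‖v‖ * (K * b) := h6.trans (h4.le.trans h5)
        _ = _ := by ring
  have h8 : s₀ * L * b ^ 2 ≤ ∑ a ∈ σ, r a * (pairing a v * pairing a v) := by
    refine le_trans ?_ (Finset.single_le_sum (hpos v) ha₀)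
    by_cases ha0 : a₀ = 0
    · rw [hb, ha0, pairing_zero, zero_apply, abs_zero]; simp
    · rw [hb, sq_abs, sq]
      exact mul_le_mul_of_nonneg_right (hr a₀ ha₀ ha0) (mul_self_nonneg _)
  have h9 : s₀ * L * b ^ 2 ≤ C ^ 2 * K ^ 2 / c * b ^ 2 := by
    calc _ ≤ B v y := by linarith
      _ ≤ C * ‖v‖ * (K * b) := h5
      _ ≤ C * (C * K * b / c) * (K * b) := by gcongr
      _ = _ := by ring
  have h10 : C ^ 2 * K ^ 2 / c < s₀ * L := by
    rw [div_lt_iff₀ (by positivity)] at hL₀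
    rw [div_lt_iff₀ hc]
    linarith
  have h11 : b = 0 := by
    by_contra hne
    have h12 : 0 < b ^ 2 := by positivity
    have := mul_lt_mul_of_pos_right h10 h12
    linarith
  rw [h11, mul_zero, zero_div] at h7
  exact norm_le_zero_iff.1 h7

/-- The complex vector with given real and imaginary parts. -/
def ofParts (v w : Fin k → ℝ) : Fin k → ℂ := fun i => ⟨v i, w i⟩

lemma rePart_ofParts (v w : Fin k → ℝ) : rePart (ofParts v w) = v := by
  ext i; simp [ofParts, rePart_apply]

lemma imPart_ofParts (v w : Fin k → ℝ) : imPart (ofParts v w) = w := by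
  ext i; simp [ofParts, imPart_apply]

/-- On the hypersurface, near a critical point, the potential equals the Lagrange function. -/
lemma CriticalData.eventually_eq_lagrangian (h : CriticalData A ν χ ψ s₀ L σ r z) :
    ∀ᶠ x in 𝓝 z, x ∈ zeroSet (tailoredFun A ν χ (Real.exp L) 1) →
      torusPotential ψ x = lagrangian ψ σ r (Log z) (logC (x / z)) := by
  have hz := h.mem_torus
  filter_upwards [isOpen_torus.eventually_mem hz, eventually_cut hz h.cut] with x hx hcut hx0
  have h1 : ∑ a ∈ σ, (r a : ℂ) * Complex.exp (cpairing a (logC (x / z))) = 0 := by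
    have h2 : ∑ a ∈ σ, monoTerm ν L x a = 0 := by
      rw [← sum_logTerm hx h.central.1.2.1 hcut, sum_logTerm_eq_zero hx0]
    have h3 : ∑ a ∈ σ, (r a : ℂ) * Complex.exp (cpairing a (logC (x / z))) =
        ((-r 0 : ℝ) : ℂ) * ∑ a ∈ σ, monoTerm ν L x a := by
      rw [Finset.mul_sum]
      refine Finset.sum_congr rfl fun a ha => ?_
      rw [h.term a ha, monoTerm, monoTerm, prod_zpow_eq_mul_exp hx hz]
      ring
    rw [h3, h2, mul_zero]
  rw [lagrangian, h1, rePart_logRatio hx hz, torusPotential, Complex.zero_re, sub_zero]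
  congr 1
  abel

lemma CriticalData.fderiv_lagrangian_eq_zero (h : CriticalData A ν χ ψ s₀ L σ r z)
    (hψ : ContDiff ℝ ∞ ψ) : fderiv ℝ (lagrangian ψ σ r (Log z)) 0 = 0 := by
  ext ζ
  rw [fderiv_lagrangian hψ, map_zero, add_zero, zero_apply, h.fderiv_eq,
    ← re_sum_mul_cpairing, sub_eq_zero]
  simp

/-- The kernel of the Hessian of the restricted potential at a critical point. -/
lemma CriticalData.hessian_kernel (h : CriticalData A ν χ ψ s₀ L σ r z)
    (hχ : ∀ a ∈ A, ContDiff ℝ ∞ (χ a)) (hψ : ContDiff ℝ ∞ ψ) (hs : 0 < s₀) (hL : 0 < L)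
    (hker : ∀ v w, (∑ a ∈ σ, r a • pairing a) v = 0 → (∑ a ∈ σ, r a • pairing a) w = 0 →
      (∀ v', (∑ a ∈ σ, r a • pairing a) v' = 0 → fderiv ℝ (fderiv ℝ ψ) (Log z) v v' -
        ∑ a ∈ σ, r a * (pairing a v * pairing a v') = 0) →
      (∑ a ∈ σ, r a * (pairing a w * pairing a w) = 0) →
      v = 0 ∧ ∀ a ∈ σ, pairing a w = 0)
    {n : ℕ} {φ : (Fin n → ℝ) → Fin k → ℂ}
    (hφ : IsLocalParametrization (zeroSet (tailoredFun A ν χ (Real.exp L) 1)) z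
      (tangent (tailoredFun A ν χ (Real.exp L) 1) z) φ) (Y : Fin k → ℂ) :
    (∃ x : Fin n → ℝ, fderiv ℝ φ 0 x = Y ∧
      ∀ y : Fin n → ℝ, hessian (fun w => torusPotential ψ (φ w)) 0 x y = 0) ↔
      Y / z ∈ phaseSpace σ := by
  have hz := h.mem_torus
  set η : (Fin n → ℝ) → Fin k → ℂ := fun w => logC (φ w / z) with hη
  have hslit : ∀ i, φ 0 i / z i ∈ Complex.slitPlane := by
    rw [hφ.base]; exact div_self_mem_slitPlane hz
  have hη0 : η 0 = 0 := by
    simp only [hη, hφ.base]; exact logC_div_self hz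
  have hηs : ContDiffAt ℝ ∞ η 0 := (contDiffAt_logRatio hslit).comp 0 hφ.smooth
  have hηd : ∀ x, fderiv ℝ η 0 x = fderiv ℝ φ 0 x / z := fun x => by
    have h1 : fderiv ℝ η 0 =
        (fderiv ℝ (fun x : Fin k → ℂ => logC (x / z)) (φ 0)).comp (fderiv ℝ φ 0) :=
      fderiv_comp (g := fun x : Fin k → ℂ => logC (x / z)) 0
        ((contDiffAt_logRatio hslit).differentiableAt (by simp))
        (hφ.smooth.differentiableAt (by simp))
    rw [h1, ContinuousLinearMap.comp_apply, fderiv_logRatio hz hslit, hφ.base]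
  -- on the hypersurface the potential agrees with the Lagrange function, of which the point is a
  -- free critical point
  have hev : (fun w => torusPotential ψ (φ w)) =ᶠ[𝓝 0]
      fun w => lagrangian ψ σ r (Log z) (η w) := by
    have h1 := hφ.smooth.continuousAt
    rw [ContinuousAt, hφ.base] at h1
    filter_upwards [h1.eventually h.eventually_eq_lagrangian, hφ.mem] with w hw1 hw2
      using hw1 hw2
  have hHess : ∀ x y, hessian (fun w => torusPotential ψ (φ w)) 0 x y =
      hessian (lagrangian ψ σ r (Log z)) 0 (fderiv ℝ φ 0 x / z) (fderiv ℝ φ 0 y / z) := by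
    intro x y
    have h1 : hessian (fun w => torusPotential ψ (φ w)) 0 x y =
        hessian (fun w => lagrangian ψ σ r (Log z) (η w)) 0 x y := by
      rw [hessian, hessian, hev.fderiv.fderiv_eq]
    rw [h1, hessian_comp (contDiff_lagrangian hψ r _).contDiffAt hηs
      (by rw [hη0]; exact h.fderiv_lagrangian_eq_zero hψ), hη0, hηd, hηd]
  have hT : ∀ Y, (∃ x, fderiv ℝ φ 0 x = Y) ↔ (∑ a ∈ σ, r a • pairing a) (rePart (Y / z)) = 0 ∧
      (∑ a ∈ σ, r a • pairing a) (imPart (Y / z)) = 0 := by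
    intro Y
    have h1 : (∃ x, fderiv ℝ φ 0 x = Y) ↔ Y ∈ tangent (tailoredFun A ν χ (Real.exp L) 1) z := by
      rw [← hφ.range_eq]; rfl
    rw [h1, h.mem_tangent_iff hs hL hχ, ← re_sum_mul_cpairing, ← im_sum_mul_cpairing,
      Complex.ext_iff, Complex.zero_re, Complex.zero_im]
  constructor
  · rintro ⟨x, rfl, hx⟩
    obtain ⟨hv, hw⟩ := (hT _).1 ⟨x, rfl⟩
    set ξ := fderiv ℝ φ 0 x / z with hξ
    -- real and imaginary parts may be tested separately
    have htest : ∀ v' w', (∑ a ∈ σ, r a • pairing a) v' = 0 →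
        (∑ a ∈ σ, r a • pairing a) w' = 0 →
        fderiv ℝ (fderiv ℝ ψ) (Log z) (rePart ξ) v' -
        ∑ a ∈ σ, r a * (pairing a (rePart ξ) * pairing a v' -
          pairing a (imPart ξ) * pairing a w') = 0 := by
      intro v' w' hv' hw'
      obtain ⟨y, hy⟩ := (hT (ofParts v' w' * z)).2 (by
        rw [div_mul_cancel_torus hz, rePart_ofParts, imPart_ofParts]; exact ⟨hv', hw'⟩)
      have h1 := hx y
      rwa [hHess, hy, div_mul_cancel_torus hz, hessian_lagrangian hψ, rePart_ofParts,
        imPart_ofParts] at h1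
    exact hker _ _ hv hw (fun v' hv' => by simpa using htest v' 0 hv' (map_zero _))
      (by simpa using htest 0 (imPart ξ) (map_zero _) hw)
  · intro hY
    obtain ⟨x, rfl⟩ := (hT Y).2 ⟨by rw [hY.1, map_zero], by
      rw [sum_apply]
      exact Finset.sum_eq_zero fun a ha => by rw [smul_apply, hY.2 a ha, smul_zero]⟩
    refine ⟨x, rfl, fun y => ?_⟩
    rw [hHess, hessian_lagrangian hψ, hY.1]
    simp only [map_zero, zero_apply, zero_mul, zero_sub, neg_eq_zero]
    exact Finset.sum_eq_zero fun a ha => by rw [hY.2 a ha]; ring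

/-- The critical set and the kernel of the Hessian are both described by `phaseSpace`. -/
lemma isMorseBott_tailoredFun (hA : IsCentralTriangulation A ν)
    (hχ : ∀ a ∈ A, ContDiff ℝ ∞ (χ a)) (hψ : ContDiff ℝ ∞ ψ)
    (hpinched : ∀ x, Pinched c C (fderiv ℝ (fderiv ℝ ψ) x)) (hs : 0 < s₀) (hL : 0 < L)
    (hdata : ∀ x ∈ criticalSet ψ (tailoredFun A ν χ (Real.exp L) 1),
      ∃ σ r, CriticalData A ν χ ψ s₀ L σ r x)
    (huniq : ∀ σ r r' z z', CriticalData A ν χ ψ s₀ L σ r z →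
      CriticalData A ν χ ψ s₀ L σ r' z' → Log z = Log z')
    (hker : ∀ σ, IsCentral A ν σ → ∀ r : (Fin k → ℤ) → ℝ,
      (∀ a ∈ σ, a ≠ 0 → s₀ * L ≤ r a) →
      ∀ B : (Fin k → ℝ) →L[ℝ] (Fin k → ℝ) →L[ℝ] ℝ, Pinched c C B →
      ∀ v w, (∑ a ∈ σ, r a • pairing a) v = 0 → (∑ a ∈ σ, r a • pairing a) w = 0 →
      (∀ v', (∑ a ∈ σ, r a • pairing a) v' = 0 →
        B v v' - ∑ a ∈ σ, r a * (pairing a v * pairing a v') = 0) →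
      (∑ a ∈ σ, r a * (pairing a w * pairing a w) = 0) →
      v = 0 ∧ ∀ a ∈ σ, pairing a w = 0) :
    IsMorseBott ψ (tailoredFun A ν χ (Real.exp L) 1) := by
  refine ⟨isCompact_criticalSet hA hχ hψ hs hL hdata huniq, fun z hz => ?_⟩
  obtain ⟨σ, r, h⟩ := hdata z hz
  obtain ⟨W, hW, hWmem⟩ := h.isSubmanifoldAt hA hχ hψ hs hL hdata
    fun r' z' h' => huniq σ r' r z' z h' h
  refine ⟨W, hW, fun n φ hφ => ?_⟩
  ext Y
  rw [SetLike.mem_coe, hWmem]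
  exact h.hessian_kernel hχ hψ hs hL (hker σ h.central r h.le _ (hpinched _)) hφ Y

end

/-! ### Vector fields of linear growth -/

section

variable {E : Type*} [NormedAddCommGroup E] [NormedSpace ℝ E] [FiniteDimensional ℝ E]

/-- A vector field of linear growth has integral curves on a time interval of fixed length. -/
lemma exists_integralCurve_of_linear_growth {Y : E → E} (hY : ContDiff ℝ 1 Y) {C : ℝ}
    (hC : 0 < C) (hgrow : ∀ x, ‖Y x‖ ≤ C * (1 + ‖x‖)) (x : E) :
    ∃ γ : ℝ → E, γ 0 = x ∧
      ∀ t ∈ Set.Ioo (-(1 / (2 * C))) (1 / (2 * C)), HasDerivAt γ (Y (γ t)) t := by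
  have : CompleteSpace E := FiniteDimensional.complete ℝ E
  have : ProperSpace E := FiniteDimensional.proper ℝ E
  set a : NNReal := ⟨1 + ‖x‖, by positivity⟩ with ha
  have haR : (a : ℝ) = 1 + ‖x‖ := rfl
  obtain ⟨K, hK⟩ := (isCompact_closedBall x (a : ℝ)).exists_bound_of_continuousOn
    (hY.continuous_fderiv (by simp)).continuousOn
  set K' : NNReal := Real.toNNReal K with hK'
  have hlip : LipschitzOnWith K' Y (Metric.closedBall x a) := by
    refine Convex.lipschitzOnWith_of_nnnorm_fderiv_le (𝕜 := ℝ)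
      (fun y _ => hY.contDiffAt.differentiableAt (by simp)) (fun y hy => ?_)
      (convex_closedBall x (a : ℝ))
    rw [← NNReal.coe_le_coe, coe_nnnorm]
    exact (hK y hy).trans (Real.le_coe_toNNReal K)
  set M : NNReal := ⟨2 * C * (1 + ‖x‖), by positivity⟩ with hM
  set ε : ℝ := 1 / (2 * C) with hε
  have hε0 : 0 < ε := by positivity
  have hPL : IsPicardLindelof (fun _ => Y) (tmin := -ε) (tmax := ε)
      ⟨0, by constructor <;> linarith⟩ x a 0 M K' := by
    refine IsPicardLindelof.of_time_independent (fun y hy => ?_) hlip ?_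
    · refine (hgrow y).trans ?_
      have h1 : ‖y‖ ≤ ‖x‖ + (1 + ‖x‖) := by
        have h2 : ‖y‖ ≤ ‖y - x‖ + ‖x‖ := norm_le_norm_sub_add y x
        rw [Metric.mem_closedBall, dist_eq_norm, haR] at hy
        linarith
      change C * (1 + ‖y‖) ≤ 2 * C * (1 + ‖x‖)
      calc C * (1 + ‖y‖) ≤ C * (1 + (‖x‖ + (1 + ‖x‖))) := by gcongr
        _ = _ := by ring
    · change 2 * C * (1 + ‖x‖) * max (ε - 0) (0 - -ε) ≤ 1 + ‖x‖ - 0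
      rw [sub_zero, zero_sub, neg_neg, max_self, hε, sub_zero]
      apply le_of_eq
      field_simp
  obtain ⟨γ, h0, hγ⟩ := hPL.exists_eq_forall_mem_Icc_hasDerivWithinAt₀
  exact ⟨γ, h0, fun t ht =>
    (hγ t (Set.Ioo_subset_Icc_self ht)).hasDerivAt (Icc_mem_nhds ht.1 ht.2)⟩

/-- A vector field of linear growth is complete. -/
lemma exists_global_integralCurve {Y : E → E} (hY : ContDiff ℝ 1 Y) {C : ℝ}
    (hC : 0 < C) (hgrow : ∀ x, ‖Y x‖ ≤ C * (1 + ‖x‖)) (x : E) :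
    ∃ γ : ℝ → E, γ 0 = x ∧ ∀ t, HasDerivAt γ (Y (γ t)) t := by
  have : CompleteSpace E := FiniteDimensional.complete ℝ E
  have hsm : ∀ v : E, (ContinuousLinearMap.smulRight (1 : ℝ →L[ℝ] ℝ) v) =
      ContinuousLinearMap.toSpanSingleton ℝ v := fun v => by ext; simp
  have hv : ContMDiff (modelWithCornersSelf ℝ E) (modelWithCornersSelf ℝ E).tangent 1
      (fun x => (⟨x, Y x⟩ : TangentBundle (modelWithCornersSelf ℝ E) E)) :=
    contMDiff_vectorSpace_iff_contDiff.2 hY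
  obtain ⟨γ, h0, hγ⟩ := exists_isMIntegralCurve_of_isMIntegralCurveOn
    (I := modelWithCornersSelf ℝ E) hv (ε := 1 / (2 * C)) (by positivity) (fun x => by
      obtain ⟨γ, h0, hγ⟩ := exists_integralCurve_of_linear_growth hY hC hgrow x
      refine ⟨γ, h0, fun t ht => ?_⟩
      refine HasMFDerivAt.hasMFDerivWithinAt (hasMFDerivAt_iff_hasFDerivAt.2 ?_)
      exact (hasDerivAt_iff_hasFDerivAt.1 (hγ t ht)).congr_fderiv (hsm _).symm) x
  refine ⟨γ, h0, fun t => hasDerivAt_iff_hasFDerivAt.2 ?_⟩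
  exact (hasMFDerivAt_iff_hasFDerivAt.1 (hγ t)).congr_fderiv (hsm _)

end

/-! ### The Liouville vector field -/

section

variable {k : ℕ}

/-- The linear system whose solution is the Liouville vector field of a level set of a function
with derivative `D`. The second argument is a Lagrange multiplier. -/
def liouvilleSystem (B : (Fin k → ℝ) →L[ℝ] (Fin k → ℝ) →L[ℝ] ℝ) (D : (Fin k → ℂ) →L[ℝ] ℂ) :
    ((Fin k → ℂ) × ℂ) →L[ℝ] (((Fin k → ℂ) →L[ℝ] ℝ) × ℂ) :=
  LinearMap.toContinuousLinearMap
    { toFun := fun Z => ((B (rePart Z.1)).comp imPart - (B (imPart Z.1)).comp rePart +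
        (Z.2.re • Complex.reCLM.comp D + Z.2.im • Complex.imCLM.comp D), D Z.1)
      map_add' := fun Y Z => by
        refine Prod.ext ?_ (by simp)
        ext X
        simp
        ring
      map_smul' := fun t Z => by
        refine Prod.ext ?_ (by simp)
        ext X
        simp
        ring }

lemma liouvilleSystem_fst (B : (Fin k → ℝ) →L[ℝ] (Fin k → ℝ) →L[ℝ] ℝ) (D : (Fin k → ℂ) →L[ℝ] ℂ)
    (Z : (Fin k → ℂ) × ℂ) (X : Fin k → ℂ) :
    (liouvilleSystem B D Z).1 X = B (rePart Z.1) (imPart X) - B (imPart Z.1) (rePart X) +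
      (Z.2.re * (D X).re + Z.2.im * (D X).im) := by
  simp [liouvilleSystem]

lemma contDiff_liouvilleSystem {B : (Fin k → ℂ) → (Fin k → ℝ) →L[ℝ] (Fin k → ℝ) →L[ℝ] ℝ}
    {D : (Fin k → ℂ) → (Fin k → ℂ) →L[ℝ] ℂ} (hB : ContDiff ℝ ∞ B) (hD : ContDiff ℝ ∞ D) :
    ContDiff ℝ ∞ fun w => liouvilleSystem (B w) (D w) := by
  refine contDiff_clm_apply_iff.2 fun Z => ContDiff.prodMk ?_ (hD.clm_apply contDiff_const)
  change ContDiff ℝ ∞ fun w => (liouvilleSystem (B w) (D w) Z).1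
  refine contDiff_clm_apply_iff.2 fun X => ?_
  simp only [liouvilleSystem_fst]
  have h1 : ∀ v v' : Fin k → ℝ, ContDiff ℝ ∞ fun w => B w v v' := fun v v' =>
    (hB.clm_apply contDiff_const).clm_apply contDiff_const
  have h2 : ContDiff ℝ ∞ fun w => D w X := hD.clm_apply contDiff_const
  exact ((h1 _ _).sub (h1 _ _)).add
    ((contDiff_const.mul (Complex.reCLM.contDiff.comp h2)).add
      (contDiff_const.mul (Complex.imCLM.contDiff.comp h2)))

/-- The system is square, and it is injective where the level set is symplectic, so that its solution
depends smoothly on the base point. -/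
lemma exists_equiv_liouvilleSystem {B : (Fin k → ℝ) →L[ℝ] (Fin k → ℝ) →L[ℝ] ℝ}
    (hB : ∀ v w, B v w = B w v) {D : (Fin k → ℂ) →L[ℝ] ℂ}
    (hD : Function.Surjective D)
    (hnd : ∀ ξ, D ξ = 0 → (∀ ζ, D ζ = 0 → omForm B ξ ζ = 0) → ξ = 0) :
    ∃ e : ((Fin k → ℂ) × ℂ) ≃L[ℝ] (((Fin k → ℂ) →L[ℝ] ℝ) × ℂ),
      (e : _ →L[ℝ] _) = liouvilleSystem B D := by
  have hinj : Function.Injective (liouvilleSystem B D).toLinearMap := by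
    rw [← LinearMap.ker_eq_bot, LinearMap.ker_eq_bot']
    rintro ⟨ξ, μ⟩ h
    have h1 : ∀ ζ, B (rePart ξ) (imPart ζ) - B (imPart ξ) (rePart ζ) +
        (μ.re * (D ζ).re + μ.im * (D ζ).im) = 0 := fun ζ => by
      rw [← liouvilleSystem_fst B D (ξ, μ) ζ]
      change ((liouvilleSystem B D).toLinearMap (ξ, μ)).1 ζ = 0
      rw [h]; rfl
    have h2 : D ξ = 0 := congrArg Prod.snd h
    have h3 : ξ = 0 := hnd ξ h2 fun ζ hζ => by
      have := h1 ζ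
      rw [hζ, Complex.zero_re, Complex.zero_im, mul_zero, mul_zero, add_zero, add_zero] at this
      rw [omForm, hB (rePart ζ)]
      exact this
    have h4 : μ = 0 := by
      obtain ⟨ζ, hζ⟩ := hD μ
      have := h1 ζ
      rw [h3, map_zero, map_zero, map_zero, hζ, map_zero, zero_apply, zero_apply, sub_zero, zero_add] at this
      rw [← Complex.normSq_eq_zero, Complex.normSq_apply]
      exact this
    rw [h3, h4]
    rfl
  have hdim : Module.finrank ℝ ((Fin k → ℂ) × ℂ) =
      Module.finrank ℝ (((Fin k → ℂ) →L[ℝ] ℝ) × ℂ) := by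
    have h1 : Module.finrank ℝ ((Fin k → ℂ) →L[ℝ] ℝ) = Module.finrank ℝ (Fin k → ℂ) := by
      rw [← (LinearMap.toContinuousLinearMap (𝕜 := ℝ) (E := Fin k → ℂ) (F' := ℝ)).finrank_eq]
      exact Subspace.dual_finrank_eq
    rw [Module.finrank_prod, Module.finrank_prod, h1]
  refine ⟨(LinearMap.linearEquivOfInjective _ hinj hdim).toContinuousLinearEquiv, ?_⟩
  exact ContinuousLinearMap.ext fun Z => rfl

/-- A level set whose Liouville vector field has linear growth is complete: the field extends to
a smooth vector field of linear growth which is tangent to all level sets. -/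
lemma exists_complete_liouville {p : (Fin k → ℂ) → (Fin k → ℝ) →L[ℝ] ℝ}
    {B : (Fin k → ℂ) → (Fin k → ℝ) →L[ℝ] (Fin k → ℝ) →L[ℝ] ℝ} {F : (Fin k → ℂ) → ℂ}
    (hp : ContDiff ℝ ∞ p) (hB : ContDiff ℝ ∞ B) (hF : ContDiff ℝ ∞ F)
    (hsymm : ∀ w u v, B w u v = B w v u)
    (hsurj : ∀ w, F w = 0 → Function.Surjective (fderiv ℝ F w))
    (hnd : ∀ w, F w = 0 → ∀ ξ, fderiv ℝ F w ξ = 0 →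
      (∀ ζ, fderiv ℝ F w ζ = 0 → omForm (B w) ξ ζ = 0) → ξ = 0)
    {C : ℝ} (hC : 0 < C)
    (hgrow : ∀ w, F w = 0 → ∀ ξ, fderiv ℝ F w ξ = 0 →
      (∀ ζ, fderiv ℝ F w ζ = 0 → omForm (B w) ξ ζ = p w (imPart ζ)) → ‖ξ‖ < C * (1 + ‖w‖))
    {w₀ : Fin k → ℂ} (hw₀ : F w₀ = 0) :
    ∃ γ : ℝ → Fin k → ℂ, γ 0 = w₀ ∧ ∀ t, F (γ t) = 0 ∧ ∃ ξ, HasDerivAt γ ξ t ∧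
      fderiv ℝ F (γ t) ξ = 0 ∧
      ∀ ζ, fderiv ℝ F (γ t) ζ = 0 → omForm (B (γ t)) ξ ζ = p (γ t) (imPart ζ) := by
  have hDs : ContDiff ℝ ∞ (fderiv ℝ F) := hF.fderiv_right (m := ∞) (by simp)
  set Λ := fun w => liouvilleSystem (B w) (fderiv ℝ F w) with hΛ
  have hΛs : ContDiff ℝ ∞ Λ := contDiff_liouvilleSystem hB hDs
  -- on the open set `N` the system can be solved
  set N : Set (Fin k → ℂ) := Λ ⁻¹' Set.range
    ((↑) : (((Fin k → ℂ) × ℂ) ≃L[ℝ] (((Fin k → ℂ) →L[ℝ] ℝ) × ℂ)) → _) with hN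
  have hNo : IsOpen N := ContinuousLinearEquiv.isOpen.preimage hΛs.continuous
  set θ : (Fin k → ℂ) → ((Fin k → ℂ) →L[ℝ] ℝ) × ℂ := fun w => ((p w).comp imPart, 0) with hθ
  have hθs : ContDiff ℝ ∞ θ := (hp.clm_comp contDiff_const).prodMk contDiff_const
  set V : (Fin k → ℂ) → Fin k → ℂ := fun w => ((Λ w).inverse (θ w)).1 with hV
  have hVs : ∀ w ∈ N, ContDiffAt ℝ ∞ V w := by
    rintro w ⟨e, he⟩
    have h1 : ContDiffAt ℝ ∞ ContinuousLinearMap.inverse (Λ w) := by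
      rw [← he]; exact contDiffAt_map_inverse e
    exact ((h1.comp w hΛs.contDiffAt).clm_apply hθs.contDiffAt).fst
  have hVeq : ∀ w ∈ N, ∃ μ, Λ w (V w, μ) = θ w := by
    rintro w ⟨e, he⟩
    refine ⟨((Λ w).inverse (θ w)).2, ?_⟩
    change Λ w ((Λ w).inverse (θ w)) = θ w
    rw [← he, ContinuousLinearMap.inverse_equiv]
    simp
  have hVD : ∀ w ∈ N, fderiv ℝ F w (V w) = 0 := fun w hw => by
    obtain ⟨μ, hμ⟩ := hVeq w hw
    exact congrArg Prod.snd hμ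
  have hVL : ∀ w ∈ N, ∀ ζ, fderiv ℝ F w ζ = 0 → omForm (B w) (V w) ζ = p w (imPart ζ) := by
    intro w hw ζ hζ
    obtain ⟨μ, hμ⟩ := hVeq w hw
    have h1 : (Λ w (V w, μ)).1 ζ = p w (imPart ζ) := by rw [hμ]; rfl
    rw [hΛ, liouvilleSystem_fst, hζ, Complex.zero_re, Complex.zero_im, mul_zero, mul_zero,
      add_zero, add_zero] at h1
    rw [omForm, hsymm w (rePart ζ)]
    exact h1
  have hMN : ∀ w, F w = 0 → w ∈ N := fun w hw =>
    exists_equiv_liouvilleSystem (hsymm w) (hsurj w hw) (hnd w hw)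
  -- on this smaller open set the solution moreover satisfies the growth bound
  set N' : Set (Fin k → ℂ) := {w | w ∈ N ∧ ‖V w‖ - C * (1 + ‖w‖) ∈ Set.Iio (0 : ℝ)} with hN'
  have hN'o : IsOpen N' := by
    refine ContinuousOn.isOpen_inter_preimage (f := fun w => ‖V w‖ - C * (1 + ‖w‖)) ?_ hNo
      isOpen_Iio
    exact (ContinuousOn.norm fun w hw => (hVs w hw).continuousAt.continuousWithinAt).sub
      (by fun_prop)
  have hMclosed : IsClosed {w | F w = 0} := isClosed_eq hF.continuous continuous_const
  have hMN' : ∀ w, F w = 0 → w ∈ N' := fun w hw => ⟨hMN w hw, by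
    rw [Set.mem_Iio, sub_neg]
    exact hgrow w hw _ (hVD w (hMN w hw)) (hVL w (hMN w hw))⟩
  -- cut the field off outside of it without changing it on the level set
  obtain ⟨b, hb0, hb1, hb⟩ := exists_contMDiffMap_zero_one_nhds_of_isClosed
    (modelWithCornersSelf ℝ (Fin k → ℂ)) (n := ⊤) hN'o.isClosed_compl hMclosed
    (Set.disjoint_left.2 fun w hw1 hw2 => hw1 (hMN' w hw2))
  have hbs : ContDiff ℝ ∞ b := b.contMDiff.contDiff
  have hbM : ∀ w, F w = 0 → b w = 1 := fun w hw => hb1.self_of_nhdsSet w hw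
  have hbN : ∀ w, w ∉ N' → ∀ᶠ x in 𝓝 w, b x = 0 := fun w hw =>
    (Filter.eventually_iff_exists_mem.1 hb0).elim fun s hs =>
      Filter.mem_of_superset (mem_nhdsSet_iff_forall.1 hs.1 w hw) hs.2
  set Y : (Fin k → ℂ) → Fin k → ℂ := fun w => b w • V w with hY
  have hYz : ∀ w, w ∉ N' → Y w = 0 := fun w hw => by
    change b w • V w = 0
    rw [(hbN w hw).self_of_nhds, zero_smul]
  have hYs : ContDiff ℝ 1 Y := by
    refine contDiff_iff_contDiffAt.2 fun w => ?_
    by_cases hw : w ∈ N'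
    · exact (hbs.contDiffAt.smul (hVs w hw.1)).of_le (by simp)
    · refine (contDiffAt_const (c := (0 : Fin k → ℂ))).congr_of_eventuallyEq ?_
      filter_upwards [hbN w hw] with x hx
      rw [hY]
      simp only [hx, zero_smul]
  have hYg : ∀ w, ‖Y w‖ ≤ C * (1 + ‖w‖) := fun w => by
    by_cases hw : w ∈ N'
    · have h1 := hb w
      have h2 := hw.2
      rw [Set.mem_Iio, sub_neg] at h2
      rw [hY, norm_smul, Real.norm_of_nonneg h1.1]
      exact (mul_le_of_le_one_left (norm_nonneg _) h1.2).trans h2.le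
    · rw [hYz w hw, norm_zero]
      positivity
  have hYD : ∀ w, fderiv ℝ F w (Y w) = 0 := fun w => by
    by_cases hw : w ∈ N'
    · rw [hY, map_smul, hVD w hw.1, smul_zero]
    · rw [hYz w hw, map_zero]
  obtain ⟨γ, h0, hγ⟩ := exists_global_integralCurve hYs hC hYg w₀
  have hconst : ∀ t, F (γ t) = 0 := by
    have h1 : ∀ t, HasDerivAt (fun t => F (γ t)) 0 t := fun t => by
      have h2 := ((hF.contDiffAt.differentiableAt (by simp)).hasFDerivAt
        (x := γ t)).comp_hasDerivAt t (hγ t)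
      rwa [hYD] at h2
    intro t
    have h2 := is_const_of_deriv_eq_zero (fun t => (h1 t).differentiableAt)
      (fun t => (h1 t).deriv) t 0
    rw [h2, h0, hw₀]
  refine ⟨γ, h0, fun t => ⟨hconst t, Y (γ t), hγ t, hYD _, ?_⟩⟩
  have h1 : Y (γ t) = V (γ t) := by rw [hY]; simp only [hbM _ (hconst t), one_smul]
  rw [h1]
  exact hVL _ (hMN _ (hconst t))

end

/-! ### Weinstein structures -/

section

variable {k : ℕ} {ψ φ : (Fin k → ℝ) → ℝ} {c C R : ℝ} {f : (Fin k → ℂ) → ℂ}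

lemma fderiv_comp_expC (hf : ContDiffOn ℝ ∞ f (torus k)) (w ξ : Fin k → ℂ) :
    fderiv ℝ (f ∘ expC) w ξ = fderiv ℝ f (expC w) (expC w * ξ) := by
  rw [fderiv_comp w ((hf.contDiffAt (isOpen_torus.mem_nhds (expC_mem_torus w))).differentiableAt
    (by simp)) (contDiff_expC.contDiffAt.differentiableAt (by simp)),
    ContinuousLinearMap.comp_apply, fderiv_expC]
  rfl

lemma mul_div_cancel_torus {z : Fin k → ℂ} (hz : z ∈ torus k) (ξ : Fin k → ℂ) : z * ξ / z = ξ := by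
  rw [mul_comm, div_mul_cancel_torus hz]

lemma mul_div_cancel_torus' {z : Fin k → ℂ} (hz : z ∈ torus k) (Y : Fin k → ℂ) :
    z * (Y / z) = Y := by
  ext i
  simp [mul_div_cancel₀ _ (hz i)]

/-- The Liouville vector field of the hypersurface in logarithmic coordinates. -/
lemma isLiouvilleVector_expC_iff (hf : ContDiffOn ℝ ∞ f (torus k)) (w ξ : Fin k → ℂ) :
    IsLiouvilleVector ψ f (expC w) (expC w * ξ) ↔ fderiv ℝ (f ∘ expC) w ξ = 0 ∧
      ∀ ζ, fderiv ℝ (f ∘ expC) w ζ = 0 →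
        omForm (fderiv ℝ (fderiv ℝ ψ) (rePart w)) ξ ζ = fderiv ℝ ψ (rePart w) (imPart ζ) := by
  have hw := expC_mem_torus w
  have hmem : ∀ ζ, expC w * ζ ∈ tangent f (expC w) ↔ fderiv ℝ (f ∘ expC) w ζ = 0 := fun ζ => by
    rw [fderiv_comp_expC hf]; rfl
  rw [IsLiouvilleVector, hmem]
  refine and_congr_right fun _ => ⟨fun h ζ hζ => ?_, fun h Y hY => ?_⟩
  · have h1 := h (expC w * ζ) ((hmem ζ).2 hζ)
    rwa [symplecticForm_eq, liouvilleForm_eq, mul_div_cancel_torus hw, mul_div_cancel_torus hw,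
      Log_expC] at h1
  · have h1 := h (Y / expC w) (by rwa [← hmem, mul_div_cancel_torus' hw])
    rwa [symplecticForm_eq, liouvilleForm_eq, mul_div_cancel_torus hw, Log_expC]

/-- If the Liouville vector field is gradient-like, then its norm is bounded by that of `dψ`, which
grows linearly in logarithmic coordinates. -/
lemma exists_norm_liouville_lt (hB : PotentialBounds ψ φ c C R) (hG : IsGradientLike ψ f) :
    ∃ K > 0, ∀ w ξ, expC w ∈ zeroSet f → IsLiouvilleVector ψ f (expC w) (expC w * ξ) →
      ‖ξ‖ < K * (1 + ‖w‖) := by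
  obtain ⟨δ, hδ, h⟩ := hG
  have hc := hB.c_pos
  have hC := hB.C_pos
  set P := ‖fderiv ℝ ψ 0‖
  refine ⟨2 * (P + C + 1) / (c * δ), by positivity, fun w ξ hw hξ => ?_⟩
  have h1 := h _ hw _ hξ
  have h2 : 0 ≤ restrictedCovectorNormSq ψ f (expC w) :=
    Real.sSup_nonneg (by rintro _ ⟨Y, -, -, rfl⟩; exact sq_nonneg _)
  rw [fderiv_torusPotential hB.smooth hw.1, kahlerMetric_eq, mul_div_cancel_torus hw.1,
    Log_expC] at h1
  have h3 := le_gForm hc.le (hB.pinched (rePart w)) ξ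
  have h4 : ‖fderiv ℝ ψ (rePart w)‖ ≤ P + C * ‖w‖ := by
    have h5 := hB.lipschitz (rePart w) 0
    rw [sub_zero] at h5
    calc ‖fderiv ℝ ψ (rePart w)‖ = ‖fderiv ℝ ψ 0 + (fderiv ℝ ψ (rePart w) - fderiv ℝ ψ 0)‖ := by
          congr 1; abel
      _ ≤ P + ‖fderiv ℝ ψ (rePart w) - fderiv ℝ ψ 0‖ := norm_add_le _ _
      _ ≤ P + C * ‖w‖ := by
        gcongr
        exact h5.trans (mul_le_mul_of_nonneg_left (norm_rePart_le w) hC.le)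
  have h5 : fderiv ℝ ψ (rePart w) (rePart ξ) ≤ (P + C * ‖w‖) * ‖ξ‖ := by
    refine (Real.le_norm_self _).trans ((ContinuousLinearMap.le_opNorm _ _).trans ?_)
    have h6 := norm_rePart_le ξ
    gcongr
  have h6 : δ * (c / 2 * ‖ξ‖ ^ 2) ≤ (P + C * ‖w‖) * ‖ξ‖ := by
    refine le_trans ?_ (h1.trans h5)
    gcongr
    linarith
  have h7 : P + C * ‖w‖ < (P + C + 1) * (1 + ‖w‖) := by
    have h8 : 0 ≤ P * ‖w‖ := by positivity
    have h9 := norm_nonneg w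
    linarith
  have h8 : c * δ * ‖ξ‖ < 2 * ((P + C + 1) * (1 + ‖w‖)) := by
    rcases (norm_nonneg ξ).eq_or_lt with h0 | h0
    · rw [← h0, mul_zero]; positivity
    · have h9 : (c * δ * ‖ξ‖) * ‖ξ‖ ≤ (2 * (P + C * ‖w‖)) * ‖ξ‖ := by linarith [sq ‖ξ‖]
      have h10 := le_of_mul_le_mul_right h9 h0
      linarith
  rw [div_mul_eq_mul_div, lt_div_iff₀ (by positivity)]
  linarith

lemma exists_complete_curve (hB : PotentialBounds ψ φ c C R)
    (hS : IsSymplecticHypersurface ψ f) (hG : IsGradientLike ψ f) {z : Fin k → ℂ}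
    (hz : z ∈ zeroSet f) :
    ∃ γ : ℝ → Fin k → ℂ, γ 0 = z ∧
      ∀ r : ℝ, γ r ∈ zeroSet f ∧ ∃ Z, HasDerivAt γ Z r ∧ IsLiouvilleVector ψ f (γ r) Z := by
  have hf := hS.smooth
  obtain ⟨K, hK, hgrow⟩ := exists_norm_liouville_lt hB hG
  have hF : ContDiff ℝ ∞ (f ∘ expC) := contDiff_iff_contDiffAt.2 fun w =>
    (hf.contDiffAt (isOpen_torus.mem_nhds (expC_mem_torus w))).comp w contDiff_expC.contDiffAt
  have hψ1 : ContDiff ℝ ∞ (fderiv ℝ ψ) := hB.smooth.fderiv_right (m := ∞) (by simp)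
  have hψ2 : ContDiff ℝ ∞ (fderiv ℝ (fderiv ℝ ψ)) := hψ1.fderiv_right (m := ∞) (by simp)
  have hM : ∀ w, (f ∘ expC) w = 0 → expC w ∈ zeroSet f := fun w hw => ⟨expC_mem_torus w, hw⟩
  obtain ⟨γ, h0, hγ⟩ := exists_complete_liouville (p := fun w => fderiv ℝ ψ (rePart w))
    (B := fun w => fderiv ℝ (fderiv ℝ ψ) (rePart w)) (hψ1.comp rePart.contDiff)
    (hψ2.comp rePart.contDiff) hF (fun w u v => (hB.pinched (rePart w)).symm u v)
    (fun w hw y => by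
      obtain ⟨Y, hY⟩ := hS.regular _ (hM w hw) y
      exact ⟨Y / expC w, by
        rw [fderiv_comp_expC hf, mul_div_cancel_torus' (expC_mem_torus w), hY]⟩)
    (fun w hw ξ hξ h => by
      have h1 := hS.nondegenerate _ (hM w hw) (expC w * ξ) (by
        change fderiv ℝ f (expC w) (expC w * ξ) = 0
        rwa [← fderiv_comp_expC hf]) fun Y hY => by
          rw [symplecticForm_eq, mul_div_cancel_torus (expC_mem_torus w), Log_expC]
          refine h _ ?_
          rw [fderiv_comp_expC hf, mul_div_cancel_torus' (expC_mem_torus w)]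
          exact hY
      rw [← mul_div_cancel_torus (expC_mem_torus w) ξ, h1]
      ext i
      simp)
    hK (fun w hw ξ hξ h => hgrow w ξ (hM w hw) ((isLiouvilleVector_expC_iff hf w ξ).2 ⟨hξ, h⟩))
    (w₀ := logC z) (by rw [Function.comp_apply, expC_logC hz.1, hz.2])
  refine ⟨fun t => expC (γ t), (congrArg expC h0).trans (expC_logC hz.1), fun t => ?_⟩
  obtain ⟨h1, ξ, h2, h3, h4⟩ := hγ t
  refine ⟨hM _ h1, expC (γ t) * ξ, ?_, (isLiouvilleVector_expC_iff hf _ _).2 ⟨h3, h4⟩⟩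
  have h5 := ((contDiff_expC (k := k)).contDiffAt.differentiableAt (x := γ t)
    (by simp)).hasFDerivAt.comp_hasDerivAt t h2
  rw [fderiv_expC] at h5
  exact h5

lemma isCompact_sublevel (hB : PotentialBounds ψ φ c C R) (hf : ContDiffOn ℝ ∞ f (torus k))
    (b : ℝ) : IsCompact {z | z ∈ zeroSet f ∧ torusPotential ψ z ≤ b} := by
  obtain ⟨M, hM⟩ := hB.exists_norm_le_of_le b
  set K : Set (Fin k → ℂ) := Set.pi Set.univ fun _ =>
    Metric.closedBall (0 : ℂ) (Real.exp M) ∩ {x | Real.exp (-M) ≤ ‖x‖} with hK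
  have hKc : IsCompact K := isCompact_univ_pi fun _ =>
    (isCompact_closedBall _ _).inter_right (isClosed_le continuous_const continuous_norm)
  have hKt : K ⊆ torus k := fun z hz i => by
    have h1 : Real.exp (-M) ≤ ‖z i‖ := (hz i (Set.mem_univ i)).2
    exact norm_pos_iff.1 ((Real.exp_pos _).trans_le h1)
  have hcont : ContinuousOn (fun z => (f z, torusPotential ψ z)) K :=
    (hf.continuousOn.mono hKt).prodMk fun z hz =>
      (contDiffAt_torusPotential hB.smooth (hKt hz)).continuousAt.continuousWithinAt
  have h1 : {z | z ∈ zeroSet f ∧ torusPotential ψ z ≤ b} =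
      K ∩ (fun z => (f z, torusPotential ψ z)) ⁻¹' ({0} ×ˢ Set.Iic b) := by
    ext z
    constructor
    · rintro ⟨⟨hz, hfz⟩, hb⟩
      refine ⟨fun i _ => ?_, hfz, hb⟩
      have h2 := abs_le.1 ((norm_le_pi_norm (Log z) i).trans (hM _ hb))
      have h3 : Real.exp (Real.log ‖z i‖) = ‖z i‖ := Real.exp_log (norm_pos_iff.2 (hz i))
      refine ⟨?_, ?_⟩
      · rw [mem_closedBall_zero_iff, ← h3]
        exact Real.exp_le_exp.2 h2.2
      · change Real.exp (-M) ≤ ‖z i‖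
        rw [← h3]
        exact Real.exp_le_exp.2 h2.1
    · rintro ⟨hz, hfz, hb⟩
      exact ⟨⟨hKt hz, hfz⟩, hb⟩
  rw [h1]
  exact hKc.of_isClosed_subset (hcont.preimage_isClosed_of_isClosed hKc.isClosed
    (isClosed_singleton.prod isClosed_Iic)) Set.inter_subset_left

lemma isMorseBottWeinstein (hB : PotentialBounds ψ φ c C R)
    (hS : IsSymplecticHypersurface ψ f) (hG : IsGradientLike ψ f) (hM : IsMorseBott ψ f) :
    IsMorseBottWeinstein ψ f :=
  ⟨hS, fun _ hz => exists_complete_curve hB hS hG hz, isCompact_sublevel hB hS.smooth, hG, hM⟩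

end

end Tailored

end

theorem mainTheorem11 (k : ℕ) (A : Finset (Fin k → ℤ)) (hzero : (0 : Fin k → ℤ) ∈ A)
    (hcard : 1 < A.card)
    (T : Geometry.SimplicialComplex ℝ (Fin k → ℝ))
    (hT : Tailored.IsStarShapedTriangulation A T)
    (ν : (Fin k → ℤ) → ℝ) (hν : Tailored.Induces A ν T)
    (hν0 : ν 0 = 0) (hνpos : ∀ a ∈ A, a ≠ 0 → 0 < ν a)
    (G : Matrix (Fin k) (Fin k) ℝ) (hG : G.PosDef)
    (ψ φ : (Fin k → ℝ) → ℝ) (hψ : Tailored.IsPotential ψ)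
    (hφ : Tailored.IsHomogeneousTwo φ)
    (hψφ : ∃ K : Set (Fin k → ℝ), IsCompact K ∧ ∀ x, x ∉ K → ψ x = φ x)
    (hadapted : Tailored.IsAdapted φ (Tailored.chamber A ν 0)) :
    ∃ ε₀ : ℝ, 0 < ε₀ ∧ ∀ ε₁ ε₂ : ℝ, 0 < ε₁ → ε₁ < ε₂ → ε₂ < ε₀ →
      ∀ χ : (Fin k → ℤ) → (Fin k → ℝ) → ℝ, Tailored.IsCutoffFamily A ν G ε₁ ε₂ χ →
        ∃ t₀ : ℝ, 1 < t₀ ∧ ∀ t : ℝ, t₀ ≤ t →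
          (∀ s ∈ Set.Icc (0 : ℝ) 1,
            Tailored.IsSymplecticHypersurface ψ (Tailored.tailoredFun A ν χ t s) ∧
            Tailored.IsGradientLike ψ (Tailored.tailoredFun A ν χ t s)) ∧
          Tailored.IsMorseBott ψ (Tailored.tailoredFun A ν χ t 1) ∧
          Tailored.IsMorseBottWeinstein ψ (Tailored.tailoredFun A ν χ t 1) := by
  have hA := Tailored.isCentralTriangulation hzero hT hν hν0 hνpos
  obtain ⟨c, C, R, hB⟩ := Tailored.exists_potentialBounds hψ hφ hψφ
  obtain ⟨X, S, hX⟩ := Tailored.exists_faceMinima hA hB hadapted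
  obtain ⟨ϱ₀, hϱ₀, ε', hε', hcut⟩ := Tailored.exists_cutoff_locally_const hA hX hG
  obtain ⟨D, hD, hheight⟩ := Tailored.exists_height_lt_of_metricDist_le hA hG
  obtain ⟨η, hη, hnear⟩ := hA.near_max
  obtain ⟨s₀, hs₀, hS⟩ := hX.exists_le_abs
  -- the accuracy that both localizes critical points and fixes the signs of the multipliers
  set ϱ := min ϱ₀ s₀ with hϱ
  obtain ⟨e, he, hcrit⟩ := Tailored.exists_near_critical hA hB hX
    (show 0 < ϱ from lt_min hϱ₀ hs₀)
  obtain ⟨κ₀, hκ₀, δ, hδ, hκ₀1, hκ₀2, hconst⟩ :=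
    Tailored.exists_gradientLike_const hB.c_pos hB.C_pos he
  set κ := min κ₀ (e / 2) with hκ
  have hκ0 : 0 < κ := lt_min hκ₀ (half_pos he)
  have hκ1 : κ ≤ κ₀ := min_le_left _ _
  have hκ2 : 2 * κ ≤ e := by linarith [min_le_right κ₀ (e / 2)]
  have hκ3 : 32 * C * κ ≤ c :=
    (mul_le_mul_of_nonneg_left hκ1 (by linarith [hB.C_pos])).trans hκ₀2
  obtain ⟨L₁, hL₁⟩ := Tailored.exists_Log_eq hA hB hs₀
  obtain ⟨L₂, hL₂⟩ := Tailored.exists_eq_zero_of_forall hA hB.c_pos hB.C_pos hs₀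
  refine ⟨min ε' (η / D), lt_min hε' (div_pos hη hD), fun ε₁ ε₂ hε₁ hε₁₂ hε₂ χ hχ => ?_⟩
  have hε₂0 : 0 < ε₂ := hε₁.trans hε₁₂
  obtain ⟨ι, hι, hιχ⟩ := hcut ε₁ ε₂ hε₁ hε₂0 (hε₂.trans_le (min_le_left _ _)) χ hχ
  have hDε : D * ε₂ < η := by
    rw [mul_comm, ← lt_div_iff₀ hD]; exact hε₂.trans_le (min_le_right _ _)
  have hnearby : ∀ p, ∀ a ∈ Tailored.nearby A ν G ε₂ p, ∀ b ∈ A,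
      Tailored.height ν b p < Tailored.height ν a p + D * ε₂ := fun p a ha b hb =>
    hheight ε₂ hε₂0 a ha.1 p ha.2 b hb
  obtain ⟨M, hM⟩ := Tailored.exists_fderiv_cutoff_bound hA hχ (fun p => by
    obtain ⟨σ, hσ, -, hσp⟩ := hnear p
    exact ⟨σ, hσ, fun a ha => hσp a ha.1 fun b hb => by linarith [hnearby p a ha b hb]⟩) hnearby
  have hgood := Tailored.eventually_isGoodZero hA hB hε₁ hχ hM hκ0 (X := X) (S := S) (e := e)
    (ϱ := ϱ) (ι := ι) (fun σ hσ u hu => hιχ σ hσ u (hu.trans_le (min_le_left _ _))) (hcrit ι hι)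
  obtain ⟨L₀, hL₀⟩ := Filter.eventually_atTop.1 (hgood.and ((Filter.eventually_gt_atTop L₁).and
    ((Filter.eventually_gt_atTop L₂).and (Filter.eventually_gt_atTop 0))))
  refine ⟨Real.exp (max L₀ 1), Real.one_lt_exp_iff.2 (by positivity), fun t ht => ?_⟩
  have ht0 : 0 < t := (Real.exp_pos _).trans_le ht
  obtain ⟨L, rfl⟩ : ∃ L, t = Real.exp L := ⟨Real.log t, (Real.exp_log ht0).symm⟩
  obtain ⟨hz, hLL₁, hLL₂, hL⟩ := hL₀ L ((le_max_left _ _).trans (Real.exp_le_exp.1 ht))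
  have hpart : ∀ s ∈ Set.Icc (0 : ℝ) 1,
      Tailored.IsSymplecticHypersurface ψ (Tailored.tailoredFun A ν χ (Real.exp L) s) ∧
      Tailored.IsGradientLike ψ (Tailored.tailoredFun A ν χ (Real.exp L) s) := fun s hs =>
    ⟨Tailored.isSymplecticHypersurface_tailoredFun hχ.smooth hB (hκ1.trans hκ₀1) hκ3 (hz s hs),
      Tailored.isGradientLike_tailoredFun hχ.smooth hB he hδ
        (fun hP p _ hq β hβ => hconst hP p hq β fun ξ => (hβ ξ).trans (by gcongr)) (hz s hs)⟩
  have h1 : (1 : ℝ) ∈ Set.Icc (0 : ℝ) 1 := by simp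
  have hMB := Tailored.isMorseBott_tailoredFun hA hχ.smooth hB.smooth hB.pinched hs₀ hL
    (fun x hx => Tailored.exists_criticalData hA hχ.smooth hB hX (hκ1.trans hκ₀1) hκ2 hL hS
      (min_le_right _ _) hx (hz 1 h1 x hx.1))
    (hL₁ L hLL₁ hL χ) (hL₂ L hLL₂ hL)
  exact ⟨hpart, hMB, Tailored.isMorseBottWeinstein hB (hpart 1 h1).1 (hpart 1 h1).2 hMB⟩
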